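/- A self-deleting graph is a pair $(G,f)$ where $G=(V,E)$ is a finite simple undirected graph and $f\colon V\to 2^E$. Put $n=|V|$, $m=|E|$ and $\mu=\max_{v\in V}|f(v)|$. A path $(v_1,e_1,v_2,\dots,e_{r-1},v_r)$ in $G$ with $e_i=\{v_i,v_{i+1}\}$ is $f$-conforming if $e_i\notin f(v_j)$ for all $j\le i$. In the problem Shortest Self-Deleting $s$-$t$-path one is given a self-deleting graph $(G,f)$ (as a list of edges together with, for each vertex $v$, the list of the edges in $f(v)$), vertices $s,t\in V$ and an integer $k\ge 1$, and has to decide whether there is an $f$-conforming $s$-$t$ path in $G$ on at most $k$ vertices. Theorem. On instances with $\mu\ge 1$, Shortest Self-Deleting $s$-$t$-path can be solved 1. by a deterministic algorithm in time $2^{O(k\log(k\max\{\mu,2\}))}\,(n+m)\log n$, and 2. by a deterministic algorithm in time $2^{O(\mu k)}\,(n+m)\log n$. Here time is the number of unit-cost operations of a word RAM; writing the time bound as $2^{O(g)}(n+m)\log n$, with $g=k\log_2(k\max\{\mu,2\})$ and $g=\mu k$ respectively, the algorithm works for every word length that is at least a suitable constant times $g+\log_2(n+m)$. -/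

import Mathlib

/-! ## Self-deleting graphs and the decision problem -/

/-- A self-deleting graph: a simple undirected graph together with a deletion function that assigns
to every vertex a set of edges of the graph. -/
structure SelfDeletingGraph (V : Type) where
  graph : SimpleGraph V
  del : V → Finset (Sym2 V)
  del_subset : ∀ v, ∀ e ∈ del v, e ∈ graph.edgeSet

namespace SelfDeletingGraph

variable {V : Type}

/-- A walk `v₀, e₀, v₁, e₁, …` with `eᵢ = {vᵢ, vᵢ₊₁}` is conforming if `eᵢ ∉ f(vⱼ)` for all
`j ≤ i`. -/
def Conforming (D : SelfDeletingGraph V) {s t : V} (p : D.graph.Walk s t) : Prop :=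
  ∀ i j : ℕ, j ≤ i → i < p.length →
    s(p.getVert i, p.getVert (i + 1)) ∉ D.del (p.getVert j)

/-- The number of edges of the graph. -/
noncomputable def edgeCount (D : SelfDeletingGraph V) : ℕ := D.graph.edgeSet.ncard

/-- The parameter `μ`: the maximum number of edges deleted by a single vertex. -/
def mu [Fintype V] (D : SelfDeletingGraph V) : ℕ := Finset.univ.sup fun v => (D.del v).card

end SelfDeletingGraph

/-- An instance of Shortest Self-Deleting `s`-`t`-path on the vertex set `{0, …, n - 1}`. -/
structure PathInstance (n : ℕ) extends SelfDeletingGraph (Fin n) where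
  s : Fin n
  t : Fin n
  k : ℕ
  k_pos : 0 < k

namespace PathInstance

variable {n : ℕ}

/-- Yes-instances: there is a conforming `s`-`t` path on at most `k` vertices
(a walk of length `l` has `l + 1` vertices). -/
def IsYes (I : PathInstance n) : Prop :=
  ∃ p : I.graph.Walk I.s I.t, p.IsPath ∧ I.Conforming p ∧ p.length + 1 ≤ I.k

/-- `I.IsEncodedBy x` says that the list of numbers `x` is an input representing the instance `I`:
the header `n, m, s, t, k`, then the end vertices of the `m` edges, every edge being listed exactly
once, in an arbitrary order and orientation, and then for each vertex `v = 0, …, n - 1` the number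
`|f(v)|` followed by the positions, in the list of edges, of the members of `f(v)`, each listed
once and in an arbitrary order. -/
def IsEncodedBy (I : PathInstance n) (x : List ℕ) : Prop :=
  ∃ (L : List (Fin n × Fin n)) (F : Fin n → List (Fin L.length)),
    (L.map fun a => s(a.1, a.2)).Nodup ∧
    (∀ e, e ∈ I.graph.edgeSet ↔ e ∈ L.map fun a => s(a.1, a.2)) ∧
    (∀ v, (F v).Nodup) ∧
    (∀ v e, e ∈ I.del v ↔ e ∈ (F v).map fun i => s((L.get i).1, (L.get i).2)) ∧
    x = [n, L.length, (I.s : ℕ), (I.t : ℕ), I.k] ++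
      (L.flatMap fun a => [(a.1 : ℕ), (a.2 : ℕ)]) ++
      ((List.finRange n).flatMap fun v => (F v).length :: (F v).map fun i => (i : ℕ))

end PathInstance

/-! ## The machine model: a word RAM with unit cost and structured control flow

A machine with word length `w` has registers and a memory, all of whose cells hold `w`-bit words,
that is, natural numbers below `2 ^ w`; memory cells are addressed by words. A program mentions only
finitely many registers. Every access to a register or to the memory, every arithmetic or logical
operation on words and every test costs one time unit. -/

namespace WordRAM

/-- The binary operations on words. -/
inductive Op
  | add | sub | mul | div | mod | and | or | xor | shl | shr | lt | eq

/-- The result of an operation, before truncation to `w` bits. Subtraction is cut off at `0`;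
comparisons return `0` or `1`. -/
def Op.eval : Op → ℕ → ℕ → ℕ
  | .add, a, b => a + b
  | .sub, a, b => a - b
  | .mul, a, b => a * b
  | .div, a, b => a / b
  | .mod, a, b => a % b
  | .and, a, b => a &&& b
  | .or, a, b => a ||| b
  | .xor, a, b => a ^^^ b
  | .shl, a, b => a <<< b
  | .shr, a, b => a >>> b
  | .lt, a, b => if a < b then 1 else 0
  | .eq, a, b => if a = b then 1 else 0

/-- Expressions: constants, registers, memory cells with computed address, operations. -/
inductive Expr
  | const (c : ℕ)
  | reg (r : ℕ)
  | load (a : Expr)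
  | op (o : Op) (a b : Expr)

/-- Structured programs. Tests are successful if the value of the expression is not `0`. -/
inductive Prog
  | skip
  | assign (r : ℕ) (e : Expr)
  | store (a e : Expr)
  | seq (p q : Prog)
  | ite (e : Expr) (p q : Prog)
  | loop (e : Expr) (p : Prog)

/-- The contents of the registers and of the memory. -/
structure State where
  reg : ℕ → ℕ
  mem : ℕ → ℕ

/-- The value of an expression on a machine with word length `w`. -/
def Expr.eval (w : ℕ) (σ : State) : Expr → ℕ
  | .const c => c % 2 ^ w
  | .reg r => σ.reg r
  | .load a => σ.mem (a.eval w σ)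
  | .op o a b => o.eval (a.eval w σ) (b.eval w σ) % 2 ^ w

/-- The time needed to evaluate an expression: one unit per node. -/
def Expr.cost : Expr → ℕ
  | .const _ => 1
  | .reg _ => 1
  | .load a => a.cost + 1
  | .op _ a b => a.cost + b.cost + 1

/-- `Exec w p σ T τ`: on a machine with word length `w`, the program `p` started in the state `σ`
halts after exactly `T` time units in the state `τ`. -/
inductive Exec (w : ℕ) : Prog → State → ℕ → State → Prop
  | skip (σ : State) : Exec w .skip σ 1 σ
  | assign (σ : State) (r : ℕ) (e : Expr) :
      Exec w (.assign r e) σ (e.cost + 1) ⟨Function.update σ.reg r (e.eval w σ), σ.mem⟩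
  | store (σ : State) (a e : Expr) :
      Exec w (.store a e) σ (a.cost + e.cost + 1)
        ⟨σ.reg, Function.update σ.mem (a.eval w σ) (e.eval w σ)⟩
  | seq {p q : Prog} {σ τ ρ : State} {T U : ℕ} :
      Exec w p σ T τ → Exec w q τ U ρ → Exec w (.seq p q) σ (T + U) ρ
  | ite_true {e : Expr} {p q : Prog} {σ τ : State} {T : ℕ} :
      e.eval w σ ≠ 0 → Exec w p σ T τ → Exec w (.ite e p q) σ (e.cost + 1 + T) τ
  | ite_false {e : Expr} {p q : Prog} {σ τ : State} {T : ℕ} :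
      e.eval w σ = 0 → Exec w q σ T τ → Exec w (.ite e p q) σ (e.cost + 1 + T) τ
  | loop_true {e : Expr} {p : Prog} {σ τ ρ : State} {T U : ℕ} :
      e.eval w σ ≠ 0 → Exec w p σ T τ → Exec w (.loop e p) τ U ρ →
        Exec w (.loop e p) σ (e.cost + 1 + T + U) ρ
  | loop_false {e : Expr} {p : Prog} {σ : State} :
      e.eval w σ = 0 → Exec w (.loop e p) σ (e.cost + 1) σ

/-- The machine is deterministic: the final state and the running time are determined by the
program, the word length and the initial state. -/
theorem Exec.deterministic {w : ℕ} {p : Prog} {σ τ τ' : State} {T T' : ℕ}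
    (h : Exec w p σ T τ) (h' : Exec w p σ T' τ') : T = T' ∧ τ = τ' := by
  induction h generalizing T' τ' with
  | skip => cases h'; exact ⟨rfl, rfl⟩
  | assign => cases h'; exact ⟨rfl, rfl⟩
  | store => cases h'; exact ⟨rfl, rfl⟩
  | seq _ _ ih₁ ih₂ =>
    cases h' with
    | seq a b =>
      obtain ⟨rfl, rfl⟩ := ih₁ a
      obtain ⟨rfl, rfl⟩ := ih₂ b
      exact ⟨rfl, rfl⟩
  | ite_true h _ ih =>
    cases h' with
    | ite_true _ a => obtain ⟨rfl, rfl⟩ := ih a; exact ⟨rfl, rfl⟩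
    | ite_false h0 _ => exact absurd h0 h
  | ite_false h _ ih =>
    cases h' with
    | ite_true h0 _ => exact absurd h h0
    | ite_false _ a => obtain ⟨rfl, rfl⟩ := ih a; exact ⟨rfl, rfl⟩
  | loop_true h _ _ ih₁ ih₂ =>
    cases h' with
    | loop_true _ a b =>
      obtain ⟨rfl, rfl⟩ := ih₁ a
      obtain ⟨rfl, rfl⟩ := ih₂ b
      exact ⟨rfl, rfl⟩
    | loop_false h0 => exact absurd h0 h
  | loop_false h =>
    cases h' with
    | loop_true h0 _ _ => exact absurd h h0
    | loop_false _ => exact ⟨rfl, rfl⟩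

/-- The initial state: the input `x` stands in the memory cells `0, 1, …`, all other cells and all
registers hold `0`. -/
def initState (w : ℕ) (x : List ℕ) : State :=
  ⟨fun _ => 0, fun a => x.getD a 0 % 2 ^ w⟩

/-- With word length `w` the program `p` decides the statement `Q` on input `x` within `B` time
units: it halts within that time, with `1` in register `0` if `Q` holds and `0` otherwise. -/
def DecidesWithin (p : Prog) (w : ℕ) (x : List ℕ) (Q : Prop) (B : ℝ) : Prop :=
  ∃ (T : ℕ) (τ : State), Exec w p (initState w x) T τ ∧ (T : ℝ) ≤ B ∧
    (Q → τ.reg 0 = 1) ∧ (¬ Q → τ.reg 0 = 0)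

end WordRAM

/-- Shortest Self-Deleting `s`-`t`-path is solvable in `2 ^ O(g(k, μ)) * (n + m) * log n` time: a
single program decides all instances with `μ ≥ 1` within this time, on every machine whose word
length is at least a constant times `g(k, μ) + log (n + m)`, so that words can address
`2 ^ O(g(k, μ)) * (n + m) ^ O(1)` memory cells. (For `μ ≥ 1` there is an edge, so `n ≥ 2`
and `log n ≥ 1`.) -/
def ShortestPathSolvableInTime (g : ℕ → ℕ → ℝ) : Prop :=
  ∃ (p : WordRAM.Prog) (C : ℝ), ∀ (n : ℕ) (I : PathInstance n) (x : List ℕ),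
    1 ≤ I.mu → I.IsEncodedBy x →
    ∀ w : ℕ, C * (g I.k I.mu + Real.logb 2 ((n : ℝ) + I.edgeCount)) ≤ w →
      WordRAM.DecidesWithin p w x I.IsYes
        ((2 : ℝ) ^ (C * g I.k I.mu) * ((n : ℝ) + I.edgeCount) * Real.logb 2 n)

/-! It is enough to look for a conforming walk with fewer than `k` edges from `s` to `t`. Cutting a
closed part out of a conforming walk only shrinks the set of vertices that precede each remaining
edge, so the walk stays conforming, and repeated cutting ends in a path (`exists_injOn_confWalk`). A
dynamic program over the number of edges therefore need not remember which vertices were visited.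
All that matters about a prefix is the set of edges forbidden by its vertices, which has at most `p
= k * μ` elements. This set has to avoid the edge set `Q` of the rest of the walk, which has at most
`k` elements.

For each level and each end vertex only a representative family of prefixes is kept: whenever some
prefix avoids `Q`, a kept one avoids `Q`. The families come from linear algebra over a prime field
with `P` elements, where `P > m + p + 1`. A list `l` of forbidden edges is sent to the function `ys
↦ ∏ (a - y)`, the product running over all `a` in `l` and `y` in `ys`. At `Q` it is nonzero exactly
if `l` and `Q` are disjoint (`avoidVal_ne_zero_iff`). For a fixed number of points this is a
symmetric polynomial of degree at most `p` in each variable, so its values at nonincreasing lists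
with entries in `{0, …, p}` determine it, and so do linear relations between such functions
(`sum_avoidVal_eq_zero`). Each prefix thus becomes a vector of length `N = pointCount p k`. If its
vector lies in the span of kept vectors that all vanish at `Q`, then it vanishes at `Q` as well
(`exists_disjoint_of_mem_span`). So it suffices to keep prefixes with linearly independent vectors,
at most `N` per family, and Gaussian elimination finds them.

One candidate costs `O(N ^ 2)`. There are fewer than `N` levels, `2 * m` directed edges and at most
`N` prefixes to extend along each, hence `O(N ^ 4 * (m + 1))` for all levels. The prime is found by
a sieve up to `2 * (m + p + 1)`, whose harmonic sum accounts for the factor `log n`. Finally `N ≤ (p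
+ k + 2).choose k`; bounding this binomial coefficient by a power of two or by a `k`-th power gives
the two running times.

The algorithm is written in a small language of bounded loops. `Cmd.exec_toProg` transfers run and
time to the word RAM as long as no number overflows, and the rules `Achieves` prove correctness,
time and absence of overflow together. -/

namespace WordRAM

/-! ## A language of bounded loops over the word RAM

Registers are used as immutable, lexically scoped variables, and sixteen unbounded arrays, which are
interleaved in the memory behind the input, hold the mutable data. -/

/-- The contents of the arrays. -/
abbrev Arrays := ℕ → ℕ → ℕ

/-- Change one cell of one array. -/
def Arrays.set (A : Arrays) (a i v : ℕ) : Arrays :=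
  fun a' i' => if a' = a ∧ i' = i then v else A a' i'

@[simp] theorem Arrays.set_same (A : Arrays) (a i v : ℕ) : A.set a i v a i = v := by
  simp [Arrays.set]

theorem Arrays.set_index_ne (A : Arrays) {a i v i' : ℕ} (h : i' ≠ i) :
    A.set a i v a i' = A a i' := by
  simp [Arrays.set, h]

theorem Arrays.set_array_ne (A : Arrays) {a i v a' : ℕ} (h : a' ≠ a) :
    A.set a i v a' = A a' := by
  funext i'; simp [Arrays.set, h]

/-- Expressions over variables, input cells and array cells. -/
inductive Term
  | const (c : ℕ)
  | var (r : ℕ)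
  | input (e : Term)
  | arr (a : ℕ) (e : Term)
  | op (o : Op) (a b : Term)

namespace Term

instance : Add Term := ⟨.op .add⟩
instance : Sub Term := ⟨.op .sub⟩
instance : Mul Term := ⟨.op .mul⟩
instance : Div Term := ⟨.op .div⟩
instance : Mod Term := ⟨.op .mod⟩
instance (n : ℕ) : OfNat Term n := ⟨.const n⟩

/-- The value of an expression, without truncation. -/
def val (x env : ℕ → ℕ) (A : Arrays) : Term → ℕ
  | .const c => c
  | .var r => env r
  | .input e => x (e.val x env A)
  | .arr a e => A a (e.val x env A)
  | .op o a b => o.eval (a.val x env A) (b.val x env A)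

/-- All intermediate results are below `V`, and input accesses stay below `base`. -/
def Bounded (base V : ℕ) (x env : ℕ → ℕ) (A : Arrays) : Term → Prop
  | .const c => c < V
  | .var _ => True
  | .input e => e.Bounded base V x env A ∧ e.val x env A < base
  | .arr _ e => e.Bounded base V x env A ∧ e.val x env A < V
  | .op o a b => (a.Bounded base V x env A ∧ b.Bounded base V x env A) ∧
      o.eval (a.val x env A) (b.val x env A) < V

/-- Only variables from `S` and arrays below `16` are mentioned. -/
def wf (S : List ℕ) : Term → Bool
  | .const _ => true
  | .var r => S.contains r
  | .input e => e.wf S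
  | .arr a e => decide (a < 16) && e.wf S
  | .op _ a b => a.wf S && b.wf S

/-- The translation to machine expressions; register `2` holds the start of the arrays. -/
def toExpr : Term → Expr
  | .const c => .const c
  | .var r => .reg r
  | .input e => .load e.toExpr
  | .arr a e => .load (.op .add (.reg 2) (.op .add (.op .mul (.const 16) e.toExpr) (.const a)))
  | .op o a b => .op o a.toExpr b.toExpr

/-- The time needed to evaluate the translated expression. -/
def cost : Term → ℕ
  | .const _ => 1
  | .var _ => 1
  | .input e => e.cost + 1
  | .arr _ e => e.cost + 7
  | .op _ a b => a.cost + b.cost + 1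

theorem cost_toExpr (e : Term) : e.toExpr.cost = e.cost := by
  induction e with
  | const | var => rfl
  | input e ih => simp [toExpr, Expr.cost, cost, ih]
  | arr a e ih => simp [toExpr, Expr.cost, cost, ih]; omega
  | op o a b iha ihb => simp [toExpr, Expr.cost, cost, iha, ihb]

section simp_lemmas

variable (base V : ℕ) (x env : ℕ → ℕ) (A : Arrays) (a b : Term)

@[simp] theorem val_const (c : ℕ) : (Term.const c).val x env A = c := rfl
@[simp] theorem val_ofNat (c : ℕ) : (ofNat(c) : Term).val x env A = c := rfl
@[simp] theorem val_var (r : ℕ) : (Term.var r).val x env A = env r := rfl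
@[simp] theorem val_input : (Term.input a).val x env A = x (a.val x env A) := rfl
@[simp] theorem val_arr (i : ℕ) : (Term.arr i a).val x env A = A i (a.val x env A) := rfl
@[simp] theorem val_add : (a + b).val x env A = a.val x env A + b.val x env A := rfl
@[simp] theorem val_sub : (a - b).val x env A = a.val x env A - b.val x env A := rfl
@[simp] theorem val_mul : (a * b).val x env A = a.val x env A * b.val x env A := rfl
@[simp] theorem val_div : (a / b).val x env A = a.val x env A / b.val x env A := rfl
@[simp] theorem val_mod : (a % b).val x env A = a.val x env A % b.val x env A := rfl
@[simp] theorem val_lt : (Term.op .lt a b).val x env A =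
    if a.val x env A < b.val x env A then 1 else 0 := rfl
@[simp] theorem val_eq : (Term.op .eq a b).val x env A =
    if a.val x env A = b.val x env A then 1 else 0 := rfl

@[simp] theorem bounded_const (c : ℕ) : (Term.const c).Bounded base V x env A ↔ c < V := Iff.rfl
@[simp] theorem bounded_ofNat (c : ℕ) :
    (ofNat(c) : Term).Bounded base V x env A ↔ c < V := Iff.rfl
@[simp] theorem bounded_var (r : ℕ) : (Term.var r).Bounded base V x env A := trivial
@[simp] theorem bounded_input : (Term.input a).Bounded base V x env A ↔
    a.Bounded base V x env A ∧ a.val x env A < base := Iff.rfl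
@[simp] theorem bounded_arr (i : ℕ) : (Term.arr i a).Bounded base V x env A ↔
    a.Bounded base V x env A ∧ a.val x env A < V := Iff.rfl
@[simp] theorem bounded_add : (a + b).Bounded base V x env A ↔
    (a.Bounded base V x env A ∧ b.Bounded base V x env A) ∧
      a.val x env A + b.val x env A < V := Iff.rfl
@[simp] theorem bounded_mul : (a * b).Bounded base V x env A ↔
    (a.Bounded base V x env A ∧ b.Bounded base V x env A) ∧
      a.val x env A * b.val x env A < V := Iff.rfl
@[simp] theorem bounded_sub : (a - b).Bounded base V x env A ↔
    (a.Bounded base V x env A ∧ b.Bounded base V x env A) ∧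
      a.val x env A - b.val x env A < V := Iff.rfl
@[simp] theorem bounded_div : (a / b).Bounded base V x env A ↔
    (a.Bounded base V x env A ∧ b.Bounded base V x env A) ∧
      a.val x env A / b.val x env A < V := Iff.rfl
@[simp] theorem bounded_mod : (a % b).Bounded base V x env A ↔
    (a.Bounded base V x env A ∧ b.Bounded base V x env A) ∧
      a.val x env A % b.val x env A < V := Iff.rfl
@[simp] theorem bounded_lt : (Term.op .lt a b).Bounded base V x env A ↔
    (a.Bounded base V x env A ∧ b.Bounded base V x env A) ∧
      (if a.val x env A < b.val x env A then 1 else 0) < V := Iff.rfl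

@[simp] theorem cost_const (c : ℕ) : (Term.const c).cost = 1 := rfl
@[simp] theorem cost_ofNat (c : ℕ) : (ofNat(c) : Term).cost = 1 := rfl
@[simp] theorem cost_var (r : ℕ) : (Term.var r).cost = 1 := rfl
@[simp] theorem cost_input : (Term.input a).cost = a.cost + 1 := rfl
@[simp] theorem cost_arr (i : ℕ) : (Term.arr i a).cost = a.cost + 7 := rfl
@[simp] theorem cost_op (o : Op) : (Term.op o a b).cost = a.cost + b.cost + 1 := rfl
@[simp] theorem cost_add : (a + b).cost = a.cost + b.cost + 1 := rfl
@[simp] theorem cost_sub : (a - b).cost = a.cost + b.cost + 1 := rfl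
@[simp] theorem cost_mul : (a * b).cost = a.cost + b.cost + 1 := rfl
@[simp] theorem cost_div : (a / b).cost = a.cost + b.cost + 1 := rfl
@[simp] theorem cost_mod : (a % b).cost = a.cost + b.cost + 1 := rfl

end simp_lemmas

end Term

/-- Commands. The variable of `bind` and the variable `r` of `loop` (which runs through
`0, …, e - 1`) are visible in the body only; `loop` also uses the register `r + 1`. -/
inductive Cmd
  | skip
  | set (a : ℕ) (i e : Term)
  | bind (r : ℕ) (e : Term) (c : Cmd)
  | seq (c₁ c₂ : Cmd)
  | ite (e : Term) (c₁ c₂ : Cmd)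
  | loop (r : ℕ) (e : Term) (c : Cmd)

namespace Cmd

/-- The assignment of variables in the body of a loop. -/
def loopEnv (env : ℕ → ℕ) (r i b : ℕ) : ℕ → ℕ :=
  Function.update (Function.update env r i) (r + 1) b

/-- The effect of a command on the arrays. -/
def run (x : ℕ → ℕ) : Cmd → (ℕ → ℕ) → Arrays → Arrays
  | .skip, _, A => A
  | .set a i e, env, A => A.set a (i.val x env A) (e.val x env A)
  | .bind r e c, env, A => c.run x (Function.update env r (e.val x env A)) A
  | .seq c₁ c₂, env, A => c₂.run x env (c₁.run x env A)
  | .ite e c₁ c₂, env, A => if e.val x env A ≠ 0 then c₁.run x env A else c₂.run x env A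
  | .loop r e c, env, A =>
      Nat.rec A (fun i A' => c.run x (loopEnv env r i (e.val x env A)) A') (e.val x env A)

/-- The state of the arrays after `i` rounds of a loop with bound `b`. -/
def rounds (x : ℕ → ℕ) (r : ℕ) (c : Cmd) (env : ℕ → ℕ) (A : Arrays) (b : ℕ) (i : ℕ) : Arrays :=
  Nat.rec A (fun i A' => c.run x (loopEnv env r i b) A') i

/-- The running time of the translated command. -/
def time (x : ℕ → ℕ) : Cmd → (ℕ → ℕ) → Arrays → ℕ
  | .skip, _, _ => 1
  | .set _ i e, _, _ => i.cost + 6 + e.cost + 1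
  | .bind r e c, env, A => e.cost + 1 + c.time x (Function.update env r (e.val x env A)) A
  | .seq c₁ c₂, env, A => c₁.time x env A + c₂.time x env (c₁.run x env A)
  | .ite e c₁ c₂, env, A =>
      e.cost + 1 + if e.val x env A ≠ 0 then c₁.time x env A else c₂.time x env A
  | .loop r e c, env, A =>
      2 + (e.cost + 1) + (∑ i ∈ Finset.range (e.val x env A),
        (c.time x (loopEnv env r i (e.val x env A))
          (rounds x r c env A (e.val x env A) i) + 8) + 4)

/-- All numbers that occur are below `V`, and input accesses stay below `base`. -/
def Bounded (base V : ℕ) (x : ℕ → ℕ) : Cmd → (ℕ → ℕ) → Arrays → Prop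
  | .skip, _, _ => True
  | .set _ i e, env, A =>
      i.Bounded base V x env A ∧ e.Bounded base V x env A ∧ i.val x env A < V
  | .bind r e c, env, A => e.Bounded base V x env A ∧
      c.Bounded base V x (Function.update env r (e.val x env A)) A
  | .seq c₁ c₂, env, A => c₁.Bounded base V x env A ∧ c₂.Bounded base V x env (c₁.run x env A)
  | .ite e c₁ c₂, env, A => e.Bounded base V x env A ∧
      (e.val x env A ≠ 0 → c₁.Bounded base V x env A) ∧
      (e.val x env A = 0 → c₂.Bounded base V x env A)
  | .loop r e c, env, A => e.Bounded base V x env A ∧ e.val x env A < V ∧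
      ∀ i < e.val x env A, c.Bounded base V x (loopEnv env r i (e.val x env A))
        (rounds x r c env A (e.val x env A) i)

/-- Scoping: only variables from `S` are in scope, and they are not overwritten. -/
def wf : List ℕ → Cmd → Bool
  | _, .skip => true
  | S, .set a i e => decide (a < 16) && i.wf S && e.wf S
  | S, .bind r e c => S.all (· < r) && e.wf S && c.wf (r :: S)
  | S, .seq c₁ c₂ => c₁.wf S && c₂.wf S
  | S, .ite e c₁ c₂ => e.wf S && c₁.wf S && c₂.wf S
  | S, .loop r e c => S.all (· < r) && e.wf S && c.wf (r :: (r + 1) :: S)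

/-- The translation to machine programs. -/
def toProg : Cmd → Prog
  | .skip => .skip
  | .set a i e =>
      .store (.op .add (.reg 2) (.op .add (.op .mul (.const 16) i.toExpr) (.const a))) e.toExpr
  | .bind r e c => .seq (.assign r e.toExpr) c.toProg
  | .seq c₁ c₂ => .seq c₁.toProg c₂.toProg
  | .ite e c₁ c₂ => .ite e.toExpr c₁.toProg c₂.toProg
  | .loop r e c =>
      .seq (.seq (.assign r (.const 0)) (.assign (r + 1) e.toExpr))
        (.loop (.op .lt (.reg r) (.reg (r + 1)))
          (.seq c.toProg (.assign r (.op .add (.reg r) (.const 1)))))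

/-- The arrays that a command may change. -/
def writes : Cmd → List ℕ
  | .skip => []
  | .set a _ _ => [a]
  | .bind _ _ c => c.writes
  | .seq c₁ c₂ => c₁.writes ++ c₂.writes
  | .ite _ c₁ c₂ => c₁.writes ++ c₂.writes
  | .loop _ _ c => c.writes

/-- This frame property keeps the loop invariants short: they mention only the arrays that the body
changes. -/
theorem run_eq_of_notMem_writes (x : ℕ → ℕ) (c : Cmd) (env : ℕ → ℕ) (A : Arrays) (a : ℕ)
    (ha : a ∉ c.writes) : c.run x env A a = A a := by
  induction c generalizing env A with
  | skip => rfl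
  | set b i e => exact Arrays.set_array_ne _ (by simpa [writes] using ha)
  | bind r e c ih => exact ih _ _ ha
  | seq c₁ c₂ ih₁ ih₂ =>
    simp only [writes, List.mem_append, not_or] at ha
    rw [run, ih₂ _ _ ha.2, ih₁ _ _ ha.1]
  | ite e c₁ c₂ ih₁ ih₂ =>
    simp only [writes, List.mem_append, not_or] at ha
    rw [run]
    split
    · exact ih₁ _ _ ha.1
    · exact ih₂ _ _ ha.2
  | loop r e c ih =>
    rw [run]
    generalize e.val x env A = b
    suffices h : ∀ i, (Nat.rec A (fun i A' => c.run x (loopEnv env r i b) A') i : Arrays) a = A a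
      from h b
    intro i
    induction i with
    | zero => rfl
    | succ i ihi => exact (ih _ _ ha).trans ihi

end Cmd

/-- The memory with input `x` below `base` and the interleaved arrays from there on. -/
def layout (base : ℕ) (x : ℕ → ℕ) (A : Arrays) : ℕ → ℕ :=
  fun a => if a < base then x a else A ((a - base) % 16) ((a - base) / 16)

theorem layout_arr (base : ℕ) (x : ℕ → ℕ) (A : Arrays) {a : ℕ} (ha : a < 16) (i : ℕ) :
    layout base x A (base + (16 * i + a)) = A a i := by
  have h₁ : (16 * i + a) % 16 = a := by omega
  have h₂ : (16 * i + a) / 16 = i := by omega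
  simp [layout, h₁, h₂]

theorem layout_set (base : ℕ) (x : ℕ → ℕ) (A : Arrays) {a : ℕ} (ha : a < 16) (i v : ℕ) :
    Function.update (layout base x A) (base + (16 * i + a)) v = layout base x (A.set a i v) := by
  funext j
  by_cases hj : j = base + (16 * i + a)
  · subst hj; simp [layout_arr _ _ _ ha]
  · rw [Function.update_of_ne hj]
    simp only [layout]
    split
    · rfl
    · rw [Arrays.set, if_neg]
      rintro ⟨h₁, h₂⟩
      apply hj
      omega

section simulation

variable {w base V : ℕ} {x : ℕ → ℕ}

/-- Nothing is truncated: a cell `i < V` of an array `a < 16` has address `base + 16 * i + a`, which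
is below `base + 16 * V + 16 ≤ 2 ^ w`, and every other intermediate value is below `V` or is a
variable, which is read unchanged. -/
theorem Term.eval_toExpr (hw : base + 16 * V + 16 ≤ 2 ^ w) {S : List ℕ} {env : ℕ → ℕ}
    {A : Arrays} {σ : State} (hd : 2 ∈ S) (hbase : env 2 = base) (hreg : ∀ i ∈ S, σ.reg i = env i)
    (hmem : σ.mem = layout base x A) (e : Term) (hwf : e.wf S = true)
    (hb : e.Bounded base V x env A) : e.toExpr.eval w σ = e.val x env A := by
  induction e with
  | const c => exact Nat.mod_eq_of_lt (lt_of_lt_of_le hb (by omega))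
  | var r => exact hreg r (by simpa [wf] using hwf)
  | input e ih =>
    simp only [toExpr, Expr.eval, ih hwf hb.1, hmem, val, layout, if_pos hb.2]
  | arr a e ih =>
    simp only [wf, Bool.and_eq_true, decide_eq_true_eq] at hwf
    obtain ⟨hb₁, hb₂⟩ := hb
    simp only [toExpr, Expr.eval, ih hwf.2 hb₁, hmem, val, Op.eval, hreg 2 hd, hbase]
    rw [Nat.mod_eq_of_lt (show 16 < 2 ^ w by omega), Nat.mod_eq_of_lt (show a < 2 ^ w by omega),
      Nat.mod_eq_of_lt (show 16 * e.val x env A < 2 ^ w by omega),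
      Nat.mod_eq_of_lt (show 16 * e.val x env A + a < 2 ^ w by omega),
      Nat.mod_eq_of_lt (by omega), layout_arr _ _ _ hwf.1]
  | op o a b iha ihb =>
    simp only [wf, Bool.and_eq_true] at hwf
    obtain ⟨⟨hb₁, hb₂⟩, hb₃⟩ := hb
    simp only [toExpr, Expr.eval, iha hwf.1 hb₁, ihb hwf.2 hb₂, val]
    exact Nat.mod_eq_of_lt (lt_of_lt_of_le hb₃ (by omega))

theorem Cmd.rounds_succ (r : ℕ) (c : Cmd) (env : ℕ → ℕ) (A : Arrays) (b i : ℕ) :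
    rounds x r c env A b (i + 1) = c.run x (loopEnv env r i b) (rounds x r c env A b i) := rfl

/-- The translated program does what the command says, in the stated time. -/
theorem Cmd.exec_toProg (hw : base + 16 * V + 16 ≤ 2 ^ w) (c : Cmd) {S : List ℕ} {env : ℕ → ℕ}
    {A : Arrays} {σ : State} (hd : 2 ∈ S) (hbase : env 2 = base)
    (hreg : ∀ i ∈ S, σ.reg i = env i) (hmem : σ.mem = layout base x A) (hwf : c.wf S = true)
    (hb : c.Bounded base V x env A) :
    ∃ τ, Exec w c.toProg σ (c.time x env A) τ ∧ (∀ i ∈ S, τ.reg i = env i) ∧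
      τ.mem = layout base x (c.run x env A) := by
  induction c generalizing S env A σ with
  | skip => exact ⟨σ, .skip σ, hreg, hmem⟩
  | set a i e =>
    simp only [wf, Bool.and_eq_true, decide_eq_true_eq] at hwf
    obtain ⟨⟨ha, hi⟩, he⟩ := hwf
    obtain ⟨hb₁, hb₂, hb₃⟩ := hb
    have hexec := Exec.store (w := w) σ
      (.op .add (.reg 2) (.op .add (.op .mul (.const 16) i.toExpr) (.const a))) e.toExpr
    have h₁ := Term.eval_toExpr hw hd hbase hreg hmem i hi hb₁
    have h₂ := Term.eval_toExpr hw hd hbase hreg hmem e he hb₂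
    simp only [Expr.eval, Op.eval, h₁, h₂, hreg 2 hd, hbase, Expr.cost, Term.cost_toExpr] at hexec
    rw [Nat.mod_eq_of_lt (show 16 < 2 ^ w by omega), Nat.mod_eq_of_lt (show a < 2 ^ w by omega),
      Nat.mod_eq_of_lt (show 16 * i.val x env A < 2 ^ w by omega),
      Nat.mod_eq_of_lt (show 16 * i.val x env A + a < 2 ^ w by omega),
      Nat.mod_eq_of_lt (by omega), hmem, layout_set _ _ _ ha] at hexec
    refine ⟨⟨σ.reg, layout base x (A.set a (i.val x env A) (e.val x env A))⟩, ?_, hreg, rfl⟩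
    rw [show 1 + (1 + i.cost + 1 + 1 + 1) + 1 + e.cost + 1 = i.cost + 6 + e.cost + 1 by omega]
      at hexec
    exact hexec
  | bind r e c ih =>
    simp only [wf, Bool.and_eq_true, List.all_eq_true, decide_eq_true_eq] at hwf
    obtain ⟨⟨hdr, he⟩, hc⟩ := hwf
    have h₁ := Term.eval_toExpr hw hd hbase hreg hmem e he hb.1
    have hexec := Exec.assign (w := w) σ r e.toExpr
    rw [h₁, Term.cost_toExpr] at hexec
    have hne : ∀ i ∈ S, i ≠ r := fun i hi => (hdr i hi).ne
    obtain ⟨τ, hτ, hτr, hτm⟩ := ih (S := r :: S)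
      (env := Function.update env r (e.val x env A)) (A := A)
      (σ := ⟨Function.update σ.reg r (e.val x env A), σ.mem⟩) (by simp [hd])
      (by rw [Function.update_of_ne (hne 2 hd), hbase])
      (by
        intro i hi
        by_cases hir : i = r
        · subst hir; simp
        · simp only [Function.update_of_ne hir]
          exact hreg i (by simpa [hir] using hi)) hmem hc hb.2
    refine ⟨τ, .seq hexec hτ, fun i hi => ?_, hτm⟩
    rw [hτr i (by simp [hi]), Function.update_of_ne (hne i hi)]
  | seq c₁ c₂ ih₁ ih₂ =>
    simp only [wf, Bool.and_eq_true] at hwf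
    obtain ⟨τ, hτ, hτr, hτm⟩ := ih₁ hd hbase hreg hmem hwf.1 hb.1
    obtain ⟨ρ, hρ, hρr, hρm⟩ := ih₂ hd hbase hτr hτm hwf.2 hb.2
    exact ⟨ρ, .seq hτ hρ, hρr, hρm⟩
  | ite e c₁ c₂ ih₁ ih₂ =>
    simp only [wf, Bool.and_eq_true] at hwf
    have h₁ := Term.eval_toExpr hw hd hbase hreg hmem e hwf.1.1 hb.1
    by_cases he : e.val x env A = 0
    · obtain ⟨τ, hτ, hτr, hτm⟩ := ih₂ hd hbase hreg hmem hwf.2 (hb.2.2 he)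
      refine ⟨τ, ?_, hτr, by simpa [run, he] using hτm⟩
      have := Exec.ite_false (p := c₁.toProg) (h₁.trans he) hτ
      simpa [time, toProg, he, Term.cost_toExpr] using this
    · obtain ⟨τ, hτ, hτr, hτm⟩ := ih₁ hd hbase hreg hmem hwf.1.2 (hb.2.1 he)
      refine ⟨τ, ?_, hτr, by simpa [run, he] using hτm⟩
      have := Exec.ite_true (q := c₂.toProg) (h₁.symm ▸ he) hτ
      simpa [time, toProg, he, Term.cost_toExpr] using this
  | loop r e c ih =>
    simp only [wf, Bool.and_eq_true, List.all_eq_true, decide_eq_true_eq] at hwf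
    obtain ⟨⟨hdr, he⟩, hc⟩ := hwf
    have hne : ∀ i ∈ S, i ≠ r ∧ i ≠ r + 1 := fun i hi => by have := hdr i hi; omega
    obtain ⟨hb₁, hb₂, hb₃⟩ := hb
    have hzero : (0 : ℕ) % 2 ^ w = 0 := Nat.zero_mod _
    have hexec₁ := Exec.assign (w := w) σ r (.const 0)
    simp only [Expr.eval, hzero, Expr.cost] at hexec₁
    have h₁ : e.toExpr.eval w ⟨Function.update σ.reg r 0, σ.mem⟩ = e.val x env A := by
      refine Term.eval_toExpr (S := S) (σ := ⟨Function.update σ.reg r 0, σ.mem⟩) hw hd hbase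
        (fun i hi => ?_) hmem e he hb₁
      simp only
      rw [Function.update_of_ne (hne i hi).1]; exact hreg i hi
    have hexec₂ := Exec.assign (w := w) ⟨Function.update σ.reg r 0, σ.mem⟩ (r + 1) e.toExpr
    rw [h₁, Term.cost_toExpr] at hexec₂
    set b := e.val x env A with hbdef
    -- Induction on the number `j` of rounds still to be done, so that the loop is entered with
    -- counter `b - j`.
    have key : ∀ j, ∀ ρ : State, j ≤ b → ρ.reg r = b - j → ρ.reg (r + 1) = b →
        (∀ i ∈ S, ρ.reg i = env i) → ρ.mem = layout base x (rounds x r c env A b (b - j)) →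
        ∃ τ, Exec w (.loop (.op .lt (.reg r) (.reg (r + 1)))
          (.seq c.toProg (.assign r (.op .add (.reg r) (.const 1))))) ρ
          (∑ i ∈ Finset.Ico (b - j) b,
            (c.time x (loopEnv env r i b) (rounds x r c env A b i) + 8) + 4) τ ∧
          (∀ i ∈ S, τ.reg i = env i) ∧ τ.mem = layout base x (rounds x r c env A b b) := by
      intro j
      have hone : 1 % 2 ^ w = 1 := Nat.mod_eq_of_lt (by omega)
      induction j with
      | zero =>
        intro ρ _ hr hr1 hS hm
        refine ⟨ρ, ?_, hS, by simpa using hm⟩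
        have := Exec.loop_false (w := w) (e := .op .lt (.reg r) (.reg (r + 1)))
          (p := .seq c.toProg (.assign r (.op .add (.reg r) (.const 1)))) (σ := ρ)
          (by simp [Expr.eval, Op.eval, hr, hr1])
        simpa [Expr.cost] using this
      | succ j ihj =>
        intro ρ hj hr hr1 hS hm
        have hlt : b - (j + 1) < b := by omega
        obtain ⟨τ, hτ, hτr, hτm⟩ := ih (S := r :: (r + 1) :: S)
          (env := loopEnv env r (b - (j + 1)) b) (A := rounds x r c env A b (b - (j + 1)))
          (σ := ρ) (by simp [hd])
          (by
            rw [loopEnv, Function.update_of_ne (hne 2 hd).2, Function.update_of_ne (hne 2 hd).1,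
              hbase])
          (by
            intro i hi
            simp only [List.mem_cons] at hi
            rcases hi with rfl | rfl | hi
            · rw [loopEnv, Function.update_of_ne (by omega), Function.update_self, hr]
            · rw [loopEnv, Function.update_self, hr1]
            · rw [loopEnv, Function.update_of_ne (hne i hi).2, Function.update_of_ne (hne i hi).1,
                hS i hi]) hm hc (hb₃ _ hlt)
        have hτr0 : τ.reg r = b - (j + 1) := by
          rw [hτr r (by simp), loopEnv, Function.update_of_ne (by omega), Function.update_self]
        have hinc := Exec.assign (w := w) τ r (.op .add (.reg r) (.const 1))
        have hval : (Expr.op .add (.reg r) (.const 1)).eval w τ = b - j := by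
          simp only [Expr.eval, Op.eval, hτr0, hone]
          rw [Nat.mod_eq_of_lt (by omega)]; omega
        rw [hval] at hinc
        obtain ⟨τ', hτ', hτ'r, hτ'm⟩ := ihj ⟨Function.update τ.reg r (b - j), τ.mem⟩ (by omega)
          (by simp)
          (by
            simp only
            rw [Function.update_of_ne (by omega), hτr (r + 1) (by simp), loopEnv,
              Function.update_self])
          (by
            intro i hi
            simp only
            rw [Function.update_of_ne (hne i hi).1, hτr i (by simp [hi]), loopEnv,
              Function.update_of_ne (hne i hi).2, Function.update_of_ne (hne i hi).1])
          (by
            simp only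
            rw [hτm, ← rounds_succ, show b - (j + 1) + 1 = b - j by omega])
        refine ⟨τ', ?_, hτ'r, hτ'm⟩
        have hcond : (Expr.op .lt (.reg r) (.reg (r + 1))).eval w ρ ≠ 0 := by
          simp [Expr.eval, Op.eval, hr, hr1, hlt, hone]
        have := Exec.loop_true hcond (.seq hτ hinc) hτ'
        convert this using 1
        rw [Finset.sum_eq_sum_Ico_succ_bot hlt, show b - (j + 1) + 1 = b - j by omega]
        simp only [Expr.cost]
        omega
    obtain ⟨τ, hτ, hτr, hτm⟩ := key b
      ⟨Function.update (Function.update σ.reg r 0) (r + 1) b, σ.mem⟩ le_rfl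
      (by simp only; rw [Function.update_of_ne (by omega), Function.update_self]; omega)
      (by simp)
      (by
        intro i hi
        simp only
        rw [Function.update_of_ne (hne i hi).2, Function.update_of_ne (hne i hi).1, hreg i hi])
      (by simpa [rounds] using hmem)
    refine ⟨τ, ?_, hτr, hτm⟩
    have := Exec.seq (.seq hexec₁ hexec₂) hτ
    rw [Nat.sub_self, ← Finset.range_eq_Ico] at this
    exact this

end simulation

/-! ## Rules for total correctness with time bounds -/

/-- Started with the variables `env` and the arrays `A`, the command `c` keeps all numbers below
`V`, needs at most `B` time units and reaches arrays with property `Q`. -/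
def Achieves (base V : ℕ) (x env : ℕ → ℕ) (A : Arrays) (c : Cmd) (B : ℕ) (Q : Arrays → Prop) :
    Prop :=
  c.Bounded base V x env A ∧ c.time x env A ≤ B ∧ Q (c.run x env A)

namespace Achieves

variable {base V : ℕ} {x env : ℕ → ℕ} {A : Arrays} {B : ℕ} {Q : Arrays → Prop}

theorem skip (hB : 1 ≤ B) (hQ : Q A) : Achieves base V x env A .skip B Q :=
  ⟨trivial, hB, hQ⟩

theorem set {a : ℕ} {i e : Term} (hi : i.Bounded base V x env A) (hiV : i.val x env A < V)
    (he : e.Bounded base V x env A) (hB : i.cost + 6 + e.cost + 1 ≤ B)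
    (hQ : Q (A.set a (i.val x env A) (e.val x env A))) :
    Achieves base V x env A (.set a i e) B Q :=
  ⟨⟨hi, he, hiV⟩, hB, hQ⟩

theorem bind {r : ℕ} {e : Term} {c : Cmd} {B' : ℕ} (he : e.Bounded base V x env A)
    (hc : Achieves base V x (Function.update env r (e.val x env A)) A c B' Q)
    (hB : e.cost + 1 + B' ≤ B) : Achieves base V x env A (.bind r e c) B Q :=
  ⟨⟨he, hc.1⟩, le_trans (Nat.add_le_add_left hc.2.1 _) hB, hc.2.2⟩

theorem seq {c₁ c₂ : Cmd} {B₁ B₂ : ℕ} {Q₁ : Arrays → Prop}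
    (h₁ : Achieves base V x env A c₁ B₁ Q₁)
    (h₂ : ∀ A₁, Q₁ A₁ → Achieves base V x env A₁ c₂ B₂ Q) (hB : B₁ + B₂ ≤ B) :
    Achieves base V x env A (.seq c₁ c₂) B Q :=
  have h := h₂ _ h₁.2.2
  ⟨⟨h₁.1, h.1⟩, le_trans (Nat.add_le_add h₁.2.1 h.2.1) hB, h.2.2⟩

theorem ite {e : Term} {c₁ c₂ : Cmd} {B' : ℕ} (he : e.Bounded base V x env A)
    (h₁ : e.val x env A ≠ 0 → Achieves base V x env A c₁ B' Q)
    (h₂ : e.val x env A = 0 → Achieves base V x env A c₂ B' Q) (hB : e.cost + 1 + B' ≤ B) :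
    Achieves base V x env A (.ite e c₁ c₂) B Q := by
  by_cases h : e.val x env A = 0
  · refine ⟨⟨he, fun h' => absurd h h', fun _ => (h₂ h).1⟩, ?_, ?_⟩
    · have := (h₂ h).2.1
      simp only [Cmd.time, h, ne_eq, not_true_eq_false, if_false]; omega
    · simpa [Cmd.run, h] using (h₂ h).2.2
  · refine ⟨⟨he, fun _ => (h₁ h).1, fun h' => absurd h' h⟩, ?_, ?_⟩
    · have := (h₁ h).2.1
      simp only [Cmd.time, h, ne_eq, not_false_eq_true, if_true]; omega
    · simpa [Cmd.run, h] using (h₁ h).2.2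

/-- The time `t i` may depend on the round, which the sieve needs for its harmonic sum. Each round
costs `8` for the successful test and the increment; the `7` besides `e.cost` pays for the two
initial assignments and the failing test. The body may use that the arrays it does not write still
have their values from before the loop. -/
theorem loop_sum {r : ℕ} {e : Term} {c : Cmd} {b : ℕ} {t : ℕ → ℕ} (I : ℕ → Arrays → Prop)
    (he : e.Bounded base V x env A) (hb : e.val x env A = b) (hV : b < V) (h0 : I 0 A)
    (hI : ∀ i < b, ∀ A', I i A' → (∀ a ∉ c.writes, A' a = A a) →
      Achieves base V x (Cmd.loopEnv env r i b) A' c (t i) (I (i + 1)))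
    (hB : e.cost + 7 + ∑ i ∈ Finset.range b, (t i + 8) ≤ B) (hQ : ∀ A', I b A' → Q A') :
    Achieves base V x env A (.loop r e c) B Q := by
  subst hb
  set b := e.val x env A with hbdef
  have hw : ∀ i, ∀ a ∉ c.writes, Cmd.rounds x r c env A b i a = A a := by
    intro i a ha
    induction i with
    | zero => rfl
    | succ i ih => rw [Cmd.rounds_succ, Cmd.run_eq_of_notMem_writes _ _ _ _ _ ha, ih]
  have key : ∀ i ≤ b, I i (Cmd.rounds x r c env A b i) := by
    intro i
    induction i with
    | zero => exact fun _ => h0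
    | succ i ih => exact fun hi => (hI i (by omega) _ (ih (by omega)) (hw i)).2.2
  have hstep := fun i (hi : i < b) => hI i hi _ (key i hi.le) (hw i)
  refine ⟨⟨he, hV, fun i hi => (hstep i hi).1⟩, ?_, hQ _ (key b le_rfl)⟩
  have hsum := Finset.sum_le_sum (s := Finset.range b)
    (f := fun i => c.time x (Cmd.loopEnv env r i b) (Cmd.rounds x r c env A b i) + 8)
    (g := fun i => t i + 8)
    (fun i hi => Nat.add_le_add_right (hstep i (Finset.mem_range.1 hi)).2.1 8)
  rw [Cmd.time, ← hbdef]
  omega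

theorem loop {r : ℕ} {e : Term} {c : Cmd} {b t : ℕ} (I : ℕ → Arrays → Prop)
    (he : e.Bounded base V x env A) (hb : e.val x env A = b) (hV : b < V) (h0 : I 0 A)
    (hI : ∀ i < b, ∀ A', I i A' → (∀ a ∉ c.writes, A' a = A a) →
      Achieves base V x (Cmd.loopEnv env r i b) A' c t (I (i + 1)))
    (hB : e.cost + 7 + b * (t + 8) ≤ B) (hQ : ∀ A', I b A' → Q A') :
    Achieves base V x env A (.loop r e c) B Q :=
  loop_sum (t := fun _ => t) I he hb hV h0 hI (by simpa using hB) hQ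

/-- Besides weakening, this is where the frame property becomes available after a subcommand, so
specifications need not list the untouched arrays. -/
theorem mono {c : Cmd} {B' : ℕ} {Q' : Arrays → Prop} (h : Achieves base V x env A c B' Q')
    (hB : B' ≤ B) (hQ : ∀ A', Q' A' → (∀ a ∉ c.writes, A' a = A a) → Q A') :
    Achieves base V x env A c B Q :=
  ⟨h.1, h.2.1.trans hB,
    hQ _ h.2.2 fun a ha => Cmd.run_eq_of_notMem_writes _ _ _ _ a ha⟩

end Achieves

end WordRAM

/-! ## Representing prefixes by vectors -/

namespace RepresentativeWalks

open Polynomial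

section vectors

variable {F : Type*} [Field F]

/-- The product of all `a - y` with `a` in the list `l`. -/
def avoidProd (l : List ℕ) (y : F) : F := (l.map fun a : ℕ => (a : F) - y).prod

/-- The product of `avoidProd l` over a list of points. -/
def avoidVal (l : List ℕ) (ys : List F) : F := (ys.map (avoidProd l)).prod

theorem avoidProd_append (l l' : List ℕ) (y : F) :
    avoidProd (l ++ l') y = avoidProd l y * avoidProd l' y := by
  simp [avoidProd]

theorem exists_poly_avoidProd (l : List ℕ) :
    ∃ f : F[X], f.natDegree ≤ l.length ∧ ∀ y, f.eval y = avoidProd l y := by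
  induction l with
  | nil => exact ⟨1, by simp, by simp [avoidProd]⟩
  | cons a l ih =>
    obtain ⟨f, hf, hfe⟩ := ih
    refine ⟨(C (a : F) - X) * f, ?_, fun y => by simp [avoidProd, hfe]⟩
    refine natDegree_mul_le.trans ?_
    have : (C (a : F) - X).natDegree ≤ 1 := by
      refine (natDegree_sub_le _ _).trans ?_
      simp
    simp only [List.length_cons]
    omega

/-- A linear combination of the functions `avoidVal` that vanishes on all lists of points of
`{0, …, p}` of a given length vanishes on all lists of points of this length. -/
theorem sum_avoidVal_eq_zero {ι : Type*} (I : Finset ι) (l : ι → List ℕ) {p : ℕ}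
    (hl : ∀ i ∈ I, (l i).length ≤ p) (hp : Set.InjOn (Nat.cast : ℕ → F) {a | a ≤ p}) (ys : List F)
    (c : ι → F) (h : ∀ zs : List ℕ, zs.length = ys.length → (∀ z ∈ zs, z ≤ p) →
      ∑ i ∈ I, c i * avoidVal (l i) (zs.map Nat.cast) = 0) :
    ∑ i ∈ I, c i * avoidVal (l i) ys = 0 := by
  induction ys generalizing c with
  | nil => simpa using h [] rfl (by simp)
  | cons y ys ih =>
    classical
    -- The first point `y` is absorbed into the coefficients. It remains to show that the new
    -- combination vanishes on the grid in the other points, and for those fixed at `zs` it is a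
    -- polynomial in `y`.
    have := ih (fun i => c i * avoidProd (l i) y) (by
      intro zs hzs hzp
      choose f hf hfe using fun i => exists_poly_avoidProd (F := F) (l i)
      set g : F[X] := ∑ i ∈ I, C (c i * avoidVal (l i) (zs.map Nat.cast)) * f i with hg
      have hdeg : g.natDegree ≤ p := by
        refine natDegree_sum_le_of_forall_le _ _ fun i hi => ?_
        exact (natDegree_C_mul_le _ _).trans ((hf i).trans (hl i hi))
      have hroot : ∀ z : ℕ, z ≤ p → g.eval (z : F) = 0 := by
        intro z hz
        have := h (z :: zs) (by simp [hzs]) (by simpa using ⟨hz, hzp⟩)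
        rw [hg, eval_finsetSum, ← this]
        refine Finset.sum_congr rfl fun i _ => ?_
        simp [hfe, avoidVal]
        ring
      -- The degree is at most `p`, while the `p + 1` distinct grid points are roots.
      have hzero : g = 0 := by
        refine eq_zero_of_natDegree_lt_card_of_eval_eq_zero' g
          ((Finset.range (p + 1)).image (Nat.cast : ℕ → F)) ?_ ?_
        · intro a ha
          obtain ⟨z, hz, rfl⟩ := Finset.mem_image.1 ha
          exact hroot z (by simpa [Nat.lt_succ_iff] using hz)
        · rw [Finset.card_image_of_injOn]
          · simp; omega
          · intro a ha b hb hab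
            exact hp (by simpa [Nat.lt_succ_iff] using ha) (by simpa [Nat.lt_succ_iff] using hb) hab
      have hy := congrArg (eval y) hzero
      rw [hg, eval_finsetSum, eval_zero] at hy
      rw [← hy]
      refine Finset.sum_congr rfl fun i _ => ?_
      simp [hfe]
      ring)
    rw [← this]
    refine Finset.sum_congr rfl fun i _ => ?_
    simp [avoidVal]
    ring

theorem avoidVal_perm (l : List ℕ) {ys zs : List F} (h : ys.Perm zs) :
    avoidVal l ys = avoidVal l zs :=
  (h.map _).prod_eq

/-- The values of `avoidVal l` on the first `N` lists of a family. -/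
def avoidVec (N : ℕ) (nodes : ℕ → List ℕ) (l : List ℕ) : Fin N → F :=
  fun c => avoidVal l ((nodes c).map Nat.cast)

/-- The first `N` lists of the family are all nonincreasing lists of length at most `q` with
entries at most `p`, possibly among others. -/
def Covers (N p q : ℕ) (nodes : ℕ → List ℕ) : Prop :=
  ∀ ys : List ℕ, ys.length ≤ q → (∀ y ∈ ys, y ≤ p) → ys.Pairwise (· ≥ ·) → ∃ c < N, nodes c = ys

/-- A product in a field vanishes only if some factor `a - y` does, and numbers below `P` with equal
casts are equal. -/
theorem avoidVal_ne_zero_iff {P : ℕ} (hinj : Set.InjOn (Nat.cast : ℕ → F) {a | a < P})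
    {l Q : List ℕ} (hl : ∀ a ∈ l, a < P) (hQ : ∀ a ∈ Q, a < P) :
    avoidVal l (Q.map (Nat.cast : ℕ → F)) ≠ 0 ↔ ∀ a ∈ Q, a ∉ l := by
  simp only [avoidVal, avoidProd, ne_eq, List.prod_eq_zero_iff, List.mem_map, not_exists, not_and,
    exists_exists_and_eq_and, sub_eq_zero]
  constructor
  · intro h a ha hal
    exact h a ha a hal rfl
  · intro h a ha b hb hab
    rw [hinj (hl b hb) (hQ a ha) hab] at hb
    exact h a ha hb

/-- If the vector of `l` is a combination of the vectors of the lists `K i`, then each list `Q` of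
length at most `q` that is disjoint from `l` is disjoint from some `K i`. -/
theorem exists_disjoint_of_mem_span {N p q P cnt : ℕ} {nodes : ℕ → List ℕ}
    (hcov : Covers N p q nodes) (hpP : p < P)
    (hinj : Set.InjOn (Nat.cast : ℕ → F) {a | a < P}) {l : List ℕ} {K : ℕ → List ℕ}
    (hlp : l.length ≤ p) (hKp : ∀ b < cnt, (K b).length ≤ p)
    (hl : ∀ a ∈ l, a < P) (hK : ∀ b < cnt, ∀ a ∈ K b, a < P)
    (hspan : (avoidVec N nodes l : Fin N → F) ∈
      Submodule.span F ((fun b => avoidVec N nodes (K b)) '' Set.Iio cnt))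
    {Q : List ℕ} (hQq : Q.length ≤ q) (hQ : ∀ a ∈ Q, a < P) (hdisj : ∀ a ∈ Q, a ∉ l) :
    ∃ b < cnt, ∀ a ∈ Q, a ∉ K b := by
  -- If `Q` met every `K b`, all functions of the `K b` would vanish at `Q`, and then the function
  -- of `l` would vanish there too, contrary to `hdisj`.
  by_contra! hcon
  have hzeroK : ∀ b < cnt, avoidVal (K b) (Q.map (Nat.cast : ℕ → F)) = 0 := by
    intro b hb
    by_contra h
    obtain ⟨a, ha, haK⟩ := hcon b hb
    exact (avoidVal_ne_zero_iff hinj (hK b hb) hQ).1 h a ha haK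
  rw [← Finset.coe_Iio, Submodule.mem_span_image_finset_iff_exists_fun'] at hspan
  obtain ⟨c, hc⟩ := hspan
  -- The relation is written as one vanishing sum: the extra index `cnt` stands for `l`, with
  -- coefficient `-1`.
  have key := sum_avoidVal_eq_zero (F := F) (insert cnt (Finset.Iio cnt))
    (fun b => if b = cnt then l else K b) (p := p)
    (by
      intro i hi
      simp only [Finset.mem_insert, Finset.mem_Iio] at hi
      split
      · exact hlp
      · exact hKp i (by omega))
    (fun a ha b hb hab => hinj (lt_of_le_of_lt ha hpP) (lt_of_le_of_lt hb hpP) hab)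
    (Q.map Nat.cast) (fun b => if b = cnt then -1 else c b)
    (by
      intro zs hzs hzp
      -- By symmetry a grid point may be sorted, and the sorted list is one of the coordinates.
      obtain ⟨j, hj, hnode⟩ := hcov (zs.mergeSort (· ≥ ·))
        (by simpa [hzs] using hQq) (by simpa using hzp)
        (by simpa using List.pairwise_mergeSort' (r := (· ≥ ·)) zs)
      have hperm : ((nodes j).map (Nat.cast : ℕ → F)).Perm (zs.map Nat.cast) := by
        rw [hnode]; exact (List.mergeSort_perm _ _).map _
      have hj' := congrFun hc ⟨j, hj⟩
      simp only [Finset.sum_apply, Pi.smul_apply, avoidVec, smul_eq_mul,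
        avoidVal_perm _ hperm] at hj'
      rw [Finset.sum_insert (by simp)]
      simp only [if_true]
      rw [← hj', neg_one_mul, neg_add_eq_zero]
      refine Finset.sum_congr rfl fun b hb => ?_
      rw [if_neg (by simp at hb; omega), if_neg (by simp at hb; omega)])
  rw [Finset.sum_insert (by simp)] at key
  simp only [if_true] at key
  rw [Finset.sum_eq_zero, add_zero, neg_one_mul, neg_eq_zero] at key
  · exact (avoidVal_ne_zero_iff hinj hl hQ).2 hdisj key
  · intro b hb
    simp only [Finset.mem_Iio] at hb
    rw [if_neg hb.ne, if_neg hb.ne, hzeroK b hb, mul_zero]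

end vectors

/-! ## Incremental elimination -/

section elimination

variable {F : Type*} [Field F] {N : ℕ}

/-- The rows `row b`, `b < cnt`, are combinations of the vectors `vec b`, `b < cnt`, and are in
echelon form with pivot positions `piv b`. -/
structure Echelon (row vec : ℕ → Fin N → F) (piv : ℕ → ℕ) (cnt : ℕ) : Prop where
  piv_lt : ∀ b < cnt, piv b < N
  row_piv : ∀ b < cnt, ∀ h : piv b < N, row b ⟨piv b, h⟩ ≠ 0
  row_zero : ∀ b b', b < b' → b' < cnt → ∀ h : piv b < N, row b' ⟨piv b, h⟩ = 0
  row_mem : ∀ b < cnt, row b ∈ Submodule.span F (vec '' Set.Iio cnt)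

/-- A later row vanishes at every earlier pivot but not at its own, so the pivots are distinct
positions below `N`. This bounds the number of walks kept in a bucket. -/
theorem Echelon.le {row vec : ℕ → Fin N → F} {piv : ℕ → ℕ} {cnt : ℕ}
    (h : Echelon row vec piv cnt) : cnt ≤ N := by
  have hne : ∀ b b', b < b' → b' < cnt → piv b ≠ piv b' := by
    intro b b' hbb' hb' he
    refine h.row_piv b' hb' (h.piv_lt b' hb') ?_
    have := h.row_zero b b' hbb' hb' (h.piv_lt b (hbb'.trans hb'))
    simpa [he] using this
  have hinj : Set.InjOn piv (Finset.range cnt) := by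
    intro b hb b' hb' he
    simp only [Finset.coe_range, Set.mem_Iio] at hb hb'
    rcases lt_trichotomy b b' with hlt | heq | hgt
    · exact absurd he (hne b b' hlt hb')
    · exact heq
    · exact absurd he.symm (hne b' b hgt hb)
  have := Finset.card_le_card_of_injOn (s := Finset.range cnt) (t := Finset.range N) piv
    (fun b hb => by simpa using h.piv_lt b (by simpa using hb)) hinj
  simpa using this

/-- `cur` is what is left of `v` after elimination with the first `b` rows. -/
structure Reduced (row vec : ℕ → Fin N → F) (piv : ℕ → ℕ) (cnt b : ℕ) (v cur : Fin N → F) :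
    Prop where
  zero : ∀ b' < b, ∀ h : piv b' < N, cur ⟨piv b', h⟩ = 0
  mem : ∃ a : F, a ≠ 0 ∧ cur - a • v ∈ Submodule.span F (vec '' Set.Iio cnt)

theorem Reduced.init (row vec : ℕ → Fin N → F) (piv : ℕ → ℕ) (cnt : ℕ) (v : Fin N → F) :
    Reduced row vec piv cnt 0 v v :=
  ⟨by simp, 1, one_ne_zero, by simp⟩

/-- Elimination without division: the current vector is multiplied by the pivot entry instead of
dividing the row by it. The nonzero factor `a` in `Reduced` records these multiplications. Zeros at
earlier pivots survive because row `b` vanishes there. -/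
theorem Reduced.step {row vec : ℕ → Fin N → F} {piv : ℕ → ℕ} {cnt b : ℕ} {v cur cur' : Fin N → F}
    (hE : Echelon row vec piv cnt) (hb : b < cnt) (h : Reduced row vec piv cnt b v cur)
    (hcur : ∀ c, cur' c = row b ⟨piv b, hE.piv_lt b hb⟩ * cur c -
      cur ⟨piv b, hE.piv_lt b hb⟩ * row b c) :
    Reduced row vec piv cnt (b + 1) v cur' := by
  obtain ⟨a, ha, hmem⟩ := h.mem
  refine ⟨fun b' hb' hlt => ?_, row b ⟨piv b, hE.piv_lt b hb⟩ * a,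
    mul_ne_zero (hE.row_piv b hb _) ha, ?_⟩
  · rw [hcur]
    rcases Nat.lt_succ_iff_lt_or_eq.1 hb' with hlt' | rfl
    · rw [h.zero b' hlt', hE.row_zero b' b hlt' hb]; ring
    · ring
  · have : cur' - (row b ⟨piv b, hE.piv_lt b hb⟩ * a) • v =
        row b ⟨piv b, hE.piv_lt b hb⟩ • (cur - a • v) -
          cur ⟨piv b, hE.piv_lt b hb⟩ • row b := by
      funext c
      simp only [Pi.sub_apply, Pi.smul_apply, smul_eq_mul, hcur]
      ring
    rw [this]
    exact Submodule.sub_mem _ (Submodule.smul_mem _ _ hmem)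
      (Submodule.smul_mem _ _ (hE.row_mem b hb))

theorem Reduced.mem_span_of_eq_zero {row vec : ℕ → Fin N → F} {piv : ℕ → ℕ} {cnt b : ℕ}
    {v cur : Fin N → F} (h : Reduced row vec piv cnt b v cur) (h0 : ∀ c, cur c = 0) :
    v ∈ Submodule.span F (vec '' Set.Iio cnt) := by
  obtain ⟨a, ha, hmem⟩ := h.mem
  have : cur = 0 := funext h0
  rw [this, zero_sub, Submodule.neg_mem_iff] at hmem
  simpa [smul_smul, ha] using Submodule.smul_mem _ a⁻¹ hmem

/-- A reduced vector with a nonzero entry can be appended. -/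
theorem Echelon.append {row vec row' vec' : ℕ → Fin N → F} {piv piv' : ℕ → ℕ} {cnt : ℕ}
    (hE : Echelon row vec piv cnt) (h : Reduced row vec piv cnt cnt (vec' cnt) (row' cnt))
    (hrow : ∀ b < cnt, row' b = row b) (hvec : ∀ b < cnt, vec' b = vec b)
    (hpiv : ∀ b < cnt, piv' b = piv b) (hlt : piv' cnt < N) (hne : row' cnt ⟨piv' cnt, hlt⟩ ≠ 0) :
    Echelon row' vec' piv' (cnt + 1) := by
  have hsub : Submodule.span F (vec '' Set.Iio cnt) ≤
      Submodule.span F (vec' '' Set.Iio (cnt + 1)) := by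
    refine Submodule.span_mono ?_
    rintro _ ⟨b, hb, rfl⟩
    exact ⟨b, Set.mem_Iio.2 (Nat.lt_succ_of_lt hb), hvec b hb⟩
  refine ⟨fun b hb => ?_, fun b hb hb' => ?_, fun b b' hbb' hb' hl => ?_, fun b hb => ?_⟩
  · rcases Nat.lt_succ_iff_lt_or_eq.1 hb with hb | rfl
    · rw [hpiv b hb]; exact hE.piv_lt b hb
    · exact hlt
  · rcases Nat.lt_succ_iff_lt_or_eq.1 hb with hb | rfl
    · simpa only [hpiv b hb, hrow b hb] using hE.row_piv b hb (hE.piv_lt b hb)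
    · exact hne
  · rcases Nat.lt_succ_iff_lt_or_eq.1 hb' with hb' | rfl
    · simpa only [hpiv b (hbb'.trans hb'), hrow b' hb'] using
        hE.row_zero b b' hbb' hb' (hE.piv_lt b (hbb'.trans hb'))
    · simpa only [hpiv b hbb'] using h.zero b hbb' (hE.piv_lt b hbb')
  · rcases Nat.lt_succ_iff_lt_or_eq.1 hb with hb | rfl
    · rw [hrow b hb]; exact hsub (hE.row_mem b hb)
    · obtain ⟨a, _, hmem⟩ := h.mem
      have h1 := hsub hmem
      have h2 : a • vec' b ∈ Submodule.span F (vec' '' Set.Iio (b + 1)) :=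
        Submodule.smul_mem _ _ (Submodule.subset_span ⟨b, by simp, rfl⟩)
      simpa using Submodule.add_mem _ h1 h2

end elimination

/-! ## The points of interpolation -/

section points

/-- All one-element extensions of a nonincreasing list by a new first element at most `p`. -/
def extensions (p : ℕ) (l : List ℕ) : List (List ℕ) :=
  (List.range (p + 1 - l.headD 0)).map fun z => (l.headD 0 + z) :: l

/-- The nonincreasing lists with entries at most `p` of length `j`. -/
def pointLists (p : ℕ) : ℕ → List (List ℕ)
  | 0 => [[]]
  | j + 1 => (pointLists p j).flatMap (extensions p)

/-- The nonincreasing lists with entries at most `p` of length at most `j`. -/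
def pointListsUpTo (p : ℕ) : ℕ → List (List ℕ)
  | 0 => [[]]
  | j + 1 => pointListsUpTo p j ++ pointLists p (j + 1)

/-- The number of nonincreasing lists of length at most `q` with entries at most `p`. -/
def pointCount (p q : ℕ) : ℕ := (pointListsUpTo p q).length

theorem mem_pointLists {p : ℕ} {ys : List ℕ} (hle : ∀ y ∈ ys, y ≤ p)
    (hs : ys.Pairwise (· ≥ ·)) : ys ∈ pointLists p ys.length := by
  induction ys with
  | nil => simp [pointLists]
  | cons y ys ih =>
    rw [List.pairwise_cons] at hs
    simp only [List.length_cons, pointLists, List.mem_flatMap]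
    refine ⟨ys, ih (fun z hz => hle z (by simp [hz])) hs.2, ?_⟩
    have h1 : ys.headD 0 ≤ y := by
      cases ys with
      | nil => simp
      | cons z zs => exact hs.1 z (by simp)
    have h2 : y ≤ p := hle y (by simp)
    simp only [extensions, List.mem_map, List.mem_range]
    exact ⟨y - ys.headD 0, by omega, by congr 1; omega⟩

theorem headD_le_of_mem_pointLists {p j : ℕ} {ys : List ℕ} (h : ys ∈ pointLists p j) :
    ys.headD 0 ≤ p := by
  cases j with
  | zero =>
    simp only [pointLists, List.mem_singleton] at h
    simp [h]
  | succ j =>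
    simp only [pointLists, List.mem_flatMap, extensions, List.mem_map, List.mem_range] at h
    obtain ⟨l, _, z, hz, rfl⟩ := h
    simp only [List.headD_cons]
    omega

theorem pointLists_subset_upTo (p : ℕ) {j q : ℕ} (h : j ≤ q) :
    pointLists p j ⊆ pointListsUpTo p q := by
  induction q with
  | zero =>
    obtain rfl : j = 0 := by omega
    simp [pointLists, pointListsUpTo]
  | succ q ih =>
    rcases Nat.le_succ_iff.1 h with h | rfl
    · exact fun l hl => by
        simp only [pointListsUpTo, List.mem_append]
        exact Or.inl (ih h hl)
    · exact fun l hl => by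
        simp only [pointListsUpTo, List.mem_append]
        exact Or.inr hl

theorem covers_pointListsUpTo (p q : ℕ) :
    Covers (pointCount p q) p q (fun c => (pointListsUpTo p q).getD c []) := by
  intro ys hlen hle hs
  have hmem := pointLists_subset_upTo p hlen (mem_pointLists hle hs)
  obtain ⟨c, hc, hget⟩ := List.getElem_of_mem hmem
  exact ⟨c, hc, by simp [List.getD_eq_getElem?_getD, hc, hget]⟩

theorem sum_map_range (f : ℕ → ℕ) (r : ℕ) :
    ((List.range r).map f).sum = ∑ z ∈ Finset.range r, f z := by
  induction r with
  | zero => rfl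
  | succ r ih => simp [List.range_succ, Finset.sum_range_succ, ih]

/-- The number of lists reached after `j` rounds of extension. -/
theorem length_iterate_extensions_le (p j : ℕ) (ls : List (List ℕ)) :
    ((fun ls : List (List ℕ) => ls.flatMap (extensions p))^[j] ls).length ≤
      (ls.map fun l => (p + 1 - l.headD 0 + j).choose j).sum := by
  induction j generalizing ls with
  | zero => simp
  | succ j ih =>
    rw [Function.iterate_succ_apply]
    refine (ih _).trans ?_
    induction ls with
    | nil => simp
    | cons l ls ihl =>
      simp only [List.flatMap_cons, List.map_append, List.sum_append, List.map_cons, List.sum_cons]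
      refine Nat.add_le_add ?_ ihl
      set r := p + 1 - l.headD 0 with hr
      have h1 : ((extensions p l).map fun l' => (p + 1 - l'.headD 0 + j).choose j).sum =
          ∑ z ∈ Finset.range r, (r - z + j).choose j := by
        rw [extensions, List.map_map, ← hr, ← sum_map_range]
        congr 1
        refine List.map_congr_left fun z hz => ?_
        simp only [Function.comp, List.headD_cons]
        congr 1
        omega
      -- In reversed order the terms are `(z + 1 + j).choose j` for `z < r`. They form the
      -- hockey-stick sum over `z ≤ r` without its first term, and the full sum is `(r + j +
      -- 1).choose (j + 1)`.
      rw [h1, ← Finset.sum_range_reflect]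
      have h2 : ∑ z ∈ Finset.range r, (r - (r - 1 - z) + j).choose j ≤
          ∑ z ∈ Finset.range (r + 1), (z + j).choose j := by
        rw [Finset.sum_range_succ']
        refine le_trans (Finset.sum_le_sum fun z hz => ?_) (Nat.le_add_right _ _)
        rw [Finset.mem_range] at hz
        rw [show r - (r - 1 - z) = z + 1 by omega]
      refine h2.trans ?_
      rw [Nat.sum_range_add_choose]
      rw [show r + j + 1 = r + (j + 1) by ring]

theorem length_pointLists_le (p j : ℕ) : (pointLists p j).length ≤ (p + 1 + j).choose j := by
  have h : ∀ j, pointLists p j =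
      (fun ls : List (List ℕ) => ls.flatMap (extensions p))^[j] [[]] := by
    intro j
    induction j with
    | zero => rfl
    | succ j ih => rw [Function.iterate_succ_apply', ← ih]; rfl
  rw [h]
  refine (length_iterate_extensions_le p j [[]]).trans ?_
  simp

/-- Pascal's rule matches the recursion on the maximal length: one summand bounds the lists of
length at most `q`, the other those of length exactly `q + 1`. -/
theorem pointCount_le_choose (p q : ℕ) : pointCount p q ≤ (p + q + 2).choose q := by
  rw [pointCount]
  induction q with
  | zero => simp [pointListsUpTo]
  | succ q ih =>
    rw [pointListsUpTo, List.length_append, show p + (q + 1) + 2 = p + q + 2 + 1 by ring,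
      Nat.choose_succ_succ]
    have := length_pointLists_le p (q + 1)
    rw [show p + 1 + (q + 1) = p + q + 2 by ring] at this
    exact Nat.add_le_add ih this

/-- Each new length contributes at least the list of zeros. With `lt_pointCount_left` this allows
`k` and `k * μ` to be absorbed into `N` in all bounds on time and addresses. -/
theorem lt_pointCount_right (p q : ℕ) : q < pointCount p q := by
  rw [pointCount]
  induction q with
  | zero => simp [pointListsUpTo]
  | succ q ih =>
    rw [pointListsUpTo, List.length_append]
    have h := mem_pointLists (p := p) (ys := List.replicate (q + 1) 0)
      (by intro y hy; rw [List.eq_of_mem_replicate hy]; exact Nat.zero_le _)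
      (List.pairwise_replicate.2 (Or.inr le_rfl))
    rw [List.length_replicate] at h
    have := List.length_pos_of_mem h
    omega

theorem lt_pointCount_left (p : ℕ) {q : ℕ} (hq : 0 < q) : p + 1 < pointCount p q := by
  rw [pointCount]
  induction q with
  | zero => omega
  | succ q ih =>
    rw [pointListsUpTo, List.length_append]
    rcases Nat.eq_zero_or_pos q with rfl | hq
    · simp [pointListsUpTo, pointLists, extensions]
    · exact (ih hq).trans_le (Nat.le_add_right _ _)

end points

end RepresentativeWalks

namespace RepresentativeWalks

/-! ## The input and its conforming walks -/

/-- `x` lists the input of the word RAM, the list of edges deleted by the vertex `v` starting,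
with its length, at position `off v`. -/
structure IsInput (x off : ℕ → ℕ) (n m s t k μ : ℕ) : Prop where
  x_zero : x 0 = n
  x_one : x 1 = m
  x_two : x 2 = s
  x_three : x 3 = t
  x_four : x 4 = k
  s_lt : s < n
  t_lt : t < n
  k_pos : 0 < k
  end_lt : ∀ e < m, ∀ d < 2, x (5 + 2 * e + d) < n
  off_zero : off 0 = 5 + 2 * m
  off_succ : ∀ v < n, off (v + 1) = off v + 1 + x (off v)
  del_lt : ∀ v < n, ∀ j < x (off v), x (off v + 1 + j) < m
  length_le : ∀ v < n, x (off v) ≤ m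
  length_le_mu : ∀ v < n, x (off v) ≤ μ
  mu_attained : ∃ v < n, x (off v) = μ

/-- The list of edges deleted by a vertex. -/
def delList (x off : ℕ → ℕ) (v : ℕ) : List ℕ :=
  (List.range (x (off v))).map fun j => x (off v + 1 + j)

/-- The edges deleted by the vertices of a list. -/
def forbidden (x off : ℕ → ℕ) (l : List ℕ) : List ℕ := l.flatMap (delList x off)

/-- The edge number `e` joins `u` and `v`. -/
def Joins (x : ℕ → ℕ) (e u v : ℕ) : Prop :=
  ∃ d < 2, x (5 + 2 * e + d) = u ∧ x (5 + 2 * e + (1 - d)) = v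

/-- A conforming walk with `r` edges: the vertices are `w 0, …, w r`, the edges `e 0, …`. -/
structure ConfWalk (x off : ℕ → ℕ) (m s r : ℕ) (w e : ℕ → ℕ) : Prop where
  start : w 0 = s
  edge_lt : ∀ i < r, e i < m
  joins : ∀ i < r, Joins x (e i) (w i) (w (i + 1))
  conf : ∀ i < r, ∀ j ≤ i, e i ∉ delList x off (w j)

section walks

variable {x off : ℕ → ℕ} {n m s t k μ : ℕ}

theorem ConfWalk.vert_lt (hx : IsInput x off n m s t k μ) {r : ℕ} {w e : ℕ → ℕ}
    (h : ConfWalk x off m s r w e) {i : ℕ} (hi : i ≤ r) : w i < n := by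
  cases i with
  | zero => rw [h.start]; exact hx.s_lt
  | succ i =>
    obtain ⟨d, hd, _, h2⟩ := h.joins i hi
    rw [← h2]
    exact hx.end_lt _ (h.edge_lt i hi) _ (by omega)

/-- Cutting out a closed part of a conforming walk. -/
theorem ConfWalk.splice {r : ℕ} {w e : ℕ → ℕ} (h : ConfWalk x off m s r w e) {i j : ℕ}
    (hij : i < j) (hj : j ≤ r) (hw : w i = w j) :
    ∃ w' e', ConfWalk x off m s (r - (j - i)) w' e' ∧ w' (r - (j - i)) = w r := by
  refine ⟨fun a => if a ≤ i then w a else w (a + (j - i)),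
    fun a => if a < i then e a else e (a + (j - i)), ⟨?_, ?_, ?_, ?_⟩, ?_⟩
  · simp [h.start]
  · intro a ha
    split
    · exact h.edge_lt a (by omega)
    · exact h.edge_lt _ (by omega)
  · intro a ha
    by_cases h1 : a < i
    · rw [if_pos h1, if_pos h1.le, if_pos (by omega)]
      exact h.joins a (by omega)
    · rw [if_neg h1, if_neg (by omega : ¬ a + 1 ≤ i)]
      have hjo := h.joins (a + (j - i)) (by omega)
      rw [show a + 1 + (j - i) = a + (j - i) + 1 by omega]
      by_cases h2 : a ≤ i
      · obtain rfl : a = i := by omega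
        rw [if_pos le_rfl, hw]
        rwa [show a + (j - a) = j by omega] at hjo ⊢
      · rwa [if_neg h2]
  -- The vertices up to a remaining edge of the shortened walk are among those up to the same edge
  -- of the old walk, so fewer deletions have to be respected.
  · intro a ha b hb
    by_cases h1 : a < i
    · rw [if_pos h1, if_pos (by omega)]
      exact h.conf a (by omega) b hb
    · rw [if_neg h1]
      split
      · exact h.conf _ (by omega) b (by omega)
      · exact h.conf _ (by omega) _ (by omega)
  · beta_reduce
    split
    · rw [show r - (j - i) = i by omega, hw, show j = r by omega]
    · rw [show r - (j - i) + (j - i) = r by omega]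

/-- This is why walks suffice and visited vertices need not be remembered: each cut at a repeated
vertex gives a shorter conforming walk with the same ends. -/
theorem exists_injOn_confWalk {r : ℕ} {w e : ℕ → ℕ} (h : ConfWalk x off m s r w e)
    (ht : w r = t) : ∃ r' ≤ r, ∃ w' e', ConfWalk x off m s r' w' e' ∧ w' r' = t ∧
      Set.InjOn w' {i | i ≤ r'} := by
  induction r using Nat.strong_induction_on generalizing w e with
  | _ r ih =>
    by_cases hinj : Set.InjOn w {i | i ≤ r}
    · exact ⟨r, le_rfl, w, e, h, ht, hinj⟩
    · have : ∃ i j, i < j ∧ j ≤ r ∧ w i = w j := by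
        simp only [Set.InjOn, not_forall] at hinj
        obtain ⟨i, hi, j, hj, hw, hne⟩ := hinj
        rcases lt_or_gt_of_ne hne with hlt | hgt
        · exact ⟨i, j, hlt, hj, hw⟩
        · exact ⟨j, i, hgt, hi, hw.symm⟩
      obtain ⟨i, j, hij, hj, hw⟩ := this
      obtain ⟨w', e', h', ht'⟩ := h.splice hij hj hw
      obtain ⟨r', hr', res⟩ := ih (r - (j - i)) (by omega) h' (ht'.trans ht)
      exact ⟨r', by omega, res⟩

/-- `K v l` for lists `l` of vertices that are conforming walks with `i` edges from `s` to `v`. -/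
def SoundAt (x off : ℕ → ℕ) (m s i : ℕ) (K : ℕ → List ℕ → Prop) : Prop :=
  ∀ v l, K v l → ∃ w e, ConfWalk x off m s i w e ∧ w i = v ∧ l = (List.range (i + 1)).map w

/-- Every conforming walk to `t` with fewer than `k` edges may have its first `i` edges replaced
by a walk from `K`. -/
def CompleteAt (x off : ℕ → ℕ) (m s t k i : ℕ) (K : ℕ → List ℕ → Prop) : Prop :=
  ∀ r < k, ∀ w e, ConfWalk x off m s r w e → w r = t → i ≤ r →
    ∃ l, K (w i) l ∧ ∀ j, i ≤ j → j < r → e j ∉ forbidden x off l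

theorem soundAt_zero : SoundAt x off m s 0 fun v l => v = s ∧ l = [s] := by
  rintro v l ⟨rfl, rfl⟩
  exact ⟨fun _ => v, fun _ => 0, ⟨rfl, by simp, by simp, by simp⟩, rfl, by simp⟩

theorem completeAt_zero : CompleteAt x off m s t k 0 fun v l => v = s ∧ l = [s] := by
  intro r _ w e h _ _
  refine ⟨[s], ⟨h.start, rfl⟩, fun j _ hj => ?_⟩
  have := h.conf j hj 0 (Nat.zero_le _)
  simpa [forbidden, h.start] using this

theorem SoundAt.succ {i : ℕ} {K K' : ℕ → List ℕ → Prop} (hK : SoundAt x off m s i K)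
    (hK' : ∀ v l', K' v l' → ∃ u l e, K u l ∧ e < m ∧ Joins x e u v ∧ e ∉ forbidden x off l ∧
      l' = l ++ [v]) : SoundAt x off m s (i + 1) K' := by
  intro v l' hl'
  obtain ⟨u, l, e, hKl, he, hj, hfor, rfl⟩ := hK' v l' hl'
  obtain ⟨w, e', hw, rfl, rfl⟩ := hK u l hKl
  have hwv : ∀ a ≤ i, Function.update w (i + 1) v a = w a := fun a ha =>
    Function.update_of_ne (by omega) _ _
  refine ⟨Function.update w (i + 1) v, Function.update e' i e, ⟨?_, ?_, ?_, ?_⟩, by simp, ?_⟩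
  · rw [hwv 0 (by omega), hw.start]
  · intro a ha
    rcases Nat.lt_succ_iff_lt_or_eq.1 ha with ha | rfl
    · rw [Function.update_of_ne ha.ne]; exact hw.edge_lt a ha
    · rwa [Function.update_self]
  · intro a ha
    rcases Nat.lt_succ_iff_lt_or_eq.1 ha with ha | rfl
    · rw [Function.update_of_ne ha.ne, hwv a ha.le, hwv (a + 1) ha]; exact hw.joins a ha
    · rwa [Function.update_self, Function.update_self, hwv a le_rfl]
  · intro a ha b hb
    rw [hwv b (by omega)]
    rcases Nat.lt_succ_iff_lt_or_eq.1 ha with ha | rfl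
    · rw [Function.update_of_ne ha.ne]; exact hw.conf a ha b hb
    · rw [Function.update_self]
      intro hmem
      apply hfor
      simp only [forbidden, List.mem_flatMap, List.mem_map, List.mem_range]
      exact ⟨w b, ⟨b, by omega, rfl⟩, hmem⟩
  · rw [List.range_succ (n := i + 1), List.map_append]
    congr 1
    · exact List.map_congr_left fun a ha => (hwv a (by simp at ha; omega)).symm
    · simp

/-- The set `Q` is chosen as the edges after `e i`. By the hypothesis on `K` they avoid the
deletions of the exchanged prefix `l`, and they avoid those of the new vertex because the original
walk is conforming. Hence `l ++ [v]` is compatible with the rest, and the representative property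
passes this on to a member of `K'`. -/
theorem CompleteAt.succ (hx : IsInput x off n m s t k μ) {i : ℕ} {K K' : ℕ → List ℕ → Prop}
    (hK : CompleteAt x off m s t k i K)
    (hK' : ∀ u l e v, u < n → v < n → K u l → e < m → Joins x e u v → e ∉ forbidden x off l →
      ∀ Q : List ℕ, Q.length ≤ k → (∀ a ∈ Q, a < m) →
        (∀ a ∈ Q, a ∉ forbidden x off (l ++ [v])) →
        ∃ l', K' v l' ∧ ∀ a ∈ Q, a ∉ forbidden x off l') :
    CompleteAt x off m s t k (i + 1) K' := by
  intro r hr w e h ht hi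
  obtain ⟨l, hl, hfor⟩ := hK r hr w e h ht (by omega)
  obtain ⟨l', hl', hQ⟩ := hK' (w i) l (e i) (w (i + 1)) (h.vert_lt hx (by omega))
    (h.vert_lt hx hi) hl (h.edge_lt i hi) (h.joins i hi)
    (hfor i le_rfl hi) ((List.range (r - (i + 1))).map fun a => e (i + 1 + a))
    (by simp; omega)
    (by
      intro a ha
      simp only [List.mem_map, List.mem_range] at ha
      obtain ⟨b, hb, rfl⟩ := ha
      exact h.edge_lt _ (by omega))
    (by
      intro a ha
      simp only [List.mem_map, List.mem_range] at ha
      obtain ⟨b, hb, rfl⟩ := ha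
      rw [forbidden, List.flatMap_append, List.mem_append, not_or]
      refine ⟨hfor _ (by omega) (by omega), ?_⟩
      simpa using h.conf (i + 1 + b) (by omega) (i + 1) (by omega))
  refine ⟨l', hl', fun j hj hjr => hQ _ ?_⟩
  simp only [List.mem_map, List.mem_range]
  exact ⟨j - (i + 1), by omega, by congr 1; omega⟩

end walks

/-! ## Decoding instances -/

/-- Splitting a concatenation at block `i` locates the entries of one edge or one vertex within the
encoded input. -/
theorem flatMap_eq_append {α β : Type*} (f : α → List β) (l : List α) {i : ℕ} (hi : i < l.length) :
    l.flatMap f = (l.take i).flatMap f ++ (f l[i] ++ (l.drop (i + 1)).flatMap f) := by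
  conv_lhs => rw [← List.take_append_drop i l, List.drop_eq_getElem_cons hi]
  rw [List.flatMap_append, List.flatMap_cons]

theorem exists_walk_of_adj {V : Type} {G : SimpleGraph V} (v : ℕ → V) (r : ℕ)
    (h : ∀ i < r, G.Adj (v i) (v (i + 1))) :
    ∃ p : G.Walk (v 0) (v r), p.length = r ∧ ∀ i ≤ r, p.getVert i = v i := by
  induction r generalizing v with
  | zero => exact ⟨.nil, rfl, fun i hi => by obtain rfl : i = 0 := by omega
                                             rfl⟩
  | succ r ih =>
    obtain ⟨p, hp, hpv⟩ := ih (fun i => v (i + 1)) (fun i hi => h (i + 1) (by omega))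
    refine ⟨.cons (h 0 (by omega)) p, by simp [hp], fun i hi => ?_⟩
    cases i with
    | zero => rfl
    | succ i => simpa using hpv i (by omega)

/-- An encoded instance is an input in the sense of `IsInput`, and yes-instances are those with a
short conforming walk. -/
theorem exists_isInput {n : ℕ} {I : PathInstance n} {x : List ℕ} (h : I.IsEncodedBy x) :
    ∃ off, IsInput (fun a => x.getD a 0) off n I.edgeCount I.s I.t I.k I.mu ∧
      I.edgeCount ≤ n * n ∧ x.length ≤ 5 + 2 * I.edgeCount + n * (I.edgeCount + 1) ∧
      (∀ a, x.getD a 0 ≤ n + I.edgeCount + I.k) ∧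
      (I.IsYes ↔ ∃ r < I.k, ∃ w e,
        ConfWalk (fun a => x.getD a 0) off I.edgeCount I.s r w e ∧ w r = I.t) := by
  obtain ⟨L, F, hnd, hedge, hFnd, hdel, hxeq⟩ := h
  have hm : I.edgeCount = L.length := by
    have hset : I.graph.edgeSet = ((L.map fun a => s(a.1, a.2)).toFinset : Set _) := by
      ext e; simp only [List.coe_toFinset, Set.mem_ofPred_eq]; exact hedge e
    rw [SelfDeletingGraph.edgeCount, hset, Set.ncard_coe_finset, List.toFinset_card_of_nodup hnd,
      List.length_map]
  have hinjL : ∀ i j : Fin L.length, s((L.get i).1, (L.get i).2) = s((L.get j).1, (L.get j).2) →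
      i = j := by
    intro i j hij
    have := (List.Nodup.get_inj_iff hnd (i := i.cast (by simp)) (j := j.cast (by simp))).1
      (by simpa using hij)
    simpa [Fin.ext_iff] using this
  have hFlen : ∀ v, (F v).length ≤ L.length := fun v => by
    simpa using (hFnd v).length_le_card
  have hcard : ∀ v, (I.del v).card = (F v).length := by
    intro v
    have hset : I.del v = ((F v).map fun i => s((L.get i).1, (L.get i).2)).toFinset := by
      ext e; rw [List.mem_toFinset]; exact hdel v e
    rw [hset, List.toFinset_card_of_nodup, List.length_map]
    exact (hFnd v).map fun i j => hinjL i j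
  rw [hm]
  set blk : Fin n → List ℕ := fun v => (F v).length :: (F v).map fun i => (i : ℕ) with hblk
  -- Brings the coercion of the entries into the form of an ordinary map of `Fin.val`.
  have hblk' : ∀ v, blk v = (F v).length :: (F v).map Fin.val := by
    intro v
    simp only [hblk, List.map_id_fun', id_eq]
    congr 1
    exact List.flatMap_pure_eq_map _ _
  clear_value blk
  set hd : List ℕ := [n, L.length, (I.s : ℕ), (I.t : ℕ), I.k] with hhd
  set es : List ℕ := L.flatMap fun a => [(a.1 : ℕ), (a.2 : ℕ)] with hes
  have hlen2 : ∀ l : List (Fin n × Fin n),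
      (l.flatMap fun a => [(a.1 : ℕ), (a.2 : ℕ)]).length = 2 * l.length := by
    intro l
    induction l with
    | nil => rfl
    | cons a l ih => simp at ih ⊢; omega
  set off : ℕ → ℕ := fun v => 5 + 2 * L.length + (((List.finRange n).take v).flatMap blk).length
    with hoff
  set X : ℕ → ℕ := fun a => x.getD a 0 with hX
  have hXoff : ∀ v : Fin n, ∀ j, j < (F v).length + 1 → X (off v + j) = (blk v).getD j 0 := by
    intro v j hj
    have hv : (v : ℕ) < (List.finRange n).length := by simp
    have := flatMap_eq_append blk (List.finRange n) hv
    simp only [hX]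
    rw [hxeq, this]
    simp only [List.getElem_finRange]
    rw [← List.append_assoc, List.getD_append_right _ _ _ _ (by simp [hhd, hes, hlen2, hoff]; omega)]
    rw [List.getD_append _ _ _ _ (by simp [hhd, hes, hlen2, hoff, hblk']; omega)]
    congr 1
    simp [hhd, hes, hlen2, hoff]; omega
  have hXlen : ∀ v : Fin n, X (off v) = (F v).length := by
    intro v
    simpa [hblk'] using hXoff v 0 (by omega)
  have hXdel : ∀ v : Fin n, ∀ j, ∀ hj : j < (F v).length,
      X (off v + 1 + j) = ((F v)[j] : ℕ) := by
    intro v j hj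
    have := hXoff v (1 + j) (by omega)
    rw [← add_assoc] at this
    rw [this]
    simp [hblk', add_comm 1 j, hj]
  have hXedge : ∀ e : Fin L.length, X (5 + 2 * e) = (L.get e).1 ∧ X (5 + 2 * e + 1) = (L.get e).2 := by
    intro e
    have := flatMap_eq_append (fun a : Fin n × Fin n => [(a.1 : ℕ), (a.2 : ℕ)]) L e.2
    have hgen : ∀ d < 2, X (5 + 2 * e + d) = [((L.get e).1 : ℕ), ((L.get e).2 : ℕ)].getD d 0 := by
      intro d hd2
      simp only [hX]
      rw [hxeq, hes, this, List.append_assoc, List.append_assoc, List.append_assoc,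
        List.getD_append_right _ _ _ _ (by simp [hhd]; omega),
        List.getD_append_right _ _ _ _ (by simp [hhd, hlen2]; omega),
        List.getD_append _ _ _ _ (by simp [hhd, hlen2]; omega)]
      congr 1
      simp [hhd, hlen2]; omega
    exact ⟨by simpa using hgen 0 (by omega), by simpa using hgen 1 (by omega)⟩
  have hheader : ∀ j < 5, X j = hd.getD j 0 := by
    intro j hj
    simp only [hX]
    rw [hxeq, List.append_assoc, List.getD_append _ _ _ _ (by simp [hhd]; omega)]
  have hdelList : ∀ v : Fin n, delList X off v = (F v).map Fin.val := by
    intro v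
    rw [delList, hXlen]
    refine List.ext_getElem (by simp) fun j h1 h2 => ?_
    simp only [List.getElem_map, List.getElem_range]
    exact hXdel v j (by simpa using h2)
  have hjoins : ∀ (e : Fin L.length) (u v : Fin n), Joins X e u v ↔
      s(u, v) = s((L.get e).1, (L.get e).2) := by
    intro e u v
    obtain ⟨h1, h2⟩ := hXedge e
    rw [Sym2.eq_iff]
    constructor
    · rintro ⟨d, hd2, hu, hv⟩
      obtain rfl | rfl : d = 0 ∨ d = 1 := by omega
      · left
        simp only [add_zero, h1, Nat.sub_zero, h2] at hu hv
        exact ⟨Fin.ext hu.symm, Fin.ext hv.symm⟩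
      · right
        simp only [Nat.sub_self, add_zero, h1, h2] at hu hv
        exact ⟨Fin.ext hu.symm, Fin.ext hv.symm⟩
    · rintro (⟨rfl, rfl⟩ | ⟨rfl, rfl⟩)
      · exact ⟨0, by omega, by simpa using h1, by simpa using h2⟩
      · exact ⟨1, by omega, by simpa using h2, by simpa using h1⟩
  have hmemdel : ∀ (e : Fin L.length) (v : Fin n), (e : ℕ) ∈ delList X off v ↔
      s((L.get e).1, (L.get e).2) ∈ I.del v := by
    intro e v
    rw [hdelList, hdel]
    simp only [List.mem_map]
    constructor
    · rintro ⟨i, hi, hie⟩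
      obtain rfl : i = e := Fin.ext hie
      exact ⟨i, hi, rfl⟩
    · rintro ⟨i, hi, hie⟩
      exact ⟨i, hi, congrArg _ (hinjL i e hie)⟩
  have hinput : IsInput X off n L.length I.s I.t I.k I.mu := by
    refine ⟨?_, ?_, ?_, ?_, ?_, I.s.2, I.t.2, I.k_pos, ?_, ?_, ?_, ?_, ?_, ?_, ?_⟩
    · simpa [hhd] using hheader 0 (by omega)
    · simpa [hhd] using hheader 1 (by omega)
    · simpa [hhd] using hheader 2 (by omega)
    · simpa [hhd] using hheader 3 (by omega)
    · simpa [hhd] using hheader 4 (by omega)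
    · intro e he d hd2
      obtain ⟨h1, h2⟩ := hXedge ⟨e, he⟩
      obtain rfl | rfl : d = 0 ∨ d = 1 := by omega
      · simp only [add_zero]; rw [h1]; exact Fin.is_lt _
      · rw [h2]; exact Fin.is_lt _
    · simp [hoff]
    · intro v hv
      have h1 := hXlen ⟨v, hv⟩
      simp only at h1
      rw [h1]
      simp only [hoff]
      rw [List.take_succ_eq_append_getElem (by simpa using hv)]
      simp [hblk']
      omega
    · intro v hv j hj
      have h1 := hXlen ⟨v, hv⟩
      simp only at h1
      rw [h1] at hj
      have := hXdel ⟨v, hv⟩ j hj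
      simp only at this
      rw [this]
      exact Fin.is_lt _
    · intro v hv
      have h1 := hXlen ⟨v, hv⟩
      simp only at h1
      rw [h1]
      exact hFlen _
    · intro v hv
      have h1 := hXlen ⟨v, hv⟩
      simp only at h1
      rw [h1, ← hcard, SelfDeletingGraph.mu]
      exact Finset.le_sup (f := fun v => (I.del v).card) (Finset.mem_univ _)
    · obtain ⟨v, _, hv⟩ := Finset.exists_mem_eq_sup Finset.univ ⟨I.s, Finset.mem_univ _⟩
        (fun v => (I.del v).card)
      exact ⟨v, v.2, by rw [hXlen, ← hcard, SelfDeletingGraph.mu, hv]⟩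
  refine ⟨off, hinput, ?_, ?_, ?_, ?_⟩
  · have : L.Nodup := List.Nodup.of_map _ hnd
    simpa using this.length_le_card
  · have hb : ∀ l : List (Fin n), (l.flatMap blk).length ≤ l.length * (L.length + 1) := by
      intro l
      induction l with
      | nil => simp
      | cons v l ih =>
        have := hFlen v
        simp only [List.flatMap_cons, List.length_append, List.length_cons, hblk',
          List.length_map] at ih ⊢
        rw [Nat.add_mul]
        omega
    have := hb (List.finRange n)
    rw [hxeq]
    simp only [List.length_append, hes, hlen2, List.length_finRange, hhd] at this ⊢
    simp only [List.length_cons, List.length_nil]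
    omega
  · intro a
    by_cases ha : a < x.length
    · rw [List.getD_eq_getElem _ _ ha]
      have hmem := List.getElem_mem ha
      generalize x[a] = y at hmem
      rw [hxeq] at hmem
      simp only [hhd, hes, hblk', List.mem_append, List.mem_flatMap, List.mem_cons, List.mem_map,
        List.not_mem_nil, or_false] at hmem
      have hs := I.s.2
      have ht := I.t.2
      rcases hmem with ((rfl | rfl | rfl | rfl | rfl) | ⟨c, _, (rfl | rfl)⟩) |
        ⟨v, _, (rfl | ⟨i, _, rfl⟩)⟩
      · omega
      · omega
      · omega
      · omega
      · omega
      · have := c.1.2; omega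
      · have := c.2.2; omega
      · have := hFlen v; omega
      · have := i.2; omega
    · rw [List.getD_eq_default _ _ (by omega)]; omega
  · constructor
    · rintro ⟨p, hp, hconf, hlen⟩
      have hidx : ∀ i, ∃ e : ℕ, i < p.length → ∃ h : e < L.length,
          s(p.getVert i, p.getVert (i + 1)) = s((L.get ⟨e, h⟩).1, (L.get ⟨e, h⟩).2) := by
        intro i
        by_cases hi : i < p.length
        · have hadj := p.adj_getVert_succ hi
          have := (hedge s(p.getVert i, p.getVert (i + 1))).1 hadj
          rw [List.mem_map] at this
          obtain ⟨a, ha, hae⟩ := this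
          obtain ⟨j, hj⟩ := List.mem_iff_get.1 ha
          exact ⟨j, fun _ => ⟨j.2, by rw [← hae, ← hj]⟩⟩
        · exact ⟨0, fun h => absurd h hi⟩
      choose e he using hidx
      refine ⟨p.length, by omega, fun i => p.getVert i, e, ⟨by simp, ?_, ?_, ?_⟩, by simp⟩
      · exact fun i hi => (he i hi).1
      · intro i hi
        obtain ⟨h1, h2⟩ := he i hi
        exact (hjoins ⟨e i, h1⟩ _ _).2 h2
      · intro i hi j hj hmem
        obtain ⟨h1, h2⟩ := he i hi
        have := (hmemdel ⟨e i, h1⟩ _).1 hmem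
        rw [← h2] at this
        exact hconf i j hj hi this
    · rintro ⟨r₀, hr₀, w₀, e₀, hw₀, ht₀⟩
      -- The instance asks for a path, so repeated vertices are cut out before the walk is
      -- translated.
      obtain ⟨r, hr, w, e, hw, ht, hinj⟩ := exists_injOn_confWalk hw₀ ht₀
      have hlt : ∀ i ≤ r, w i < n := fun i hi => hw.vert_lt hinput hi
      -- The default `I.s` is used only beyond position `r`.
      set v : ℕ → Fin n := fun i => if h : w i < n then ⟨w i, h⟩ else I.s with hv
      have hvw : ∀ i ≤ r, (v i : ℕ) = w i := fun i hi => by simp [hv, hlt i hi]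
      have hsym : ∀ i, ∀ hi : i < r, s(v i, v (i + 1)) =
          s((L.get ⟨e i, hw.edge_lt i hi⟩).1, (L.get ⟨e i, hw.edge_lt i hi⟩).2) := by
        intro i hi
        rw [← hjoins, hvw i hi.le, hvw (i + 1) hi]
        exact hw.joins i hi
      have hadj : ∀ i < r, I.graph.Adj (v i) (v (i + 1)) := by
        intro i hi
        rw [← SimpleGraph.mem_edgeSet, hedge, hsym i hi]
        exact List.mem_map.2 ⟨_, List.get_mem _ _, rfl⟩
      obtain ⟨p, hp, hpv⟩ := exists_walk_of_adj v r hadj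
      have h0 : v 0 = I.s := Fin.ext (by rw [hvw 0 (by omega), hw.start])
      have h1 : v r = I.t := Fin.ext (by rw [hvw r le_rfl, ht])
      refine ⟨p.copy h0 h1, ?_, ?_, by simp [hp]; omega⟩
      · rw [SimpleGraph.Walk.isPath_copy, ← SimpleGraph.Walk.IsPath.getVert_injOn_iff]
        intro i hi j hj hij
        simp only [Set.mem_ofPred_eq, hp] at hi hj
        rw [hpv i hi, hpv j hj] at hij
        have := congrArg Fin.val hij
        rw [hvw i hi, hvw j hj] at this
        exact hinj hi hj this
      · intro i j hji hi
        simp only [SimpleGraph.Walk.length_copy, hp] at hi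
        simp only [SimpleGraph.Walk.getVert_copy]
        rw [hpv i hi.le, hpv (i + 1) hi, hpv j (by omega), hsym i hi, ← hmemdel, hvw j (by omega)]
        exact hw.conf i hi j hji

end RepresentativeWalks

namespace WordRAM

theorem Arrays.set_set (A : Arrays) (a i v v' : ℕ) : (A.set a i v).set a i v' = A.set a i v' := by
  funext a' i'; simp only [Arrays.set]; split <;> rfl

theorem Arrays.set_apply (A : Arrays) (a i v a' i' : ℕ) :
    A.set a i v a' i' = if a' = a ∧ i' = i then v else A a' i' := rfl

end WordRAM

/-! ### Address bounds, and the product attached to a stored walk -/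

namespace RepresentativeWalks

open WordRAM

/-- The numbers that govern the computation, with `Y` a common bound for the quantities and `Y ^ 5`
one for all addresses and intermediate results. -/
structure Context (x off : ℕ → ℕ) (n m s t k μ p M N Y base : ℕ) : Prop where
  input : IsInput x off n m s t k μ
  p_eq : p = k * μ
  M_eq : M = m + p + 1
  N_eq : N = pointCount p k
  base_eq : base = 5 + 2 * m + n + n * m
  n_le : n ≤ Y
  N_lt : N < Y
  M_lt : 4 * M + 2 ≤ Y
  le_Y : 16 ≤ Y

namespace Context

variable {x off : ℕ → ℕ} {n m s t k μ p M N Y base : ℕ}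

/-- A list of deleted edges occupies at most `m + 1` cells including its length. Hence `base = 5 + 2
* m + n * (m + 1)`, which is computed from `n` and `m` alone, lies behind the whole input. -/
theorem off_le (h : Context x off n m s t k μ p M N Y base) {v : ℕ} (hv : v ≤ n) :
    off v ≤ 5 + 2 * m + v * (m + 1) := by
  induction v with
  | zero => rw [h.input.off_zero]; omega
  | succ v ih =>
    have h1 := ih (by omega)
    have h2 := h.input.length_le v (by omega)
    rw [h.input.off_succ v (by omega), Nat.add_mul]
    omega

theorem off_lt_base (h : Context x off n m s t k μ p M N Y base) {v j : ℕ} (hv : v < n)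
    (hj : j ≤ x (off v)) : off v + j < base := by
  have h1 := h.off_le hv
  rw [h.input.off_succ v hv] at h1
  have h2 : (v + 1) * (m + 1) ≤ n * (m + 1) := Nat.mul_le_mul_right _ hv
  rw [Nat.mul_add n] at h2
  rw [h.base_eq]
  have h3 : v.succ * (m + 1) = (v + 1) * (m + 1) := rfl
  omega

theorem lt_N (h : Context x off n m s t k μ p M N Y base) : k < N ∧ p + 1 < N := by
  rw [h.N_eq]
  exact ⟨lt_pointCount_right p k, lt_pointCount_left p h.input.k_pos⟩

theorem sq_lt (h : Context x off n m s t k μ p M N Y base) : 3 * Y ^ 2 + 3 * Y + 5 < Y ^ 5 := by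
  have h16 := h.le_Y
  have h2 : 16 * Y ≤ Y ^ 2 := by nlinarith
  have h3 : 16 * Y ^ 2 ≤ Y ^ 5 := by
    have : Y ^ 5 = Y ^ 3 * Y ^ 2 := by ring
    rw [this]
    refine Nat.mul_le_mul_right _ ?_
    calc 16 ≤ Y := h16
      _ ≤ Y ^ 3 := Nat.le_self_pow (by norm_num) Y
  omega

theorem mul_le (_h : Context x off n m s t k μ p M N Y base) {a b : ℕ} (ha : a ≤ Y) (hb : b ≤ Y) :
    a * b ≤ Y ^ 2 := by
  rw [sq]; exact Nat.mul_le_mul ha hb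

theorem base_lt (h : Context x off n m s t k μ p M N Y base) : base < Y ^ 5 := by
  have h1 := h.sq_lt
  have h2 := h.M_lt
  have h3 := h.M_eq
  have h4 := h.mul_le h.n_le (show m ≤ Y by omega)
  have h5 := h.n_le
  rw [h.base_eq]
  omega

/-- The bucket of the vertex `v` at level `i` has number `i * n + v` and owns `N + 1` slots: at most
`N` are filled with rows, and the next one is free for a candidate under test. -/
theorem slot_lt (h : Context x off n m s t k μ p M N Y base) {i v b : ℕ} (hi : i < k) (hv : v < n)
    (hb : b ≤ N) : (i * n + v) * (N + 1) + b < Y ^ 3 := by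
  have h1 : i * n + v < k * n := by
    calc i * n + v < i * n + n := by omega
      _ = (i + 1) * n := by ring
      _ ≤ k * n := Nat.mul_le_mul_right _ hi
  have h2 : k * n ≤ Y * Y := Nat.mul_le_mul (by have := h.lt_N; have := h.N_lt; omega) h.n_le
  calc (i * n + v) * (N + 1) + b < (i * n + v) * (N + 1) + (N + 1) := by omega
    _ = (i * n + v + 1) * (N + 1) := by ring
    _ ≤ (Y * Y) * Y := Nat.mul_le_mul (by omega) h.N_lt
    _ = Y ^ 3 := by ring

theorem cell_lt (h : Context x off n m s t k μ p M N Y base) {a b c : ℕ} (ha : a < Y ^ 3)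
    (hb : b ≤ Y) (hc : c < Y) : a * b + c < Y ^ 5 := by
  have h16 := h.le_Y
  have h3 : Y ^ 4 ≤ Y ^ 5 := Nat.pow_le_pow_right (by omega) (by norm_num)
  calc a * b + c < a * Y + Y := by have := Nat.mul_le_mul_left a hb; omega
    _ = (a + 1) * Y := by ring
    _ ≤ Y ^ 3 * Y := Nat.mul_le_mul_right _ ha
    _ = Y ^ 4 := by ring
    _ ≤ Y ^ 5 := h3

theorem cube_le (h : Context x off n m s t k μ p M N Y base) : Y ^ 3 ≤ Y ^ 5 :=
  Nat.pow_le_pow_right (by have := h.le_Y; omega) (by norm_num)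

end Context

/-- The vertices stored in the first `len` cells of the slot `a`. -/
def pathAt (A : Arrays) (k a len : ℕ) : List ℕ := (List.range len).map fun j => A 8 (a * k + j)

theorem pathAt_succ (A : Arrays) (k a len : ℕ) :
    pathAt A k a (len + 1) = pathAt A k a len ++ [A 8 (a * k + len)] := by
  simp [pathAt, List.range_succ]

theorem forbidden_append_singleton (x off : ℕ → ℕ) (l : List ℕ) (v : ℕ) :
    forbidden x off (l ++ [v]) = forbidden x off l ++ delList x off v := by
  simp [forbidden]

/-- Compute the product of all `a - y` modulo the prime, where `a` runs through the edges deleted by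
the first `len` vertices of a slot. The slot, `len` and `y` are the variables `26`, `27`, `28`. -/
def evalCmd : Cmd :=
  .seq (.set 0 5 1) <|
  .loop 30 (.var 27) <|
    .bind 32 (.arr 8 (.var 26 * .var 5 + .var 30)) <|
    .bind 33 (.arr 1 (.var 32)) <|
    .loop 34 (.input (.var 33)) <|
      .set 0 5 ((.arr 0 5 * (.input (.var 33 + 1 + .var 34) + (.var 8 - .var 28))) % .var 8)

section specs

variable {x off : ℕ → ℕ} {n m s t k μ p M N Y base P : ℕ}

/-- Since subtraction is cut off at `0`, the factor `a - y` is computed as `a + (P - y)`; reduction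
modulo `P` after each multiplication keeps the numbers small. The command has two uses: tabulating
the products at the grid values `0, …, p`, and testing at `y = e` whether the edge `e` is forbidden.
-/
theorem evalCmd_spec (h : Context x off n m s t k μ p M N Y base) [Fact P.Prime]
    (hPM : P ≤ 2 * M) {env : ℕ → ℕ} {A : Arrays} {slot len y : ℕ} (h5 : env 5 = k) (h8 : env 8 = P)
    (h26 : env 26 = slot) (h27 : env 27 = len) (h28 : env 28 = y) (hslot : slot < Y ^ 3)
    (hlen : len ≤ k) (hy : y < P) (hoff : ∀ v < n, A 1 v = off v)
    (hpath : ∀ j < len, A 8 (slot * k + j) < n) :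
    Achieves base (Y ^ 5) x env A evalCmd (100 * (len * (μ + 1) + 1)) fun A' =>
      ∃ r, A' = A.set 0 5 r ∧ r < P ∧
        (r : ZMod P) = avoidProd (forbidden x off (pathAt A k slot len)) (y : ZMod P) := by
  have hP1 : 1 < P := (Fact.out : P.Prime).one_lt
  have hV := h.sq_lt
  have hM := h.M_lt
  have hMe := h.M_eq
  have hkN := h.lt_N
  have hN := h.N_lt
  have hnY := h.n_le
  have hbV := h.base_lt
  refine Achieves.seq (B₁ := 9) (B₂ := 100 * (len * (μ + 1)) + 10)
    (Q₁ := fun A' => A' = A.set 0 5 1) ?_ ?_ (by omega)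
  · refine Achieves.set ?_ ?_ ?_ (by simp [Term.cost]) ?_
    · simp; omega
    · simp; omega
    · simp; omega
    · simp
  rintro _ rfl
  refine Achieves.loop (b := len) (t := 100 * μ + 60)
    (fun j A' => ∃ r, A' = A.set 0 5 r ∧ r < P ∧
        (r : ZMod P) = avoidProd (forbidden x off (pathAt A k slot j)) (y : ZMod P))
    ?_ ?_ ?_ ?_ ?_ ?_ ?_
  · simp
  · simp [h27]
  · omega
  · exact ⟨1, rfl, hP1, by simp [pathAt, forbidden, avoidProd]⟩
  · rintro j hj _ ⟨r, rfl, hr, hrv⟩ -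
    have hcell := h.cell_lt hslot (show k ≤ Y by omega) (show j < Y by omega)
    set v := A 8 (slot * k + j) with hv
    have hvn := hpath j hj
    rw [← hv] at hvn
    refine Achieves.bind (B' := 60 * μ + 36) ?_ ?_ (by simp; omega)
    · simp [Cmd.loopEnv, h26, h5]; omega
    refine Achieves.bind (B' := 60 * μ + 20) ?_ ?_ (by simp; omega)
    · simp [Cmd.loopEnv, h26, h5, Arrays.set_array_ne, ← hv]; omega
    have hxo := h.input.length_le_mu v hvn
    have hxo' := h.input.length_le v hvn
    refine Achieves.loop (b := x (off v)) (t := 50)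
      (fun z A' => ∃ r, A' = A.set 0 5 r ∧ r < P ∧
        (r : ZMod P) = avoidProd (forbidden x off (pathAt A k slot j) ++
          (List.range z).map fun q => x (off v + 1 + q)) (y : ZMod P))
      ?_ ?_ ?_ ?_ ?_ ?_ ?_
    · simp [Cmd.loopEnv, h26, h5, Arrays.set_array_ne, ← hv, hoff v hvn]
      simpa using h.off_lt_base hvn (Nat.zero_le _)
    · simp [Cmd.loopEnv, h26, h5, Arrays.set_array_ne, ← hv, hoff v hvn]
    · omega
    · exact ⟨r, rfl, hr, by simpa using hrv⟩
    · rintro z hz _ ⟨r, rfl, hr, hrv⟩ -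
      have hb := h.off_lt_base hvn (show 1 + z ≤ x (off v) by omega)
      have ha := h.input.del_lt v hvn z hz
      have hmul := h.mul_le (show r ≤ Y by omega)
        (show x (off v + 1 + z) + (P - y) ≤ Y by omega)
      have hmod := Nat.mod_lt (r * (x (off v + 1 + z) + (P - y))) (show 0 < P by omega)
      refine Achieves.set ?_ ?_ ?_ (by simp) ?_
      · simp; omega
      · simp; omega
      · simp [Cmd.loopEnv, h26, h5, h8, h28, Arrays.set_array_ne, ← hv, hoff v hvn]
        omega
      · refine ⟨_, Arrays.set_set _ _ _ _ _, ?_, ?_⟩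
        · simp [Cmd.loopEnv, h26, h5, h8, h28, Arrays.set_array_ne, ← hv, hoff v hvn]
          exact hmod
        · simp [Cmd.loopEnv, h26, h5, h8, h28, Arrays.set_array_ne, ← hv, hoff v hvn]
          -- The summand `P` is zero in `ZMod P`, so the factor is `a - y`.
          rw [Nat.cast_sub hy.le, hrv, List.range_succ, List.map_append, ← List.append_assoc,
            avoidProd_append _ (List.map _ [z]), ZMod.natCast_self, zero_sub, ← sub_eq_add_neg]
          congr 1
          simp [avoidProd]
    · simp; omega
    · rintro A' ⟨r, rfl, hr, hrv⟩
      refine ⟨r, rfl, hr, ?_⟩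
      rw [hrv, pathAt_succ, forbidden_append_singleton, delList, ← hv]
  · simp; nlinarith
  · exact fun A' h => h

end specs

end RepresentativeWalks

/-! ### Preprocessing: offsets, the prime, the interpolation points -/

namespace RepresentativeWalks

open WordRAM

variable {x off : ℕ → ℕ} {n m s t k μ p M N Y base : ℕ}

/-- Find the positions of the lists of deleted edges, and their maximal length. -/
def scanCmd : Cmd :=
  .seq (.set 0 0 (5 + 2 * .var 1)) <|
  .loop 10 (.var 0) <|
    .bind 12 (.arr 0 0) <|
    .seq (.set 1 (.var 10) (.var 12)) <|
    .seq (.ite (.op .lt (.arr 0 1) (.input (.var 12))) (.set 0 1 (.input (.var 12))) .skip) <|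
    .set 0 0 (.var 12 + 1 + .input (.var 12))

/-- The maximum `μ` is not part of the input but is needed for `p = k * μ`. Jumping from one length
entry to the next takes time proportional to `n`, whatever the lengths of the lists. -/
theorem scanCmd_spec (h : Context x off n m s t k μ p M N Y base) {env : ℕ → ℕ} {A : Arrays}
    (h0 : env 0 = n) (h1 : env 1 = m) (hA : A 0 1 = 0) :
    Achieves base (Y ^ 5) x env A scanCmd (100 * (n + 1)) fun A' =>
      (∀ v < n, A' 1 v = off v) ∧ A' 0 1 = μ := by
  have hV := h.sq_lt
  have hM := h.M_lt
  have hMe := h.M_eq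
  have hnY := h.n_le
  have hbV := h.base_lt
  have hbe := h.base_eq
  refine Achieves.seq (B₁ := 20) (B₂ := 90 * n + 20)
    (Q₁ := fun A' => A' = A.set 0 0 (5 + 2 * m)) ?_ ?_ (by omega)
  · refine Achieves.set ?_ ?_ ?_ (by simp) ?_
    · simp; omega
    · simp; omega
    · simp [h1]; omega
    · simp [h1]
  rintro _ rfl
  refine Achieves.loop (b := n) (t := 82)
    (fun v A' => A' 0 0 = off v ∧ (∀ u < v, A' 1 u = off u) ∧ (∀ u < v, x (off u) ≤ A' 0 1) ∧
      A' 0 1 ≤ μ) (by simp) (by simp [h0]) (by omega) ?_ ?_ (by simp; omega) ?_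
  · simp [h.input.off_zero, Arrays.set_apply, hA]
  · rintro v hv A' ⟨i1, i2, i3, i4⟩ -
    have hb := h.off_lt_base hv (le_refl _)
    have hb0 := h.off_lt_base hv (Nat.zero_le _)
    have hmu := h.input.length_le_mu v hv
    have hmm := h.input.length_le v hv
    rw [add_zero] at hb0
    have hsucc := h.input.off_succ v hv
    refine Achieves.bind (B' := 73) (by simp; omega) ?_ (by simp)
    refine Achieves.seq (B₁ := 9) (B₂ := 64) (Q₁ := fun A'' => A'' = A'.set 1 v (off v)) ?_ ?_ le_rfl
    · refine Achieves.set (by simp) ?_ (by simp) (by simp) ?_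
      · simp [Cmd.loopEnv]; omega
      · simp [Cmd.loopEnv, i1]
    rintro _ rfl
    refine Achieves.seq (B₁ := 40) (B₂ := 20)
      (Q₁ := fun A'' => A'' = (A'.set 1 v (off v)).set 0 1 (max (A' 0 1) (x (off v)))) ?_ ?_
      (by omega)
    · refine Achieves.ite (B' := 15) ?_ ?_ ?_ (by simp)
      · simp [Cmd.loopEnv, i1]; split <;> omega
      · intro hlt
        simp [Cmd.loopEnv, i1, Arrays.set_apply] at hlt
        refine Achieves.set (by simp; omega) (by simp; omega) ?_ (by simp) ?_
        · simp [Cmd.loopEnv, i1]; omega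
        · simp [Cmd.loopEnv, i1, max_eq_right hlt.le]
      · intro hlt
        simp [Cmd.loopEnv, i1, Arrays.set_apply] at hlt
        refine Achieves.skip (by omega) ?_
        rw [max_eq_left hlt]
        funext a i
        by_cases hc : a = 0 ∧ i = 1
        · obtain ⟨rfl, rfl⟩ := hc; simp [Arrays.set_apply]
        · rw [Arrays.set_apply _ 0 1, if_neg hc]
    rintro _ rfl
    refine Achieves.set (by simp; omega) (by simp; omega) ?_ (by simp) ?_
    · simp [Cmd.loopEnv, i1]; omega
    · refine ⟨?_, ?_, ?_, ?_⟩
      · simp [Cmd.loopEnv, i1, hsucc]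
      · intro u hu
        by_cases huv : u = v
        · subst huv; simp [Arrays.set_apply]
        · simp [Arrays.set_apply, huv]; exact i2 u (by omega)
      · intro u hu
        simp only [Arrays.set_apply]
        by_cases huv : u = v
        · subst huv; simp
        · simp; left; exact i3 u (by omega)
      · simp [Arrays.set_apply]; omega
  · rintro A' ⟨_, i2, i3, i4⟩
    refine ⟨i2, le_antisymm i4 ?_⟩
    obtain ⟨v, hv, hvm⟩ := h.input.mu_attained
    rw [← hvm]; exact i3 v hv

/-- Find a prime between `M + 1` and `2 * M` by a sieve. -/
def sieveCmd : Cmd :=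
  .seq (.loop 10 (2 * .var 7) <|
    .bind 12 (.var 10 + 2) <|
    .loop 13 (2 * .var 7 / .var 12 - 1) <|
      .set 2 ((.var 13 + 2) * .var 12) 1) <|
  .loop 10 (.var 7) <|
    .ite (.arr 2 (.var 7 + 1 + .var 10)) .skip (.set 0 2 (.var 7 + 1 + .var 10))

/-- A number in the range is composite exactly if it is a product of two factors that are at least
`2`, and Bertrand's postulate provides a prime above `M`. Such a prime exceeds all edge numbers and
all grid values. Crossing out multiples costs a harmonic sum, the only source of the logarithm in
the running time. -/
theorem sieveCmd_spec (h : Context x off n m s t k μ p M N Y base) {env : ℕ → ℕ} {A : Arrays}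
    (h7 : env 7 = M) (hA : ∀ c, A 2 c = 0) :
    Achieves base (Y ^ 5) x env A sieveCmd
      (100 * (M + 1) + 100 * ∑ i ∈ Finset.range (2 * M), (2 * M / (i + 2) + 1)) fun A' =>
      (A' 0 2).Prime ∧ M < A' 0 2 ∧ A' 0 2 ≤ 2 * M := by
  have hV := h.sq_lt
  have hM := h.M_lt
  have hMe := h.M_eq
  refine Achieves.seq
    (B₁ := 10 + ∑ i ∈ Finset.range (2 * M), 100 * (2 * M / (i + 2) + 1)) (B₂ := 100 * M + 20)
    (Q₁ := fun A' => ∀ c ≤ 2 * M, A' 2 c ≠ 0 ↔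
      ∃ d, 2 ≤ d ∧ d < 2 * M + 2 ∧ ∃ z, 2 ≤ z ∧ c = z * d) ?_ ?_
      (by rw [← Finset.mul_sum]; omega)
  · refine Achieves.loop_sum (b := 2 * M) (t := fun i => 40 * (2 * M / (i + 2)) + 40)
      (fun i A' => ∀ c ≤ 2 * M, A' 2 c ≠ 0 ↔ ∃ d, 2 ≤ d ∧ d < i + 2 ∧ ∃ z, 2 ≤ z ∧ c = z * d)
      (by simp [h7]; omega) (by simp [h7]) (by omega) ?_ ?_ ?_ (fun _ h => h)
    · intro c _
      simp only [hA, ne_eq, not_true_eq_false, false_iff]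
      rintro ⟨d, h1, h2, _⟩
      omega
    · intro i hi A' hI _
      have hdivle : 2 * M / (i + 2) ≤ 2 * M := Nat.div_le_self _ _
      refine Achieves.bind (B' := 40 * (2 * M / (i + 2)) + 20)
        (by simp [Cmd.loopEnv]; omega) ?_ (by simp; omega)
      -- The multiples of `i + 2` are crossed out from the double onwards, hence one round fewer
      -- than the quotient.
      refine Achieves.loop (b := 2 * M / (i + 2) - 1) (t := 30)
        (fun z A'' => ∀ c ≤ 2 * M, A'' 2 c ≠ 0 ↔ A' 2 c ≠ 0 ∨ ∃ z' < z, c = (z' + 2) * (i + 2))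
        ?_ ?_ (by omega) (by simp) ?_ (by simp; omega) ?_
      · simp [Cmd.loopEnv, h7]; omega
      · simp [Cmd.loopEnv, h7]
      · intro z hz A'' hI' _
        have hle : (z + 2) * (i + 2) ≤ 2 * M := by
          calc (z + 2) * (i + 2) ≤ (2 * M / (i + 2)) * (i + 2) :=
                Nat.mul_le_mul_right _ (by omega)
            _ ≤ 2 * M := Nat.div_mul_le_self _ _
        refine Achieves.set ?_ ?_ (by simp; omega) (by simp) ?_
        · simp [Cmd.loopEnv]; omega
        · simp [Cmd.loopEnv]; omega
        · intro c hc
          simp only [Arrays.set_apply, true_and]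
          simp [Cmd.loopEnv]
          by_cases hcz : c = (z + 2) * (i + 2)
          · simp only [hcz, if_true]
            refine ⟨fun _ => Or.inr ⟨z, by omega, rfl⟩, fun _ => one_ne_zero⟩
          · rw [if_neg hcz]
            have := hI' c hc
            simp only [ne_eq] at this
            rw [this]
            constructor
            · rintro (h' | ⟨z', hz', rfl⟩)
              · exact Or.inl h'
              · exact Or.inr ⟨z', by omega, rfl⟩
            · rintro (h' | ⟨z', hz', rfl⟩)
              · exact Or.inl h'
              · refine Or.inr ⟨z', ?_, rfl⟩
                rcases Nat.lt_or_eq_of_le hz' with h' | rfl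
                · exact h'
                · exact absurd rfl hcz
      · intro A'' hI' c hc
        rw [hI' c hc, hI c hc]
        constructor
        · rintro (⟨d, h1, h2, z, h3, h4⟩ | ⟨z', hz', rfl⟩)
          · exact ⟨d, h1, by omega, z, h3, h4⟩
          · exact ⟨i + 2, by omega, by omega, z' + 2, by omega, rfl⟩
        · rintro ⟨d, h1, h2, z, h3, rfl⟩
          rcases Nat.lt_succ_iff_lt_or_eq.1 (show d < i + 2 + 1 by omega) with h' | rfl
          · exact Or.inl ⟨d, h1, h', z, h3, rfl⟩
          · refine Or.inr ⟨z - 2, ?_, by congr 1; omega⟩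
            have : z ≤ 2 * M / (i + 2) := (Nat.le_div_iff_mul_le (by omega)).2 hc
            omega
    · simp only [Term.cost_mul, Term.cost_ofNat, Term.cost_var]
      have : ∑ i ∈ Finset.range (2 * M), (40 * (2 * M / (i + 2)) + 40 + 8) ≤
          ∑ i ∈ Finset.range (2 * M), 100 * (2 * M / (i + 2) + 1) :=
        Finset.sum_le_sum fun i _ => by omega
      omega
  · intro A₁ hA₁
    have hsieve : ∀ c, M < c → c ≤ 2 * M → (A₁ 2 c = 0 ↔ c.Prime) := by
      intro c h1 h2
      rw [← not_iff_not, ← ne_eq, hA₁ c h2, Nat.not_prime_iff_exists_mul_eq (by omega)]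
      constructor
      · rintro ⟨d, hd, _, z, hz, rfl⟩
        exact ⟨d, z, by nlinarith, by nlinarith, Nat.mul_comm d z⟩
      · rintro ⟨a, b, ha, hb, rfl⟩
        have ha2 : 2 ≤ a := by
          by_contra hcon
          have : a = 0 ∨ a = 1 := by omega
          rcases this with rfl | rfl
          · omega
          · omega
        have hb2 : 2 ≤ b := by
          by_contra hcon
          have : b = 0 ∨ b = 1 := by omega
          rcases this with rfl | rfl
          · omega
          · omega
        exact ⟨b, hb2, by omega, a, ha2, rfl⟩
    refine Achieves.loop (b := M) (t := 30)
      (fun i A' => A' 2 = A₁ 2 ∧ ∀ z < i, (M + 1 + z).Prime →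
        (A' 0 2).Prime ∧ M < A' 0 2 ∧ A' 0 2 ≤ 2 * M)
      (by simp) (by simp [h7]) (by omega) (by simp) ?_ (by simp; omega) ?_
    · rintro i hi A' ⟨hI1, hI2⟩ -
      refine Achieves.ite (B' := 14) ?_ ?_ ?_ (by simp)
      · simp [Cmd.loopEnv, h7]; omega
      · intro hne
        simp [Cmd.loopEnv, h7, hI1] at hne
        refine Achieves.skip (by omega) ⟨hI1, fun z hz hp => ?_⟩
        rcases Nat.lt_succ_iff_lt_or_eq.1 hz with h' | rfl
        · exact hI2 z h' hp
        · exact absurd ((hsieve _ (by omega) (by omega)).2 hp) hne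
      · intro heq
        simp [Cmd.loopEnv, h7, hI1] at heq
        refine Achieves.set (by simp; omega) (by simp; omega) (by simp [Cmd.loopEnv, h7]; omega)
          (by simp) ⟨by simp [Arrays.set_array_ne, hI1], fun z _ _ => ?_⟩
        have := (hsieve (M + 1 + i) (by omega) (by omega)).1 heq
        simp [Cmd.loopEnv, h7]
        exact ⟨this, by omega, by omega⟩
    · rintro A' ⟨-, hI⟩
      -- The search meets at least one prime by Bertrand's postulate; every later prime overwrites
      -- the stored one, which does no harm.
      obtain ⟨q, hq, h1, h2⟩ := Nat.exists_prime_lt_and_le_two_mul M (by omega)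
      refine hI (q - (M + 1)) (by omega) ?_
      rwa [show M + 1 + (q - (M + 1)) = q by omega]

/-- The lists in `L` are stored as a tree: the array `4` holds the first elements, the array `3`
points to the rest. -/
structure StoresTree (A : Arrays) (L : List (List ℕ)) : Prop where
  count : A 0 4 = L.length
  first : ∀ c < L.length, A 4 c = (L.getD c []).headD 0
  root : L.getD 0 [] = []
  parent_lt : ∀ c < L.length, 0 < c → A 3 c < c
  eq_cons : ∀ c < L.length, 0 < c → L.getD c [] = A 4 c :: L.getD (A 3 c) []

/-- A new list shares its tail with node `i`, so it costs two cells whatever its length. -/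
theorem StoresTree.append {A : Arrays} {L : List (List ℕ)} (h : StoresTree A L) {i y : ℕ}
    (hi : i < L.length) :
    StoresTree (((A.set 3 L.length i).set 4 L.length y).set 0 4 (L.length + 1))
      (L ++ [y :: L.getD i []]) := by
  have hget : ∀ c < L.length, (L ++ [y :: L.getD i []]).getD c [] = L.getD c [] := fun c hc =>
    List.getD_append _ _ _ _ hc
  have hlast : (L ++ [y :: L.getD i []]).getD L.length [] = y :: L.getD i [] := by
    rw [List.getD_append_right _ _ _ _ le_rfl]; simp
  have hor : ∀ c, c < (L ++ [y :: L.getD i []]).length → c < L.length ∨ c = L.length := by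
    intro c hc
    simp only [List.length_append, List.length_singleton] at hc
    omega
  refine ⟨by simp, fun c hc => ?_, ?_, fun c hc hpos => ?_, fun c hc hpos => ?_⟩
  · rcases hor c hc with hc | rfl
    · rw [hget c hc, ← h.first c hc]
      simp [Arrays.set_apply, hc.ne]
    · rw [hlast]; simp [Arrays.set_apply]
  · rw [hget 0 (by omega)]; exact h.root
  · rcases hor c hc with hc | rfl
    · simpa [Arrays.set_apply, hc.ne] using h.parent_lt c hc hpos
    · simpa [Arrays.set_apply] using hi
  · rcases hor c hc with hc | rfl
    · have hp := h.parent_lt c hc hpos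
      have := h.eq_cons c hc hpos
      simp only [Arrays.set_apply, hc.ne, and_false, if_false, false_and,
        show (3 : ℕ) ≠ 4 by decide, show (4 : ℕ) ≠ 3 by decide, show (3 : ℕ) ≠ 0 by decide,
        show (4 : ℕ) ≠ 0 by decide]
      rw [hget c hc, hget _ (by omega), this]
    · simp only [Arrays.set_apply, false_and, if_false, and_self, if_true,
        show (3 : ℕ) ≠ 4 by decide, show (3 : ℕ) ≠ 0 by decide,
        show (4 : ℕ) ≠ 0 by decide]
      rw [hlast, hget i hi]

/-- Store all nonincreasing lists of length at most `k` with entries at most `p`. -/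
def treeCmd : Cmd :=
  .seq (.set 0 3 0) <| .seq (.set 0 4 1) <|
  .loop 10 (.var 5) <|
    .bind 12 (.arr 0 3) <| .bind 13 (.arr 0 4) <|
    .seq (.set 0 3 (.var 13)) <|
    .loop 14 (.var 13 - .var 12) <|
      .bind 16 (.var 12 + .var 14) <| .bind 17 (.arr 4 (.var 16)) <|
      .loop 18 (.var 6 + 1 - .var 17) <|
        .bind 20 (.arr 0 4) <|
        .seq (.set 3 (.var 20) (.var 16)) <| .seq (.set 4 (.var 20) (.var 17 + .var 18)) <|
        .set 0 4 (.var 20 + 1)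

theorem exists_pointListsUpTo_eq_append (p d : ℕ) :
    ∃ pre, pointListsUpTo p d = pre ++ pointLists p d := by
  cases d with
  | zero => exact ⟨[], rfl⟩
  | succ d => exact ⟨_, rfl⟩

theorem length_pointListsUpTo_mono (p : ℕ) {d q : ℕ} (h : d ≤ q) :
    (pointListsUpTo p d).length ≤ pointCount p q := by
  rw [pointCount]
  induction q with
  | zero => obtain rfl : d = 0 := by omega
            exact le_rfl
  | succ q ih =>
    rcases Nat.le_succ_iff.1 h with h | rfl
    · exact (ih h).trans (by simp [pointListsUpTo])
    · exact le_rfl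

/-- Cell `3` of array `0` marks where the lists of maximal length begin. Only these are extended in
the next round, each by all admissible first elements, so every list is produced behind its tail.
Each of the three nested loops has at most `N` rounds; this crude bound is good enough, because the
levels cost `N ^ 4` anyway. -/
theorem treeCmd_spec (h : Context x off n m s t k μ p M N Y base) {env : ℕ → ℕ} {A : Arrays}
    (h5 : env 5 = k) (h6 : env 6 = p) (hA : A 4 0 = 0) :
    Achieves base (Y ^ 5) x env A treeCmd (400 * N ^ 3) fun A' =>
      StoresTree A' (pointListsUpTo p k) := by
  have hV := h.sq_lt
  have hM := h.M_lt
  have hMe := h.M_eq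
  have hN := h.N_lt
  have hkN := h.lt_N
  have hNe := h.N_eq
  have hN1 : 1 ≤ N := by omega
  have hpow : N ≤ N ^ 2 ∧ N ^ 2 ≤ N ^ 3 :=
    ⟨Nat.le_self_pow (by norm_num) N, Nat.pow_le_pow_right hN1 (by norm_num)⟩
  refine Achieves.seq (B₁ := 20) (B₂ := 300 * N ^ 3 + 40)
    (Q₁ := fun A' => A' = A.set 0 3 0) ?_ ?_ (by omega)
  · exact Achieves.set (by simp; omega) (by simp; omega) (by simp; omega) (by simp) (by simp)
  rintro _ rfl
  refine Achieves.seq (B₁ := 20) (B₂ := 300 * N ^ 3 + 20)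
    (Q₁ := fun A' => A' = (A.set 0 3 0).set 0 4 1) ?_ ?_ (by omega)
  · exact Achieves.set (by simp; omega) (by simp; omega) (by simp; omega) (by simp) (by simp)
  rintro _ rfl
  refine Achieves.loop (b := k) (t := 180 * N ^ 2 + 70)
    (fun d A' => StoresTree A' (pointListsUpTo p d) ∧
      A' 0 3 + (pointLists p d).length = (pointListsUpTo p d).length)
    (by simp) (by simp [h5]) (by omega) ?_ ?_ ?_ (fun _ h => h.1)
  · refine ⟨⟨?_, ?_, ?_, ?_, ?_⟩, ?_⟩
    · simp [pointListsUpTo]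
    · intro c hc
      obtain rfl : c = 0 := by simpa [pointListsUpTo] using hc
      simp [Arrays.set_apply, hA, pointListsUpTo]
    · simp [pointListsUpTo]
    · intro c hc hpos
      simp [pointListsUpTo] at hc; omega
    · intro c hc hpos
      simp [pointListsUpTo] at hc; omega
    · simp [Arrays.set_apply, pointListsUpTo, pointLists]
  · rintro d hd A' ⟨hT, hlo⟩ -
    -- The lists of length `d` are the last ones in the table, starting at index `pre.length`.
    obtain ⟨pre, hpre⟩ := exists_pointListsUpTo_eq_append p d
    have hprelen : A' 0 3 = pre.length := by
      rw [hpre, List.length_append] at hlo; omega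
    have hlenN := length_pointListsUpTo_mono p hd
    rw [← hNe] at hlenN
    have hlenN' : (pointListsUpTo p d).length + (pointLists p (d + 1)).length ≤ N := by
      simpa [pointListsUpTo] using hlenN
    refine Achieves.bind (B' := 180 * N ^ 2 + 60) (by simp; omega) ?_ (by simp; omega)
    refine Achieves.bind (B' := 180 * N ^ 2 + 50) (by simp; omega) ?_ (by simp; omega)
    refine Achieves.seq (B₁ := 20) (B₂ := 180 * N ^ 2 + 30)
      (Q₁ := fun A'' => A'' = A'.set 0 3 (pointListsUpTo p d).length) ?_ ?_ (by omega)
    · exact Achieves.set (by simp; omega) (by simp; omega) (by simp) (by simp)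
        (by simp [hT.count])
    rintro _ rfl
    refine Achieves.loop (b := (pointLists p d).length) (t := 120 * N + 40)
      (fun j A'' => StoresTree A''
        (pointListsUpTo p d ++ ((pointLists p d).take j).flatMap (extensions p)) ∧
        A'' 0 3 = (pointListsUpTo p d).length) ?_ ?_ (by omega) ?_ ?_ ?_ ?_
    · simp [Cmd.loopEnv, hT.count]; omega
    · simp [Cmd.loopEnv, hT.count]; omega
    · refine ⟨?_, by simp⟩
      simp only [List.take_zero, List.flatMap_nil, List.append_nil]
      refine ⟨?_, ?_, hT.root, ?_, ?_⟩
      · simpa [Arrays.set_apply] using hT.count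
      · simpa [Arrays.set_array_ne] using hT.first
      · simpa [Arrays.set_array_ne] using hT.parent_lt
      · simpa [Arrays.set_array_ne] using hT.eq_cons
    · rintro j hj A'' ⟨hT', hlo'⟩ -
      set l := (pointLists p d)[j] with hl
      set L := pointListsUpTo p d ++ ((pointLists p d).take j).flatMap (extensions p) with hL
      have hidx : pre.length + j < (pointListsUpTo p d).length := by
        rw [hpre, List.length_append]; omega
      have hidxL : pre.length + j < L.length := by
        rw [hL, List.length_append]; omega
      have hgetl : L.getD (pre.length + j) [] = l := by
        rw [hL, List.getD_append _ _ _ _ hidx, hpre,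
          List.getD_append_right _ _ _ _ (by omega), Nat.add_sub_cancel_left,
          List.getD_eq_getElem _ _ hj]
      have hsplit := flatMap_eq_append (extensions p) (pointLists p d) hj
      have hLlen : L.length + (extensions p l).length ≤ N := by
        have h1 := congrArg List.length hsplit
        have h2 : pointLists p (d + 1) = (pointLists p d).flatMap (extensions p) := rfl
        rw [h2] at hlenN'
        simp only [List.length_append] at h1
        rw [hL, List.length_append]
        simp only [← hl] at h1
        omega
      obtain ⟨y₀, hy₀⟩ : ∃ y₀, l.headD 0 = y₀ := ⟨_, rfl⟩
      have hextl : extensions p l = (List.range (p + 1 - y₀)).map fun z' => (y₀ + z') :: l := by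
        rw [extensions, hy₀]
      have hext : (extensions p l).length = p + 1 - y₀ := by simp [hextl]
      have hhead : y₀ ≤ p := hy₀ ▸ headD_le_of_mem_pointLists (List.getElem_mem hj)
      have h4 : A'' 4 (pre.length + j) = y₀ := by
        rw [hT'.first _ hidxL, hgetl, hy₀]
      refine Achieves.bind (B' := 120 * N + 34) ?_ ?_ (by simp; omega)
      · simp [Cmd.loopEnv, hprelen]; omega
      refine Achieves.bind (B' := 120 * N + 20) ?_ ?_ (by simp; omega)
      · simp [Cmd.loopEnv, hprelen]; omega
      refine Achieves.loop (b := p + 1 - y₀) (t := 100)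
        (fun z A₃ => StoresTree A₃ (L ++ (List.range z).map fun z' => (y₀ + z') :: l) ∧
          A₃ 0 3 = (pointListsUpTo p d).length) ?_ ?_ (by omega) ?_ ?_ ?_ ?_
      · simp [Cmd.loopEnv, hprelen, h6, h4]; omega
      · simp [Cmd.loopEnv, hprelen, h6, h4]
      · simpa using ⟨hT', hlo'⟩
      · rintro z hz A₃ ⟨hT₃, hlo₃⟩ -
        set L₃ := L ++ (List.range z).map fun z' => (y₀ + z') :: l with hL₃
        have hL₃len : L₃.length = L.length + z := by simp [hL₃]
        have hget₃ : L₃.getD (pre.length + j) [] = l := by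
          rw [hL₃, List.getD_append _ _ _ _ hidxL, hgetl]
        have happ := hT₃.append (i := pre.length + j) (y := y₀ + z) (by omega)
        rw [hget₃] at happ
        refine Achieves.bind (B' := 60) (by simp; omega) ?_ (by simp)
        refine Achieves.seq (B₁ := 20) (B₂ := 40)
          (Q₁ := fun B => B = A₃.set 3 L₃.length (pre.length + j)) ?_ ?_ le_rfl
        · refine Achieves.set (by simp) ?_ (by simp) (by simp) ?_
          · simp [hT₃.count]; omega
          · simp [Cmd.loopEnv, hT₃.count, hprelen]
        rintro _ rfl
        refine Achieves.seq (B₁ := 20) (B₂ := 20)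
          (Q₁ := fun B => B = (A₃.set 3 L₃.length (pre.length + j)).set 4 L₃.length
            (y₀ + z)) ?_ ?_ le_rfl
        · refine Achieves.set (by simp) ?_ ?_ (by simp) ?_
          · simp [hT₃.count]; omega
          · simp [Cmd.loopEnv, hprelen, h4]; omega
          · simp [Cmd.loopEnv, hT₃.count, hprelen, h4]
        rintro _ rfl
        refine Achieves.set (by simp; omega) (by simp; omega) ?_ (by simp) ?_
        · simp [hT₃.count]; omega
        · constructor
          · rw [List.range_succ, List.map_append, ← List.append_assoc, ← hL₃]
            simpa [hT₃.count] using happ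
          · simpa [Arrays.set_apply] using hlo₃
      · simp
        have : p + 1 - y₀ ≤ N := by omega
        nlinarith
      · rintro A₃ ⟨hT₃, hlo₃⟩
        refine ⟨?_, hlo₃⟩
        rw [List.take_succ_eq_append_getElem hj, List.flatMap_append, ← List.append_assoc, ← hL]
        simpa [hextl, ← hl] using hT₃
    · simp
      have : (pointLists p d).length ≤ N := by omega
      nlinarith
    · rintro A'' ⟨hT', hlo'⟩
      rw [List.take_length] at hT'
      refine ⟨hT', ?_⟩
      rw [hlo']
      simp [pointListsUpTo]
  · simp
    have h1 : k * (180 * N ^ 2 + 70 + 8) ≤ N * (258 * N ^ 2) :=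
      Nat.mul_le_mul (by omega) (by omega)
    have h2 : N * (258 * N ^ 2) = 258 * N ^ 3 := by ring
    omega

end RepresentativeWalks

/-! ### The vector of a candidate walk and its elimination -/

namespace RepresentativeWalks

open WordRAM

variable {x off : ℕ → ℕ} {n m s t k μ p M N Y base P : ℕ}

/-- Blocks of `c` cells with different numbers are disjoint. All framing between slots and between
buckets rests on this. -/
theorem mul_add_ne {a b c i j : ℕ} (h : a ≠ b) (hi : i < c) (hj : j < c) :
    a * c + i ≠ b * c + j := by
  intro heq
  have h1 := congrArg (· / c) heq
  have hc : 0 < c := by omega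
  simp only [Nat.mul_comm _ c, Nat.mul_add_div hc, Nat.div_eq_of_lt hi, Nat.div_eq_of_lt hj] at h1
  exact h (by simpa using h1)

/-- Store the walk in slot `var 20`, extended by the vertex `var 17`, in slot `var 23`. -/
def copyCmd : Cmd :=
  .seq (.loop 24 (.var 10 + 1) <|
    .set 8 (.var 23 * .var 5 + .var 24) (.arr 8 (.var 20 * .var 5 + .var 24))) <|
  .set 8 (.var 23 * .var 5 + (.var 10 + 1)) (.var 17)

theorem copyCmd_spec (h : Context x off n m s t k μ p M N Y base) {env : ℕ → ℕ} {A : Arrays}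
    {i v src sl : ℕ} (h5 : env 5 = k) (h10 : env 10 = i) (h17 : env 17 = v) (h20 : env 20 = src)
    (h23 : env 23 = sl) (hi : i + 1 < k) (hsrc : src < Y ^ 3) (hsl : sl < Y ^ 3)
    (hne : src ≠ sl) :
    Achieves base (Y ^ 5) x env A copyCmd (100 * N) fun A' =>
      pathAt A' k sl (i + 2) = pathAt A k src (i + 1) ++ [v] ∧
      ∀ s' ≠ sl, ∀ j < k, A' 8 (s' * k + j) = A 8 (s' * k + j) := by
  have hN := h.N_lt
  have hkN := h.lt_N
  have hV := h.sq_lt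
  have hcell : ∀ a < Y ^ 3, ∀ j < k, a * k + j < Y ^ 5 := fun a ha j hj =>
    h.cell_lt ha (by omega) (by omega)
  have hlast := hcell sl hsl (i + 1) hi
  refine Achieves.seq (B₁ := 40 * k + 10) (B₂ := 30)
    (Q₁ := fun A' => (∀ j < i + 1, A' 8 (sl * k + j) = A 8 (src * k + j)) ∧
      ∀ s' ≠ sl, ∀ j < k, A' 8 (s' * k + j) = A 8 (s' * k + j)) ?_ ?_ (by omega)
  · refine Achieves.loop (b := i + 1) (t := 32)
      (fun b A' => (∀ j < b, A' 8 (sl * k + j) = A 8 (src * k + j)) ∧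
        ∀ s' ≠ sl, ∀ j < k, A' 8 (s' * k + j) = A 8 (s' * k + j))
      (by simp [h10]; omega) (by simp [h10]) (by omega) (by simp) ?_ (by simp; omega)
      (fun _ h => h)
    rintro b hb A' ⟨hI1, hI2⟩ -
    have hb1 := hcell sl hsl b (by omega)
    have hb2 := hcell src hsrc b (by omega)
    refine Achieves.set ?_ ?_ ?_ (by simp) ⟨fun j hj => ?_, fun s' hs' j hj => ?_⟩
    · simp [Cmd.loopEnv, h23, h5]; omega
    · simpa [Cmd.loopEnv, h23, h5] using hb1
    · simp [Cmd.loopEnv, h20, h5]; omega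
    · simp only [Arrays.set_apply, true_and]
      simp only [Term.val_add, Term.val_mul, Term.val_var, Term.val_arr, Cmd.loopEnv]
      simp [h23, h5, h20]
      split
      · next hjb => rw [hI2 src hne b (by omega), hjb]
      · exact hI1 j (by omega)
    · rw [Arrays.set_index_ne, hI2 s' hs' j hj]
      simpa [Cmd.loopEnv, h23, h5] using mul_add_ne hs' hj (by omega)
  · rintro A₁ ⟨hI1, hI2⟩
    refine Achieves.set ?_ ?_ (by simp) (by simp) ⟨?_, fun s' hs' j hj => ?_⟩
    · simp [h23, h5, h10]; omega
    · simpa [h23, h5, h10] using hlast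
    · simp only [Term.val_add, Term.val_mul, Term.val_var, h23, h5, h10, h17, Term.val_ofNat]
      rw [pathAt_succ, Arrays.set_same]
      congr 1
      refine List.map_congr_left fun j hj => ?_
      rw [List.mem_range] at hj
      rw [Arrays.set_index_ne _ (by omega), hI1 j hj]
    · rw [Arrays.set_index_ne, hI2 s' hs' j hj]
      simpa [h23, h5, h10] using mul_add_ne hs' hj hi

/-- Tabulate the products for the walk in slot `var 23` at the points `0, …, p`. -/
def tabulateCmd : Cmd :=
  .loop 24 (.var 6 + 1) <|
    .seq (.bind 26 (.var 23) <| .bind 27 (.var 10 + 2) <| .bind 28 (.var 24) evalCmd) <|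
    .set 5 (.var 24) (.arr 0 5)

/-- All points of interpolation have entries in `{0, …, p}`, so the product over the forbidden edges
is computed once per value. Afterwards each coordinate of the vector takes a single multiplication.
One product involves at most `k * μ = p` deleted edges, fewer than `N`. -/
theorem tabulateCmd_spec (h : Context x off n m s t k μ p M N Y base) [Fact P.Prime] (hMP : M < P)
    (hPM : P ≤ 2 * M) {env : ℕ → ℕ} {A : Arrays} {i sl : ℕ} {l : List ℕ} (h5 : env 5 = k)
    (h6 : env 6 = p) (h8 : env 8 = P) (h10 : env 10 = i) (h23 : env 23 = sl) (hi : i + 1 < k)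
    (hsl : sl < Y ^ 3) (hoff : ∀ v < n, A 1 v = off v) (hl : pathAt A k sl (i + 2) = l)
    (hln : ∀ v ∈ l, v < n) :
    Achieves base (Y ^ 5) x env A tabulateCmd (500 * N ^ 2) fun A' =>
      (∀ y ≤ p, A' 5 y < P ∧
        (A' 5 y : ZMod P) = avoidProd (forbidden x off l) (y : ZMod P)) ∧ A' 0 4 = A 0 4 := by
  have hN := h.N_lt
  have hkN := h.lt_N
  have hV := h.sq_lt
  have hMe := h.M_eq
  have hM := h.M_lt
  have hpe := h.p_eq
  have hpath : ∀ j < i + 2, A 8 (sl * k + j) < n := by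
    intro j hj
    refine hln _ ?_
    rw [← hl, pathAt]
    exact List.mem_map.2 ⟨j, List.mem_range.2 hj, rfl⟩
  refine Achieves.loop (b := p + 1) (t := 100 * (2 * N + 1) + 50)
    (fun b A' => (∀ y < b, A' 5 y < P ∧
      (A' 5 y : ZMod P) = avoidProd (forbidden x off l) (y : ZMod P)) ∧ A' 0 4 = A 0 4)
    (by simp [h6]; omega) (by simp [h6]) (by omega) (by simp) ?_ ?_
    (fun _ h => ⟨fun y hy => h.1 y (by omega), h.2⟩)
  · rintro y hy A' ⟨hI1, hI2⟩ hfr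
    have hfr1 : A' 1 = A 1 := hfr 1 (by decide)
    have hfr8 : A' 8 = A 8 := hfr 8 (by decide)
    have hpath' : pathAt A' k sl (i + 2) = l := by rw [← hl, pathAt, pathAt, hfr8]
    refine Achieves.seq (B₁ := 100 * (2 * N + 1) + 12) (B₂ := 30)
      (Q₁ := fun A'' => ∃ r, A'' = A'.set 0 5 r ∧ r < P ∧
        (r : ZMod P) = avoidProd (forbidden x off l) (y : ZMod P)) ?_ ?_ (by omega)
    · refine Achieves.bind (B' := 100 * (2 * N + 1) + 8) (by simp) ?_ (by simp; omega)
      refine Achieves.bind (B' := 100 * (2 * N + 1) + 4) (by simp [Cmd.loopEnv, h10]; omega) ?_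
        (by simp; omega)
      refine Achieves.bind (B' := 100 * (2 * N + 1)) (by simp) ?_ (by simp; omega)
      have key := evalCmd_spec h hPM (A := A') (slot := sl) (len := i + 2) (y := y)
        (env := Function.update (Function.update (Function.update (Cmd.loopEnv env 24 y (p + 1))
          26 sl) 27 (i + 2)) 28 y) (by simpa [Cmd.loopEnv] using h5)
        (by simpa [Cmd.loopEnv] using h8) (by simp) (by simp) (by simp) hsl (by omega) (by omega)
        (fun v hv => by rw [hfr1, hoff v hv]) (fun j hj => by rw [hfr8]; exact hpath j hj)
      rw [hpath'] at key
      have htime : 100 * ((i + 2) * (μ + 1) + 1) ≤ 100 * (2 * N + 1) := by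
        have : (i + 2) * (μ + 1) ≤ k * (μ + 1) := Nat.mul_le_mul_right _ (by omega)
        have h2 : k * (μ + 1) = p + k := by rw [hpe]; ring
        omega
      refine Achieves.mono (B' := 100 * ((i + 2) * (μ + 1) + 1)) ?_ htime (fun A'' h _ => h)
      simpa [Cmd.loopEnv, h10, h23] using key
    · rintro _ ⟨r, rfl, hr, hrv⟩
      refine Achieves.set (by simp) ?_ (by simp; omega) (by simp) ⟨fun y' hy' => ?_, ?_⟩
      · simp [Cmd.loopEnv]; omega
      · by_cases hyy : y' = y
        · subst hyy
          simp [Cmd.loopEnv]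
          exact ⟨hr, hrv⟩
        · rw [Arrays.set_index_ne _ (by simpa [Cmd.loopEnv] using hyy), Arrays.set_array_ne _
            (by decide)]
          exact hI1 y' (by omega)
      · rw [Arrays.set_array_ne _ (by decide), Arrays.set_index_ne _ (by decide)]
        exact hI2
  · simp
    nlinarith

/-- Compute the vector of the walk in slot `var 23` from the table. -/
def vectorCmd : Cmd :=
  .seq (.set 9 (.var 23 * .var 9) 1) <|
  .loop 24 (.var 9 - 1) <|
    .set 9 (.var 23 * .var 9 + (.var 24 + 1))
      (.arr 9 (.var 23 * .var 9 + .arr 3 (.var 24 + 1)) * .arr 5 (.arr 4 (.var 24 + 1)) % .var 8)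

theorem headD_le_of_mem_pointListsUpTo {p q : ℕ} {ys : List ℕ} (h : ys ∈ pointListsUpTo p q) :
    ys.headD 0 ≤ p := by
  induction q with
  | zero =>
    simp only [pointListsUpTo, List.mem_singleton] at h
    simp [h]
  | succ q ih =>
    rw [pointListsUpTo, List.mem_append] at h
    rcases h with h | h
    · exact ih h
    · exact headD_le_of_mem_pointLists h

/-- The family of interpolation points. -/
def points (p k : ℕ) : ℕ → List ℕ := fun c => (pointListsUpTo p k).getD c []

/-- The value at `y :: ys` is the tabulated product at `y` times the value at `ys`. The tail is the
parent in the tree and has a smaller index, so its coordinate is already known. -/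
theorem vectorCmd_spec (h : Context x off n m s t k μ p M N Y base) [Fact P.Prime]
    (hPM : P ≤ 2 * M) {env : ℕ → ℕ} {A : Arrays} {sl : ℕ} {l : List ℕ}
    (h8 : env 8 = P) (h9 : env 9 = N) (h23 : env 23 = sl)
    (hsl : sl < Y ^ 3) (hT : StoresTree A (pointListsUpTo p k))
    (htab : ∀ y ≤ p, A 5 y < P ∧ (A 5 y : ZMod P) = avoidProd l (y : ZMod P)) :
    Achieves base (Y ^ 5) x env A vectorCmd (100 * N) fun A' =>
      (∀ c < N, A' 9 (sl * N + c) < P ∧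
        (A' 9 (sl * N + c) : ZMod P) = avoidVal l ((points p k c).map Nat.cast)) ∧
      ∀ s' ≠ sl, ∀ c < N, A' 9 (s' * N + c) = A 9 (s' * N + c) := by
  have hN := h.N_lt
  have hkN := h.lt_N
  have hV := h.sq_lt
  have hMe := h.M_eq
  have hM := h.M_lt
  have hP1 : 1 < P := (Fact.out : P.Prime).one_lt
  have hlen : (pointListsUpTo p k).length = N := h.N_eq.symm
  have hcell : ∀ c < N, sl * N + c < Y ^ 5 := fun c hc =>
    h.cell_lt hsl (by omega) (by omega)
  have hcell0 := hcell 0 (by omega)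
  have hval : ∀ c < N, A 4 c ≤ p := by
    intro c hc
    rw [hT.first c (by omega)]
    rw [List.getD_eq_getElem _ _ (by omega)]
    exact headD_le_of_mem_pointListsUpTo (List.getElem_mem _)
  refine Achieves.seq (B₁ := 20) (B₂ := 80 * N)
    (Q₁ := fun A' => A' = A.set 9 (sl * N) 1) ?_ ?_ (by omega)
  · refine Achieves.set ?_ ?_ (by simp; omega) (by simp) (by simp [h23, h9])
    · simp [h23, h9]; omega
    · simp [h23, h9]; omega
  rintro _ rfl
  -- Coordinate `0` belongs to the empty list and is already `1`, so the invariant is ahead of the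
  -- counter by one.
  refine Achieves.loop (b := N - 1) (t := 60)
    (fun b A' => (∀ c < b + 1, A' 9 (sl * N + c) < P ∧
        (A' 9 (sl * N + c) : ZMod P) = avoidVal l ((points p k c).map Nat.cast)) ∧
      ∀ s' ≠ sl, ∀ c < N, A' 9 (s' * N + c) = A 9 (s' * N + c))
    (by simp [h9]; omega) (by simp [h9]) (by omega) ?_ ?_ (by simp; omega) ?_
  · refine ⟨fun c hc => ?_, fun s' hs' c hc => ?_⟩
    · obtain rfl : c = 0 := by omega
      simp only [add_zero, Arrays.set_same]
      refine ⟨hP1, ?_⟩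
      rw [points, hT.root]
      simp [avoidVal]
    · rw [Arrays.set_index_ne]
      simpa using mul_add_ne hs' hc (show 0 < N by omega)
  · rintro b hb A' ⟨hI1, hI2⟩ hfr
    have hfr3 : A' 3 = A 3 := by
      rw [hfr 3 (by decide), Arrays.set_array_ne _ (by decide)]
    have hfr4 : A' 4 = A 4 := by
      rw [hfr 4 (by decide), Arrays.set_array_ne _ (by decide)]
    have hfr5 : A' 5 = A 5 := by
      rw [hfr 5 (by decide), Arrays.set_array_ne _ (by decide)]
    have hpar := hT.parent_lt (b + 1) (by omega) (by omega)
    have hcons := hT.eq_cons (b + 1) (by omega) (by omega)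
    have hv := hval (b + 1) (by omega)
    obtain ⟨ht1, ht2⟩ := htab _ hv
    obtain ⟨hr1, hr2⟩ := hI1 _ hpar
    have hc1 := hcell (b + 1) (by omega)
    have hc2 := hcell (A 3 (b + 1)) (by omega)
    have hmul := h.mul_le (show A' 9 (sl * N + A 3 (b + 1)) ≤ Y by omega)
      (show A 5 (A 4 (b + 1)) ≤ Y by omega)
    have hmod := Nat.mod_lt (A' 9 (sl * N + A 3 (b + 1)) * A 5 (A 4 (b + 1)))
      (show 0 < P by omega)
    refine Achieves.set ?_ ?_ ?_ (by simp) ⟨fun c hc => ?_, fun s' hs' c hc => ?_⟩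
    · simp [Cmd.loopEnv, h23, h9]; omega
    · simpa [Cmd.loopEnv, h23, h9] using hc1
    · simp [Cmd.loopEnv, h23, h9, hfr3, hfr4, hfr5, h8]; omega
    · by_cases hcb : c = b + 1
      · subst hcb
        simp [Cmd.loopEnv, h23, h9, hfr3, hfr4, hfr5, h8]
        refine ⟨hmod, ?_⟩
        rw [hr2, ht2]
        have : points p k (b + 1) = A 4 (b + 1) :: points p k (A 3 (b + 1)) := hcons
        rw [this]
        simp [avoidVal, mul_comm]
      · rw [Arrays.set_index_ne]
        · exact hI1 c (by omega)
        · simp [Cmd.loopEnv, h23, h9]; omega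
    · rw [Arrays.set_index_ne, hI2 s' hs' c hc]
      simpa [Cmd.loopEnv, h23, h9] using mul_add_ne hs' hc (show b + 1 < N by omega)
  · rintro A' ⟨hI1, hI2⟩
    exact ⟨fun c hc => hI1 c (by omega), hI2⟩

/-- The row stored in a slot. -/
def rowAt (A : Arrays) (P N a : ℕ) : Fin N → ZMod P := fun c => (A 9 (a * N + c) : ZMod P)

/-- Eliminate the pivots of the bucket `var 21`, which has `var 22` rows, from the row in slot
`var 23`. -/
def reduceCmd : Cmd :=
  .loop 24 (.var 22) <|
    .bind 26 (.var 21 * (.var 9 + 1) + .var 24) <|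
    .bind 27 (.arr 10 (.var 26)) <|
    .bind 28 (.arr 9 (.var 23 * .var 9 + .var 27)) <|
    .bind 29 (.arr 9 (.var 26 * .var 9 + .var 27)) <|
    .loop 30 (.var 9) <|
      .set 9 (.var 23 * .var 9 + .var 30)
        ((.var 29 * .arr 9 (.var 23 * .var 9 + .var 30) +
          (.var 8 - .var 28) * .arr 9 (.var 26 * .var 9 + .var 30)) % .var 8)

/-- Each round is one step of `Reduced.step`, with `P - a` in the role of `-a`. The two pivot
entries `a` and `d` are read before the inner loop, which overwrites the current entry at the pivot
position. -/
theorem reduceCmd_spec (h : Context x off n m s t k μ p M N Y base) [Fact P.Prime]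
    (hPM : P ≤ 2 * M) {env : ℕ → ℕ} {A : Arrays} {cv cn sl : ℕ} {vec : ℕ → Fin N → ZMod P}
    (h8 : env 8 = P) (h9 : env 9 = N) (h21 : env 21 = cv) (h22 : env 22 = cn) (h23 : env 23 = sl)
    (hsl : sl = cv * (N + 1) + cn) (hslY : sl < Y ^ 3)
    (hE : Echelon (fun b => rowAt A P N (cv * (N + 1) + b)) vec
      (fun b => A 10 (cv * (N + 1) + b)) cn)
    (hrow : ∀ b < cn, ∀ c < N, A 9 ((cv * (N + 1) + b) * N + c) < P)
    (hcur : ∀ c < N, A 9 (sl * N + c) < P) :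
    Achieves base (Y ^ 5) x env A reduceCmd (200 * N ^ 2) fun A' =>
      Reduced (fun b => rowAt A P N (cv * (N + 1) + b)) vec
        (fun b => A 10 (cv * (N + 1) + b)) cn cn (rowAt A P N sl) (rowAt A' P N sl) ∧
      (∀ c < N, A' 9 (sl * N + c) < P) ∧
      ∀ s' ≠ sl, ∀ c < N, A' 9 (s' * N + c) = A 9 (s' * N + c) := by
  have hN := h.N_lt
  have hkN := h.lt_N
  have hV := h.sq_lt
  have hMe := h.M_eq
  have hM := h.M_lt
  have hcube := h.cube_le
  have hP0 : 0 < P := (Fact.out : P.Prime).pos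
  have hcnN : cn ≤ N := hE.le
  have hcell : ∀ a < Y ^ 3, ∀ c < N, a * N + c < Y ^ 5 := fun a ha c hc =>
    h.cell_lt ha (by omega) (by omega)
  refine Achieves.loop (b := cn) (t := 70 * N + 80)
    (fun b A' => Reduced (fun b => rowAt A P N (cv * (N + 1) + b)) vec
        (fun b => A 10 (cv * (N + 1) + b)) cn b (rowAt A P N sl) (rowAt A' P N sl) ∧
      (∀ c < N, A' 9 (sl * N + c) < P) ∧
      ∀ s' ≠ sl, ∀ c < N, A' 9 (s' * N + c) = A 9 (s' * N + c))
    (by simp) (by simp [h22]) (by omega) ⟨Reduced.init _ _ _ _ _, hcur, fun _ _ _ _ => rfl⟩ ?_ ?_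
    (fun _ h => h)
  · rintro b hb A' ⟨hI1, hI2, hI3⟩ hfr
    have hfr10 : A' 10 = A 10 := hfr 10 (by decide)
    obtain ⟨rs, hrs⟩ : ∃ rs, cv * (N + 1) + b = rs := ⟨_, rfl⟩
    have hrsY : rs < Y ^ 3 := by omega
    have hrsne : rs ≠ sl := by omega
    obtain ⟨pc, hpc⟩ : ∃ pc, A 10 rs = pc := ⟨_, rfl⟩
    have hpcN : pc < N := by
      have := hE.piv_lt b hb
      rwa [hrs, hpc] at this
    have hcs := hcell sl hslY pc hpcN
    have hcr := hcell rs hrsY pc hpcN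
    have ha := hI2 pc hpcN
    obtain ⟨a, hav⟩ : ∃ a, A' 9 (sl * N + pc) = a := ⟨_, rfl⟩
    obtain ⟨d, hdv⟩ : ∃ d, A 9 (rs * N + pc) = d := ⟨_, rfl⟩
    have hd := hrow b hb pc hpcN
    rw [hrs, hdv] at hd
    rw [hav] at ha
    have hdv' : A' 9 (rs * N + pc) = d := by rw [hI3 rs hrsne pc hpcN, hdv]
    refine Achieves.bind (B' := 70 * N + 70) ?_ ?_ (by simp; omega)
    · simp [Cmd.loopEnv, h21, h9]
      have : cv * (N + 1) + b < Y ^ 5 := by omega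
      omega
    refine Achieves.bind (B' := 70 * N + 60) ?_ ?_ (by simp; omega)
    · simp [Cmd.loopEnv, h21, h9, hrs]; omega
    refine Achieves.bind (B' := 70 * N + 40) ?_ ?_ (by simp; omega)
    · simp [Cmd.loopEnv, h21, h9, h23, hrs, hfr10, hpc]; omega
    refine Achieves.bind (B' := 70 * N + 20) ?_ ?_ (by simp; omega)
    · simp [Cmd.loopEnv, h21, h9, h23, hrs, hfr10, hpc]; omega
    refine Achieves.loop (b := N) (t := 62)
      (fun j A'' => (∀ c < j, A'' 9 (sl * N + c) =
          (d * A' 9 (sl * N + c) + (P - a) * A 9 (rs * N + c)) % P) ∧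
        (∀ c < N, j ≤ c → A'' 9 (sl * N + c) = A' 9 (sl * N + c)) ∧
        ∀ s' ≠ sl, ∀ c < N, A'' 9 (s' * N + c) = A 9 (s' * N + c))
      (by simp) (by simp [Cmd.loopEnv, h9]) (by omega) ⟨by simp, fun _ _ _ => rfl, hI3⟩ ?_
      (by simp; omega) ?_
    · rintro j hj A'' ⟨hJ1, hJ2, hJ3⟩ -
      have hcs' := hcell sl hslY j hj
      have hcr' := hcell rs hrsY j hj
      have hr := hrow b hb j hj
      rw [hrs] at hr
      have hc := hI2 j hj
      have hm1 := h.mul_le (show d ≤ Y by omega) (show A' 9 (sl * N + j) ≤ Y by omega)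
      have hm2 := h.mul_le (show P - a ≤ Y by omega) (show A 9 (rs * N + j) ≤ Y by omega)
      have hmod := Nat.mod_lt (d * A' 9 (sl * N + j) + (P - a) * A 9 (rs * N + j)) hP0
      have e1 := hJ2 j hj le_rfl
      have e2 := hJ3 rs hrsne j hj
      refine Achieves.set ?_ ?_ ?_ (by simp) ⟨fun c hc => ?_, fun c hc hjc => ?_,
        fun s' hs' c hc => ?_⟩
      · simp [Cmd.loopEnv, h23, h9]; omega
      · simpa [Cmd.loopEnv, h23, h9] using hcs'
      · simp [Cmd.loopEnv, h21, h9, h23, hrs, hfr10, hpc, h8, hav, hdv', e1, e2]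
        omega
      · by_cases hcj : c = j
        · subst hcj
          simp [Cmd.loopEnv, h21, h9, h23, hrs, hfr10, hpc, h8, hav, hdv', e1, e2]
        · rw [Arrays.set_index_ne]
          · exact hJ1 c (by omega)
          · simp [Cmd.loopEnv, h23, h9]; omega
      · rw [Arrays.set_index_ne]
        · exact hJ2 c hc (by omega)
        · simp [Cmd.loopEnv, h23, h9]; omega
      · rw [Arrays.set_index_ne, hJ3 s' hs' c hc]
        simpa [Cmd.loopEnv, h23, h9] using mul_add_ne hs' hc hj
    · rintro A'' ⟨hJ1, hJ2, hJ3⟩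
      refine ⟨?_, fun c hc => ?_, hJ3⟩
      · refine Reduced.step hE hb hI1 fun c => ?_
        simp only [rowAt]
        simp only [hrs, hpc, hdv, hav]
        rw [hJ1 c c.2, ZMod.natCast_mod, Nat.cast_add, Nat.cast_mul, Nat.cast_mul,
          Nat.cast_sub ha.le, ZMod.natCast_self]
        ring
      · rw [hJ1 c hc]; exact Nat.mod_lt _ hP0
  · simp
    nlinarith

/-- Look for a nonzero entry in the row in slot `var 23`; if there is one, then record its position
and add the slot to the bucket `var 21`. -/
def pivotCmd : Cmd :=
  .seq (.set 0 6 (.var 9)) <|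
  .seq (.loop 24 (.var 9) <|
    .ite (.arr 9 (.var 23 * .var 9 + .var 24)) (.set 0 6 (.var 24)) .skip) <|
  .ite (.op .lt (.arr 0 6) (.var 9))
    (.seq (.set 10 (.var 23) (.arr 0 6)) (.set 7 (.var 21) (.var 22 + 1))) .skip

/-- The value `N`, which is not a position, signals that no nonzero entry was found. Any nonzero
position may serve as a pivot; the loop ends with the last one. -/
theorem pivotCmd_spec (h : Context x off n m s t k μ p M N Y base) {env : ℕ → ℕ} {A : Arrays}
    {cv cn sl : ℕ} (h9 : env 9 = N) (h21 : env 21 = cv) (h22 : env 22 = cn) (h23 : env 23 = sl)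
    (hcn : cn ≤ N) (hcv : cv < Y ^ 3) (hsl : sl < Y ^ 3) :
    Achieves base (Y ^ 5) x env A pivotCmd (200 * N) fun A' =>
      A' 0 4 = A 0 4 ∧
      ((∀ c < N, A 9 (sl * N + c) = 0) ∧ A' 7 = A 7 ∧ A' 10 = A 10 ∨
        ∃ c < N, A 9 (sl * N + c) ≠ 0 ∧ A' 10 sl = c ∧ (∀ s' ≠ sl, A' 10 s' = A 10 s') ∧
          A' 7 cv = cn + 1 ∧ ∀ i ≠ cv, A' 7 i = A 7 i) := by
  have hN := h.N_lt
  have hkN := h.lt_N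
  have hV := h.sq_lt
  have hcube := h.cube_le
  refine Achieves.seq (B₁ := 20) (B₂ := 150 * N) (Q₁ := fun A' => A' = A.set 0 6 N) ?_ ?_ (by omega)
  · exact Achieves.set (by simp; omega) (by simp; omega) (by simp) (by simp) (by simp [h9])
  rintro _ rfl
  refine Achieves.seq (B₁ := 60 * N + 10) (B₂ := 60)
    (Q₁ := fun A' => ∃ r, A' = A.set 0 6 r ∧ ((∀ c < N, A 9 (sl * N + c) = 0) ∧ r = N ∨
      r < N ∧ A 9 (sl * N + r) ≠ 0)) ?_ ?_ (by omega)
  · refine Achieves.loop (b := N) (t := 40)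
      (fun b A' => ∃ r, A' = A.set 0 6 r ∧ ((∀ c < b, A 9 (sl * N + c) = 0) ∧ r = N ∨
        r < N ∧ A 9 (sl * N + r) ≠ 0))
      (by simp) (by simp [h9]) (by omega) ⟨N, rfl, by simp⟩ ?_ (by simp; omega) (fun _ h => h)
    rintro b hb _ ⟨r, rfl, hr⟩ -
    have hc := h.cell_lt hsl (show N ≤ Y by omega) (show b < Y by omega)
    refine Achieves.ite (B' := 20) ?_ ?_ ?_ (by simp)
    · simp [Cmd.loopEnv, h23, h9]; omega
    · intro hne
      simp [Cmd.loopEnv, h23, h9, Arrays.set_array_ne] at hne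
      refine Achieves.set (by simp; omega) (by simp; omega) (by simp) (by simp)
        ⟨b, by simp [Cmd.loopEnv, Arrays.set_set], Or.inr ⟨hb, hne⟩⟩
    · intro heq
      simp [Cmd.loopEnv, h23, h9, Arrays.set_array_ne] at heq
      refine Achieves.skip (by omega) ⟨r, rfl, ?_⟩
      rcases hr with ⟨hz, hrN⟩ | hr
      · refine Or.inl ⟨fun c hc => ?_, hrN⟩
        rcases Nat.lt_succ_iff_lt_or_eq.1 hc with hc | rfl
        · exact hz c hc
        · exact heq
      · exact Or.inr hr
  · rintro _ ⟨r, rfl, hr⟩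
    refine Achieves.ite (B' := 40) ?_ ?_ ?_ (by simp)
    · simp [h9]; split <;> omega
    · intro hlt
      simp [h9] at hlt
      refine Achieves.seq (B₁ := 20) (B₂ := 20)
        (Q₁ := fun A' => A' = (A.set 0 6 r).set 10 sl r) ?_ ?_ le_rfl
      · exact Achieves.set (by simp) (by simp [h23]; omega) (by simp; omega) (by simp)
          (by simp [h23])
      rintro _ rfl
      refine Achieves.set (by simp) (by simp [h21]; omega) (by simp [h22]; omega) (by simp)
        ⟨by simp [Arrays.set_apply], Or.inr ⟨r, hlt, ?_, ?_, ?_, ?_, ?_⟩⟩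
      · rcases hr with ⟨_, hr⟩ | hr
        · omega
        · exact hr.2
      · simp [Arrays.set_apply]
      · intro s' hs'
        simp [Arrays.set_apply, hs']
      · simp [h21, h22]
      · intro i hi
        simp [Arrays.set_apply, h21, hi]
    · intro hge
      simp [h9] at hge
      refine Achieves.skip (by omega) ⟨by simp [Arrays.set_apply], Or.inl ⟨?_, ?_, ?_⟩⟩
      · rcases hr with hr | hr
        · exact hr.1
        · omega
      · simp [Arrays.set_array_ne]
      · simp [Arrays.set_array_ne]

end RepresentativeWalks

/-! ### Inserting a walk into a bucket -/

namespace RepresentativeWalks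

open WordRAM

theorem Echelon.congr {F : Type*} [Field F] {N : ℕ} {row vec row' vec' : ℕ → Fin N → F}
    {piv piv' : ℕ → ℕ} {cnt : ℕ} (hE : Echelon row vec piv cnt)
    (hrow : ∀ b < cnt, row' b = row b) (hvec : ∀ b < cnt, vec' b = vec b)
    (hpiv : ∀ b < cnt, piv' b = piv b) : Echelon row' vec' piv' cnt := by
  have himg : vec' '' Set.Iio cnt = vec '' Set.Iio cnt := Set.image_congr fun b hb => hvec b hb
  refine ⟨fun b hb => ?_, fun b hb _ => ?_, fun b b' hbb' hb' _ => ?_, fun b hb => ?_⟩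
  · rw [hpiv b hb]; exact hE.piv_lt b hb
  · simpa only [hpiv b hb, hrow b hb] using hE.row_piv b hb (hE.piv_lt b hb)
  · simpa only [hpiv b (hbb'.trans hb'), hrow b' hb'] using
      hE.row_zero b b' hbb' hb' (hE.piv_lt b (hbb'.trans hb'))
  · rw [hrow b hb, himg]; exact hE.row_mem b hb

variable {x off : ℕ → ℕ} {n m s t k μ p M N Y base P : ℕ}

/-- The vector of a walk, given by its list of vertices. -/
def walkVec (x off : ℕ → ℕ) (p k N P : ℕ) [Fact P.Prime] (l : List ℕ) : Fin N → ZMod P :=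
  avoidVec N (points p k) (forbidden x off l)

/-- The span of the vectors of the walks on `len` vertices in the bucket `cv`. -/
def bucketSpan (x off : ℕ → ℕ) (p k N P : ℕ) [Fact P.Prime] (A : Arrays) (cv len : ℕ) :
    Submodule (ZMod P) (Fin N → ZMod P) :=
  Submodule.span (ZMod P)
    ((fun b => walkVec x off p k N P (pathAt A k (cv * (N + 1) + b) len)) '' Set.Iio (A 7 cv))

/-- The bucket `cv` holds rows in echelon form that belong to walks on `len` vertices. -/
structure Bucket (x off : ℕ → ℕ) (p k N P : ℕ) [Fact P.Prime] (A : Arrays) (cv len : ℕ) :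
    Prop where
  echelon : Echelon (fun b => rowAt A P N (cv * (N + 1) + b))
    (fun b => walkVec x off p k N P (pathAt A k (cv * (N + 1) + b) len))
    (fun b => A 10 (cv * (N + 1) + b)) (A 7 cv)
  row_lt : ∀ b < A 7 cv, ∀ c < N, A 9 ((cv * (N + 1) + b) * N + c) < P

/-- The contents of the slot `a` are the same in `A` and `A'`. -/
structure SameSlot (k N : ℕ) (A A' : Arrays) (a : ℕ) : Prop where
  path : ∀ j < k, A' 8 (a * k + j) = A 8 (a * k + j)
  row : ∀ c < N, A' 9 (a * N + c) = A 9 (a * N + c)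
  piv : A' 10 a = A 10 a

theorem SameSlot.pathAt_eq {A A' : Arrays} {a len : ℕ} (h : SameSlot k N A A' a) (hlen : len ≤ k) :
    pathAt A' k a len = pathAt A k a len :=
  List.map_congr_left fun j hj => h.path j (by rw [List.mem_range] at hj; omega)

theorem SameSlot.rowAt_eq {A A' : Arrays} {a : ℕ} (h : SameSlot k N A A' a) :
    rowAt A' P N a = rowAt A P N a :=
  funext fun c => by rw [rowAt, rowAt, h.row c c.2]

theorem bucketSpan_congr [Fact P.Prime] {A A' : Arrays} {cv len : ℕ} (hlen : len ≤ k)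
    (hcnt : A' 7 cv = A 7 cv) (h : ∀ b < A 7 cv, SameSlot k N A A' (cv * (N + 1) + b)) :
    bucketSpan x off p k N P A' cv len = bucketSpan x off p k N P A cv len := by
  rw [bucketSpan, bucketSpan, hcnt]
  congr 1
  exact Set.image_congr fun b hb => by rw [(h b hb).pathAt_eq hlen]

theorem Bucket.congr [Fact P.Prime] {A A' : Arrays} {cv len : ℕ}
    (hB : Bucket x off p k N P A cv len) (hlen : len ≤ k) (hcnt : A' 7 cv = A 7 cv)
    (h : ∀ b < A 7 cv, SameSlot k N A A' (cv * (N + 1) + b)) :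
    Bucket x off p k N P A' cv len := by
  refine ⟨?_, fun b hb c hc => ?_⟩
  · rw [hcnt]
    exact hB.echelon.congr (fun b hb => (h b hb).rowAt_eq)
      (fun b hb => by rw [(h b hb).pathAt_eq hlen]) (fun b hb => (h b hb).piv)
  · rw [hcnt] at hb
    rw [(h b hb).row c hc]; exact hB.row_lt b hb c hc

/-- Extend the walk in slot `var 20` by the vertex `var 17` and add it to the bucket `var 21`, if
its vector does not depend on the vectors that are already there. -/
def insertCmd : Cmd :=
  .seq copyCmd <| .seq tabulateCmd <| .seq vectorCmd <| .seq reduceCmd pivotCmd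

theorem StoresTree.congr {A A' : Arrays} {L : List (List ℕ)} (h : StoresTree A L)
    (h0 : A' 0 4 = A 0 4) (h3 : A' 3 = A 3) (h4 : A' 4 = A 4) : StoresTree A' L :=
  ⟨by rw [h0, h.count], by rw [h4]; exact h.first, h.root, by rw [h3]; exact h.parent_lt,
    by rw [h3, h4]; exact h.eq_cons⟩

/-- The candidate is built in the first free slot `sl` of its bucket and becomes a member only when
the counter is raised; a rejected one leaves unreferenced data there. In both cases its vector ends
up in the span of the bucket: either elimination reduces it to zero, or it is now one of the
generators. -/
theorem insertCmd_spec (h : Context x off n m s t k μ p M N Y base) [Fact P.Prime] (hMP : M < P)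
    (hPM : P ≤ 2 * M) {env : ℕ → ℕ} {A : Arrays} {i v src cv cn sl : ℕ} {l : List ℕ}
    (h5 : env 5 = k) (h6 : env 6 = p) (h8 : env 8 = P) (h9 : env 9 = N) (h10 : env 10 = i)
    (h17 : env 17 = v) (h20 : env 20 = src) (h21 : env 21 = cv) (h22 : env 22 = cn)
    (h23 : env 23 = sl) (hcn : A 7 cv = cn) (hsl : cv * (N + 1) + cn = sl) (hslY : sl < Y ^ 3)
    (hcvY : cv < Y ^ 3) (hsrcY : src < Y ^ 3) (hne : src ≠ sl) (hi : i + 1 < k)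
    (hl : pathAt A k src (i + 1) = l) (hln : ∀ u ∈ l, u < n) (hv : v < n)
    (hoff : ∀ v < n, A 1 v = off v) (hT : StoresTree A (pointListsUpTo p k))
    (hB : Bucket x off p k N P A cv (i + 2)) :
    Achieves base (Y ^ 5) x env A insertCmd (1100 * N ^ 2) fun A' =>
      A' 1 = A 1 ∧ StoresTree A' (pointListsUpTo p k) ∧ (∀ a ≠ sl, SameSlot k N A A' a) ∧
      (∀ j ≠ cv, A' 7 j = A 7 j) ∧
      (A' 7 cv = cn ∨ A' 7 cv = cn + 1 ∧ pathAt A' k sl (i + 2) = l ++ [v]) ∧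
      Bucket x off p k N P A' cv (i + 2) ∧
      walkVec x off p k N P (l ++ [v]) ∈ bucketSpan x off p k N P A' cv (i + 2) := by
  have hN1 : N ≤ N ^ 2 := Nat.le_self_pow (by norm_num) N
  have hcnN : cn ≤ N := by rw [← hcn]; exact hB.echelon.le
  have hl'n : ∀ u ∈ l ++ [v], u < n := by
    intro u hu
    rw [List.mem_append, List.mem_singleton] at hu
    rcases hu with hu | rfl
    · exact hln u hu
    · exact hv
  have hslb : ∀ b < cn, cv * (N + 1) + b ≠ sl := fun b hb => by omega
  refine Achieves.seq (B₁ := 100 * N) (B₂ := 1000 * N ^ 2)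
    (Q₁ := fun A₁ => (pathAt A₁ k sl (i + 2) = l ++ [v] ∧
      ∀ s' ≠ sl, ∀ j < k, A₁ 8 (s' * k + j) = A 8 (s' * k + j)) ∧
      ∀ a ∉ copyCmd.writes, A₁ a = A a) ?_ ?_ (by omega)
  · refine (copyCmd_spec h (A := A) h5 h10 h17 h20 h23 hi hsrcY hslY hne).mono le_rfl
      fun A' hA' hfr => ⟨?_, hfr⟩
    rwa [hl] at hA'
  rintro A₁ ⟨⟨hp₁, hs₁⟩, hf₁⟩
  refine Achieves.seq (B₁ := 500 * N ^ 2) (B₂ := 500 * N ^ 2)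
    (Q₁ := fun A₂ => ((∀ y ≤ p, A₂ 5 y < P ∧
        (A₂ 5 y : ZMod P) = avoidProd (forbidden x off (l ++ [v])) (y : ZMod P)) ∧
        A₂ 0 4 = A₁ 0 4) ∧
      ∀ a ∉ tabulateCmd.writes, A₂ a = A₁ a) ?_ ?_ (by omega)
  · exact (tabulateCmd_spec h hMP hPM (A := A₁) h5 h6 h8 h10 h23 hi hslY
      (by rw [hf₁ 1 (by decide)]; exact hoff) hp₁ hl'n).mono le_rfl fun A' hA' hfr => ⟨hA', hfr⟩
  rintro A₂ ⟨⟨ht₂, hc₂⟩, hf₂⟩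
  have hT₂ : StoresTree A₂ (pointListsUpTo p k) := hT.congr
    (by rw [hc₂, hf₁ 0 (by decide)])
    (by rw [hf₂ 3 (by decide), hf₁ 3 (by decide)])
    (by rw [hf₂ 4 (by decide), hf₁ 4 (by decide)])
  refine Achieves.seq (B₁ := 100 * N) (B₂ := 400 * N ^ 2)
    (Q₁ := fun A₃ => ((∀ c < N, A₃ 9 (sl * N + c) < P ∧
        (A₃ 9 (sl * N + c) : ZMod P) =
          avoidVal (forbidden x off (l ++ [v])) ((points p k c).map Nat.cast)) ∧
        ∀ s' ≠ sl, ∀ c < N, A₃ 9 (s' * N + c) = A₂ 9 (s' * N + c)) ∧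
      ∀ a ∉ vectorCmd.writes, A₃ a = A₂ a) ?_ ?_ (by omega)
  · exact (vectorCmd_spec h hPM (A := A₂) h8 h9 h23 hslY hT₂ ht₂).mono le_rfl
      fun A' hA' hfr => ⟨hA', hfr⟩
  rintro A₃ ⟨⟨hv₃, hs₃⟩, hf₃⟩
  have h₃7 : A₃ 7 = A 7 := by
    rw [hf₃ 7 (by decide), hf₂ 7 (by decide), hf₁ 7 (by decide)]
  have h₃10 : A₃ 10 = A 10 := by
    rw [hf₃ 10 (by decide), hf₂ 10 (by decide), hf₁ 10 (by decide)]
  have h₃8 : A₃ 8 = A₁ 8 := by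
    rw [hf₃ 8 (by decide), hf₂ 8 (by decide)]
  have hsame₃ : ∀ a ≠ sl, SameSlot k N A A₃ a := by
    intro a ha
    refine ⟨fun j hj => ?_, fun c hc => ?_, by rw [h₃10]⟩
    · rw [h₃8, hs₁ a ha j hj]
    · rw [hs₃ a ha c hc, hf₂ 9 (by decide), hf₁ 9 (by decide)]
  have hB₃ : Bucket x off p k N P A₃ cv (i + 2) :=
    hB.congr (by omega) (by rw [h₃7]) fun b hb => hsame₃ _ (hslb b (by omega))
  have hrow₃ : rowAt A₃ P N sl = walkVec x off p k N P (l ++ [v]) :=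
    funext fun c => (hv₃ c c.2).2
  have hp₃ : pathAt A₃ k sl (i + 2) = l ++ [v] := by
    rw [← hp₁, pathAt, pathAt, h₃8]
  have hE₃ := hB₃.echelon
  have hcn₃ : A₃ 7 cv = cn := by rw [h₃7, hcn]
  rw [hcn₃] at hE₃
  refine Achieves.seq (B₁ := 200 * N ^ 2) (B₂ := 200 * N)
    (Q₁ := fun A₄ => (Reduced (fun b => rowAt A₃ P N (cv * (N + 1) + b))
        (fun b => walkVec x off p k N P (pathAt A₃ k (cv * (N + 1) + b) (i + 2)))
        (fun b => A₃ 10 (cv * (N + 1) + b)) cn cn (rowAt A₃ P N sl) (rowAt A₄ P N sl) ∧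
      (∀ c < N, A₄ 9 (sl * N + c) < P) ∧
      ∀ s' ≠ sl, ∀ c < N, A₄ 9 (s' * N + c) = A₃ 9 (s' * N + c)) ∧
      ∀ a ∉ reduceCmd.writes, A₄ a = A₃ a) ?_ ?_ (by omega)
  · exact (reduceCmd_spec h hPM (A := A₃) h8 h9 h21 h22 h23 hsl.symm hslY hE₃
      (fun b hb => hB₃.row_lt b (by omega)) (fun c hc => (hv₃ c hc).1)).mono le_rfl
      fun A' hA' hfr => ⟨hA', hfr⟩
  rintro A₄ ⟨⟨hr₄, hlt₄, hs₄⟩, hf₄⟩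
  rw [hrow₃] at hr₄
  refine (pivotCmd_spec h (A := A₄) h9 h21 h22 h23 hcnN hcvY hslY).mono le_rfl ?_
  rintro A₅ ⟨hc₅, hcase⟩ hf₅
  have h₅1 : A₅ 1 = A 1 := by
    rw [hf₅ 1 (by decide), hf₄ 1 (by decide), hf₃ 1 (by decide), hf₂ 1 (by decide),
      hf₁ 1 (by decide)]
  have h₅T : StoresTree A₅ (pointListsUpTo p k) := hT₂.congr
    (by rw [hc₅, hf₄ 0 (by decide), hf₃ 0 (by decide)])
    (by rw [hf₅ 3 (by decide), hf₄ 3 (by decide), hf₃ 3 (by decide)])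
    (by rw [hf₅ 4 (by decide), hf₄ 4 (by decide), hf₃ 4 (by decide)])
  have h₅8 : A₅ 8 = A₃ 8 := by rw [hf₅ 8 (by decide), hf₄ 8 (by decide)]
  have h₅9 : A₅ 9 = A₄ 9 := hf₅ 9 (by decide)
  have h₄7 : A₄ 7 = A 7 := by rw [hf₄ 7 (by decide), h₃7]
  have h₄10 : A₄ 10 = A₃ 10 := hf₄ 10 (by decide)
  have hpiv : ∀ a ≠ sl, A₅ 10 a = A₃ 10 a := by
    intro a ha
    rcases hcase with ⟨_, _, h'⟩ | ⟨_, _, _, _, h', _⟩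
    · rw [h', h₄10]
    · rw [h' a ha, h₄10]
  have hsame₃₅ : ∀ a ≠ sl, SameSlot k N A₃ A₅ a := by
    intro a ha
    refine ⟨fun j _ => by rw [h₅8], fun c hc => ?_, hpiv a ha⟩
    rw [h₅9, hs₄ a ha c hc]
  have hsame : ∀ a ≠ sl, SameSlot k N A A₅ a := by
    intro a ha
    have e1 := hsame₃ a ha
    have e2 := hsame₃₅ a ha
    exact ⟨fun j hj => (e2.path j hj).trans (e1.path j hj),
      fun c hc => (e2.row c hc).trans (e1.row c hc), e2.piv.trans e1.piv⟩
  have hp₅ : pathAt A₅ k sl (i + 2) = l ++ [v] := by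
    rw [← hp₃, pathAt, pathAt, h₅8]
  -- Either the candidate was reduced to zero and the counter is unchanged, or a pivot was found and
  -- the echelon form grows by one row.
  rcases hcase with ⟨hz, h7, _⟩ | ⟨c, hcN, hcne, hpc, _, h7, h7'⟩
  · have h7A : A₅ 7 = A₃ 7 := by rw [h7, h₄7, h₃7]
    refine ⟨h₅1, h₅T, hsame, fun j _ => by rw [h7, h₄7], Or.inl (by rw [h7, h₄7, hcn]),
      hB₃.congr (by omega) (by rw [h7A]) fun b hb => hsame₃₅ _ (hslb b (by omega)), ?_⟩
    rw [bucketSpan_congr (by omega) (by rw [h7A]) fun b hb => hsame₃₅ _ (hslb b (by omega)),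
      bucketSpan, hcn₃]
    refine hr₄.mem_span_of_eq_zero fun c => ?_
    rw [rowAt, hz c c.2, Nat.cast_zero]
  · have hvec : walkVec x off p k N P (pathAt A₅ k (cv * (N + 1) + cn) (i + 2)) =
        walkVec x off p k N P (l ++ [v]) := by rw [hsl, hp₅]
    have hrow₅ : rowAt A₅ P N sl = rowAt A₄ P N sl := by
      funext c; rw [rowAt, rowAt, h₅9]
    refine ⟨h₅1, h₅T, hsame, fun j hj => by rw [h7' j hj, h₄7], Or.inr ⟨h7, hp₅⟩, ⟨?_, ?_⟩, ?_⟩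
    · rw [h7]
      refine Echelon.append hE₃ ?_ (fun b hb => (hsame₃₅ _ (hslb b hb)).rowAt_eq)
        (fun b hb => by rw [(hsame₃₅ _ (hslb b hb)).pathAt_eq (by omega)])
        (fun b hb => hpiv _ (hslb b hb)) ?_ ?_
      · simp only [hvec]
        rw [hsl, hrow₅]
        exact hr₄
      · rw [hsl, hpc]; exact hcN
      · simp only [hsl, hpc, rowAt, h₅9]
        -- The stored representatives are below `P`, so a nonzero cell is nonzero in the field.
        rw [Ne, ZMod.natCast_eq_zero_iff]
        intro hdvd
        exact hcne (Nat.eq_zero_of_dvd_of_lt hdvd (hlt₄ c hcN))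
    · intro b hb c hc
      rw [h7] at hb
      rcases Nat.lt_succ_iff_lt_or_eq.1 hb with hb | rfl
      · rw [(hsame₃₅ _ (hslb b hb)).row c hc]
        exact hB₃.row_lt b (by omega) c hc
      · rw [hsl, h₅9]; exact hlt₄ c hc
    · rw [bucketSpan, h7, ← hvec]
      exact Submodule.subset_span ⟨cn, by simp, rfl⟩

end RepresentativeWalks

/-! ### From one level to the next -/

namespace RepresentativeWalks

open WordRAM

variable {x off : ℕ → ℕ} {n m s t k μ p M N Y base P : ℕ}

theorem length_forbidden_le (hx : IsInput x off n m s t k μ) {l : List ℕ} (hl : ∀ v ∈ l, v < n) :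
    (forbidden x off l).length ≤ l.length * μ := by
  induction l with
  | nil => simp [forbidden]
  | cons v l ih =>
    have h1 := ih fun u hu => hl u (by simp [hu])
    have h2 := hx.length_le_mu v (hl v (by simp))
    simp only [forbidden, List.flatMap_cons, List.length_append, delList, List.length_map,
      List.length_range, List.length_cons, Nat.add_mul] at h1 ⊢
    omega

theorem lt_of_mem_forbidden (hx : IsInput x off n m s t k μ) {l : List ℕ} (hl : ∀ v ∈ l, v < n)
    {a : ℕ} (ha : a ∈ forbidden x off l) : a < m := by
  simp only [forbidden, delList, List.mem_flatMap, List.mem_map, List.mem_range] at ha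
  obtain ⟨v, hv, j, hj, rfl⟩ := ha
  exact hx.del_lt v (hl v hv) j hj

theorem natCast_injOn (P : ℕ) : Set.InjOn (Nat.cast : ℕ → ZMod P) {a | a < P} := by
  intro a ha b hb hab
  rw [ZMod.natCast_eq_natCast_iff'] at hab
  rwa [Nat.mod_eq_of_lt ha, Nat.mod_eq_of_lt hb] at hab

/-- Buckets only grow during a level, so an extension that has once been covered stays covered. -/
theorem bucketSpan_mono [Fact P.Prime] {A A' : Arrays} {cv len : ℕ} (hlen : len ≤ k)
    (hcnt : A 7 cv ≤ A' 7 cv) (h : ∀ b < A 7 cv, SameSlot k N A A' (cv * (N + 1) + b)) :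
    bucketSpan x off p k N P A cv len ≤ bucketSpan x off p k N P A' cv len := by
  refine Submodule.span_mono ?_
  rintro _ ⟨b, hb, rfl⟩
  exact ⟨b, Set.mem_Iio.2 (lt_of_lt_of_le hb hcnt), by
    simp only [(h b hb).pathAt_eq hlen]⟩

/-- The walks with `i` edges that are stored for the vertex `v`. -/
def Stored (n k N : ℕ) (A : Arrays) (i v : ℕ) (l : List ℕ) : Prop :=
  v < n ∧ ∃ b < A 7 (i * n + v), l = pathAt A k ((i * n + v) * (N + 1) + b) (i + 1)

/-- All levels up to `i` have been computed. -/
structure LevelsDone (x off : ℕ → ℕ) (n m s t k p N : ℕ) (A : Arrays) (i : ℕ) : Prop where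
  offsets : ∀ v < n, A 1 v = off v
  tree : StoresTree A (pointListsUpTo p k)
  empty : ∀ j, (i + 1) * n ≤ j → A 7 j = 0
  count_le : ∀ v < n, A 7 (i * n + v) ≤ N
  sound : SoundAt x off m s i (Stored n k N A i)
  complete : CompleteAt x off m s t k i (Stored n k N A i)
  answer : ∀ i' ≤ i, A 7 (i' * n + t) ≠ 0 ↔ ∃ w e, ConfWalk x off m s i' w e ∧ w i' = t

theorem LevelsDone.vert_lt (hx : IsInput x off n m s t k μ) {A : Arrays} {i : ℕ}
    (h : LevelsDone x off n m s t k p N A i) {v b u : ℕ} (hv : v < n) (hb : b < A 7 (i * n + v))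
    (hu : u ∈ pathAt A k ((i * n + v) * (N + 1) + b) (i + 1)) : u < n := by
  obtain ⟨w, e, hw, _, hl⟩ := h.sound v _ ⟨hv, b, hb, rfl⟩
  rw [hl, List.mem_map] at hu
  obtain ⟨j, hj, rfl⟩ := hu
  rw [List.mem_range] at hj
  exact hw.vert_lt hx (by omega)

/-- The level `i + 1` is being computed from the level `i` of `A₀`; the extensions of the walk
number `b` at its end along the edge `e` in direction `d` have been dealt with if `Done e d b`. -/
structure Building (x off : ℕ → ℕ) (n m k p N P : ℕ) [Fact P.Prime] (A₀ A : Arrays) (i : ℕ)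
    (Done : ℕ → ℕ → ℕ → Prop) : Prop where
  offsets : ∀ v < n, A 1 v = off v
  tree : StoresTree A (pointListsUpTo p k)
  empty : ∀ j, (i + 2) * n ≤ j → A 7 j = 0
  count_eq : ∀ j < (i + 1) * n, A 7 j = A₀ 7 j
  path_eq : ∀ v < n, ∀ b < A₀ 7 (i * n + v),
    SameSlot k N A₀ A ((i * n + v) * (N + 1) + b)
  bucket : ∀ v < n, Bucket x off p k N P A ((i + 1) * n + v) (i + 2)
  sound : ∀ v < n, ∀ b < A 7 ((i + 1) * n + v), ∃ u l e, Stored n k N A₀ i u l ∧ e < m ∧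
    Joins x e u v ∧ e ∉ forbidden x off l ∧
    pathAt A k (((i + 1) * n + v) * (N + 1) + b) (i + 2) = l ++ [v]
  covered : ∀ e d b, Done e d b → e < m → d < 2 → b < A₀ 7 (i * n + x (5 + 2 * e + d)) →
    e ∉ forbidden x off (pathAt A₀ k ((i * n + x (5 + 2 * e + d)) * (N + 1) + b) (i + 1)) →
    walkVec x off p k N P
      (pathAt A₀ k ((i * n + x (5 + 2 * e + d)) * (N + 1) + b) (i + 1) ++
        [x (5 + 2 * e + (1 - d))]) ∈
      bucketSpan x off p k N P A ((i + 1) * n + x (5 + 2 * e + (1 - d))) (i + 2)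

theorem Building.weaken [Fact P.Prime] {A₀ A : Arrays} {i : ℕ} {Done Done' : ℕ → ℕ → ℕ → Prop}
    (h : Building x off n m k p N P A₀ A i Done)
    (hD : ∀ e d b, Done' e d b → e < m → d < 2 → b < A₀ 7 (i * n + x (5 + 2 * e + d)) →
      Done e d b) : Building x off n m k p N P A₀ A i Done' :=
  ⟨h.offsets, h.tree, h.empty, h.count_eq, h.path_eq, h.bucket, h.sound,
    fun e d b hd h1 h2 h3 => h.covered e d b (hD e d b hd h1 h2 h3) h1 h2 h3⟩

theorem LevelsDone.building [Fact P.Prime] {A : Arrays} {i : ℕ}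
    (h : LevelsDone x off n m s t k p N A i) :
    Building x off n m k p N P A A i fun _ _ _ => False := by
  have h0 : ∀ v, A 7 ((i + 1) * n + v) = 0 := fun v => h.empty _ (by omega)
  refine ⟨h.offsets, h.tree, fun j hj => h.empty j ?_, fun _ _ => rfl,
    fun _ _ _ _ => ⟨fun _ _ => rfl, fun _ _ => rfl, rfl⟩, fun v _ => ⟨?_, ?_⟩, ?_, ?_⟩
  · exact le_trans (Nat.mul_le_mul_right _ (by omega)) hj
  · rw [h0]
    exact ⟨by simp, by simp, by simp, by simp⟩
  · simp [h0]
  · simp [h0]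
  · simp

/-- Here the linear algebra yields the representative property. Walks on at most `k` vertices forbid
at most `k * μ = p` edges, the rest of a walk has at most `k` edges, and all edge numbers as well as
`p` are below `P`. So `exists_disjoint_of_mem_span` applies to each extension, whose vector lies in
the span of its bucket. Completeness for a walk with exactly `i + 1` edges, after which nothing is
left to avoid, says that the bucket of `t` is nonempty if such a walk exists. -/
theorem Building.levelsDone (h : Context x off n m s t k μ p M N Y base) [Fact P.Prime]
    (hMP : M < P) {A₀ A : Arrays} {i : ℕ} (hi : i + 1 < k)
    (hL : LevelsDone x off n m s t k p N A₀ i)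
    (hB : Building x off n m k p N P A₀ A i fun _ _ _ => True) :
    LevelsDone x off n m s t k p N A (i + 1) := by
  have hMe := h.M_eq
  have hx := h.input
  have hsound : SoundAt x off m s (i + 1) (Stored n k N A (i + 1)) := by
    refine hL.sound.succ ?_
    rintro v _ ⟨hv, b, hb, rfl⟩
    obtain ⟨u, l, e, hst, he, hj, hf, hp⟩ := hB.sound v hv b hb
    exact ⟨u, l, e, hst, he, hj, hf, hp⟩
  have hvert : ∀ v < n, ∀ b < A 7 ((i + 1) * n + v), ∀ u ∈
      pathAt A k (((i + 1) * n + v) * (N + 1) + b) (i + 2), u < n := by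
    intro v hv b hb u hu
    obtain ⟨w, e, hw, _, hl⟩ := hsound v _ ⟨hv, b, hb, rfl⟩
    rw [hl, List.mem_map] at hu
    obtain ⟨j, hj, rfl⟩ := hu
    rw [List.mem_range] at hj
    exact hw.vert_lt hx (by omega)
  have hlen : ∀ l : List ℕ, l.length ≤ k → (∀ v ∈ l, v < n) →
      (forbidden x off l).length ≤ p := by
    intro l hlk hl
    refine (length_forbidden_le hx hl).trans ?_
    rw [h.p_eq]
    exact Nat.mul_le_mul_right _ hlk
  have hcomplete : CompleteAt x off m s t k (i + 1) (Stored n k N A (i + 1)) := by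
    refine hL.complete.succ hx ?_
    rintro u _ e v hu hv ⟨_, b, hb, rfl⟩ he ⟨d, hd, rfl, rfl⟩ hf Q hQk hQm hQ
    have hcov := hB.covered e d b trivial he hd hb hf
    have hpath : ∀ w ∈ pathAt A₀ k ((i * n + x (5 + 2 * e + d)) * (N + 1) + b) (i + 1) ++
        [x (5 + 2 * e + (1 - d))], w < n := by
      intro w hw
      rw [List.mem_append, List.mem_singleton] at hw
      rcases hw with hw | rfl
      · exact hL.vert_lt hx hu hb hw
      · exact hv
    have hcovers : Covers N p k (points p k) := by
      rw [h.N_eq]; exact covers_pointListsUpTo p k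
    obtain ⟨b', hb', hQ'⟩ := exists_disjoint_of_mem_span (F := ZMod P) hcovers
      (show p < P by omega) (natCast_injOn P)
      (K := fun b' => forbidden x off
        (pathAt A k (((i + 1) * n + x (5 + 2 * e + (1 - d))) * (N + 1) + b') (i + 2)))
      (hlen _ (by simp [pathAt]; omega) hpath)
      (fun b' hb' => hlen _ (by simp [pathAt]; omega) (hvert _ hv b' hb'))
      (fun a ha => by have := lt_of_mem_forbidden hx hpath ha; omega)
      (fun b' hb' a ha => by have := lt_of_mem_forbidden hx (hvert _ hv b' hb') ha; omega)
      hcov hQk (fun a ha => by have := hQm a ha; omega) hQ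
    exact ⟨_, ⟨hv, b', hb', rfl⟩, hQ'⟩
  refine ⟨hB.offsets, hB.tree, hB.empty, fun v hv => (hB.bucket v hv).echelon.le, hsound,
    hcomplete, fun i' hi' => ?_⟩
  rcases Nat.le_succ_iff.1 hi' with hi' | rfl
  · rw [hB.count_eq, hL.answer i' hi']
    have := hx.t_lt
    calc i' * n + t < i' * n + n := by omega
      _ = (i' + 1) * n := by ring
      _ ≤ (i + 1) * n := Nat.mul_le_mul_right _ (by omega)
  · constructor
    · intro hne
      obtain ⟨w, e, hw, hwt, _⟩ := hsound t _ ⟨hx.t_lt, 0, Nat.pos_of_ne_zero hne, rfl⟩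
      exact ⟨w, e, hw, hwt⟩
    · rintro ⟨w, e, hw, hwt⟩
      obtain ⟨l, ⟨_, b, hb, _⟩, _⟩ := hcomplete (i + 1) hi w e hw hwt le_rfl
      rw [hwt] at hb
      exact Nat.ne_of_gt (lt_of_le_of_lt (Nat.zero_le _) hb)

theorem Building.set_result [Fact P.Prime] {A₀ A : Arrays} {i : ℕ} {Done : ℕ → ℕ → ℕ → Prop}
    (hi : i + 1 < k) (hB : Building x off n m k p N P A₀ A i Done) (r : ℕ) :
    Building x off n m k p N P A₀ (A.set 0 5 r) i Done := by
  have hsame : ∀ a, SameSlot k N A (A.set 0 5 r) a := fun a =>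
    ⟨fun j _ => by rw [Arrays.set_array_ne _ (by decide)],
      fun j _ => by rw [Arrays.set_array_ne _ (by decide)],
      by rw [Arrays.set_array_ne _ (by decide)]⟩
  have h7 : (A.set 0 5 r) 7 = A 7 := Arrays.set_array_ne _ (by decide)
  have h8' : (A.set 0 5 r) 8 = A 8 := Arrays.set_array_ne _ (by decide)
  refine ⟨by rw [Arrays.set_array_ne _ (by decide)]; exact hB.offsets,
    hB.tree.congr (Arrays.set_index_ne _ (by decide)) (Arrays.set_array_ne _ (by decide))
      (Arrays.set_array_ne _ (by decide)),
    by rw [h7]; exact hB.empty, by rw [h7]; exact hB.count_eq, fun v hv b hb => ?_,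
    fun v hv => (hB.bucket v hv).congr (by omega) (by rw [h7]) fun b _ => hsame _,
    ?_, fun e d b h1 h2 h3 h4 h5 => ?_⟩
  · have := hB.path_eq v hv b hb
    exact ⟨fun j hj => by rw [h8']; exact this.path j hj,
      fun c hc => by rw [Arrays.set_array_ne _ (by decide)]; exact this.row c hc,
      by rw [Arrays.set_array_ne _ (by decide)]; exact this.piv⟩
  · rw [h7]
    simpa only [pathAt, h8'] using hB.sound
  · rw [bucketSpan_congr (by omega) (by rw [h7]) fun b _ => hsame _]
    exact hB.covered e d b h1 h2 h3 h4 h5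

/-- Only the slot `sl` changes. It lies in level `i + 1`, so the walks of level `i` are intact;
another bucket of the new level owns other slots, and older members of the same bucket have numbers
below `cn`. -/
theorem Building.insert (hx : IsInput x off n m s t k μ) [Fact P.Prime] {A₀ A₁ A' : Arrays}
    {i e d b u v cv cn sl : ℕ} {l : List ℕ} {Done : ℕ → ℕ → ℕ → Prop} (hi : i + 1 < k)
    (he : e < m) (hd : d < 2) (hu : x (5 + 2 * e + d) = u) (hv : x (5 + 2 * e + (1 - d)) = v)
    (hun : u < n) (hb : b < A₀ 7 (i * n + u)) (hvn : v < n)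
    (hl : pathAt A₀ k ((i * n + u) * (N + 1) + b) (i + 1) = l) (hef : e ∉ forbidden x off l)
    (hcv : (i + 1) * n + v = cv) (hcn : A₁ 7 cv = cn) (hsl : cv * (N + 1) + cn = sl)
    (hL : ∀ u < n, A₀ 7 (i * n + u) ≤ N)
    (hnesl : ∀ u' < n, ∀ b' ≤ N, (i * n + u') * (N + 1) + b' ≠ sl)
    (hB' : Building x off n m k p N P A₀ A₁ i Done)
    (g1 : A' 1 = A₁ 1) (gT : StoresTree A' (pointListsUpTo p k))
    (gsame : ∀ a ≠ sl, SameSlot k N A₁ A' a) (g7 : ∀ j ≠ cv, A' 7 j = A₁ 7 j)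
    (gcase : A' 7 cv = cn ∨ A' 7 cv = cn + 1 ∧ pathAt A' k sl (i + 2) = l ++ [v])
    (gB : Bucket x off p k N P A' cv (i + 2))
    (gspan : walkVec x off p k N P (l ++ [v]) ∈ bucketSpan x off p k N P A' cv (i + 2)) :
    Building x off n m k p N P A₀ A' i
      fun e' d' b' => Done e' d' b' ∨ e' = e ∧ d' = d ∧ b' = b := by
  have hcnN : cn ≤ N := by
    rw [← hcn, ← hcv]; exact (hB'.bucket v hvn).echelon.le
  have hcount : A₁ 7 cv ≤ A' 7 cv := by rcases gcase with g | g <;> omega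
  have hsameBucket : ∀ v' < n, ∀ b' < A₁ 7 ((i + 1) * n + v'),
      SameSlot k N A₁ A' (((i + 1) * n + v') * (N + 1) + b') := by
    intro v' hv' b' hb'
    refine gsame _ ?_
    have hb'N : b' < N := lt_of_lt_of_le hb' (hB'.bucket v' hv').echelon.le
    by_cases hvv : (i + 1) * n + v' = cv
    · rw [hvv] at hb' ⊢; omega
    · rw [← hsl]; exact mul_add_ne hvv (by omega) (by omega)
  refine ⟨by rw [g1]; exact hB'.offsets, gT, fun j hj => ?_, fun j hj => ?_, fun u' hu' b' hb' => ?_,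
    fun v' hv' => ?_, fun v' hv' b' hb' => ?_, ?_⟩
  · rw [g7 j, hB'.empty j hj]
    rw [Nat.add_mul] at hj hcv
    omega
  · rw [g7 j (by omega), hB'.count_eq j hj]
  · have e1 := hB'.path_eq u' hu' b' hb'
    have e2 := gsame _ (hnesl u' hu' b' (by have := hL u' hu'; omega))
    exact ⟨fun j hj => (e2.path j hj).trans (e1.path j hj),
      fun c hc => (e2.row c hc).trans (e1.row c hc), e2.piv.trans e1.piv⟩
  · by_cases hvv : (i + 1) * n + v' = cv
    · rw [hvv]; exact gB
    · exact (hB'.bucket v' hv').congr (by omega) (g7 _ hvv) (hsameBucket v' hv')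
  · by_cases hold : b' < A₁ 7 ((i + 1) * n + v')
    · obtain ⟨u₁, l₁, e₁, k1, k2, k3, k4, k5⟩ := hB'.sound v' hv' b' hold
      refine ⟨u₁, l₁, e₁, k1, k2, k3, k4, ?_⟩
      rw [(hsameBucket v' hv' b' hold).pathAt_eq (by omega), k5]
    · have hvv : (i + 1) * n + v' = cv := by
        by_contra hvv
        rw [g7 _ hvv] at hb'
        exact hold hb'
      obtain rfl : v' = v := by omega
      rcases gcase with g | ⟨g, gp⟩
      · rw [hvv] at hb' hold; omega
      · have hbcn : b' = cn := by rw [hvv] at hb' hold; omega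
        refine ⟨u, l, e, ⟨hun, b, hb, by rw [hl]⟩, he, ⟨d, hd, hu, hv⟩, hef, ?_⟩
        rw [hvv, hbcn, hsl, gp]
  · rintro e' d' b' hD k1 k2 k3 k4
    rcases hD with hD | ⟨rfl, rfl, rfl⟩
    · have := hB'.covered e' d' b' hD k1 k2 k3 k4
      refine bucketSpan_mono (by omega) ?_
        (hsameBucket _ (hx.end_lt e' k1 _ (by omega))) this
      by_cases hvv : (i + 1) * n + x (5 + 2 * e' + (1 - d')) = cv
      · rw [hvv]; exact hcount
      · rw [g7 _ hvv]
    · rw [hu, hv, hl, hcv]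
      exact gspan

/-- Try to extend the walk number `var 18` at `var 16` along the edge `var 12` to `var 17`. -/
def stepCmd : Cmd :=
  .bind 20 ((.var 10 * .var 0 + .var 16) * (.var 9 + 1) + .var 18) <|
  .seq (.bind 26 (.var 20) <| .bind 27 (.var 10 + 1) <| .bind 28 (.var 12) evalCmd) <|
  .ite (.arr 0 5)
    (.bind 21 ((.var 10 + 1) * .var 0 + .var 17) <| .bind 22 (.arr 7 (.var 21)) <|
      .bind 23 (.var 21 * (.var 9 + 1) + .var 22) insertCmd)
    .skip

/-- The test whether `e` is forbidden evaluates the product of the walk at `y = e`: the remainder is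
zero exactly if `e` occurs among the forbidden edges, all edge numbers being below `P`. If it is
zero, the extension is not conforming and there is nothing to cover. -/
theorem stepCmd_spec (h : Context x off n m s t k μ p M N Y base) [Fact P.Prime] (hMP : M < P)
    (hPM : P ≤ 2 * M) {env : ℕ → ℕ} {A₀ A : Arrays} {i e d b u v : ℕ}
    {Done : ℕ → ℕ → ℕ → Prop}
    (h0 : env 0 = n) (h5 : env 5 = k) (h6 : env 6 = p) (h8 : env 8 = P) (h9 : env 9 = N)
    (h10 : env 10 = i) (h12 : env 12 = e) (h16 : env 16 = u) (h17 : env 17 = v) (h18 : env 18 = b)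
    (hi : i + 1 < k) (he : e < m) (hd : d < 2) (hu : x (5 + 2 * e + d) = u)
    (hv : x (5 + 2 * e + (1 - d)) = v) (hb : b < A₀ 7 (i * n + u))
    (hL : LevelsDone x off n m s t k p N A₀ i)
    (hB : Building x off n m k p N P A₀ A i Done) :
    Achieves base (Y ^ 5) x env A stepCmd (1700 * N ^ 2) fun A' =>
      Building x off n m k p N P A₀ A' i
        fun e' d' b' => Done e' d' b' ∨ e' = e ∧ d' = d ∧ b' = b := by
  have hx := h.input
  have hN := h.N_lt
  have hkN := h.lt_N
  have hV := h.sq_lt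
  have hMe := h.M_eq
  have hM := h.M_lt
  have hcube := h.cube_le
  have hN1 : N ≤ N ^ 2 := Nat.le_self_pow (by norm_num) N
  have hun : u < n := by rw [← hu]; exact hx.end_lt e he d hd
  have hvn : v < n := by rw [← hv]; exact hx.end_lt e he _ (by omega)
  have hbN : b < N := lt_of_lt_of_le hb (hL.count_le u hun)
  obtain ⟨ps, hps⟩ : ∃ ps, (i * n + u) * (N + 1) + b = ps := ⟨_, rfl⟩
  have hpsY : ps < Y ^ 3 := by rw [← hps]; exact h.slot_lt (by omega) hun hbN.le
  have hsub : i * n + u ≤ (i * n + u) * (N + 1) := Nat.le_mul_of_pos_right _ (by omega)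
  obtain ⟨l, hl⟩ : ∃ l, pathAt A₀ k ps (i + 1) = l := ⟨_, rfl⟩
  have hlA : pathAt A k ps (i + 1) = l := by
    rw [← hl, ← hps]; exact (hB.path_eq u hun b hb).pathAt_eq (by omega)
  have hln : ∀ w ∈ l, w < n := by
    intro w hw
    rw [← hl, ← hps] at hw
    exact hL.vert_lt hx hun hb hw
  have hslot0 := h.slot_lt (i := i) (v := u) (b := b) (by omega) hun hbN.le
  refine Achieves.bind (B' := 1680 * N ^ 2) ?_ ?_ ?_
  · simp [h10, h0, h16, h9, h18]
    omega
  swap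
  · simp
    omega
  simp only [Term.val_add, Term.val_mul, Term.val_var, Term.val_ofNat, h10, h0, h16, h9, h18, hps]
  refine Achieves.seq (B₁ := 400 * N) (B₂ := 1200 * N ^ 2)
    (Q₁ := fun A' => ∃ r, A' = A.set 0 5 r ∧ r < P ∧
      (r : ZMod P) = avoidProd (forbidden x off l) (e : ZMod P)) ?_ ?_ (by omega)
  · refine Achieves.bind (B' := 100 * (2 * N + 1) + 10) (by simp) ?_ (by simp; omega)
    refine Achieves.bind (B' := 100 * (2 * N + 1) + 4) (by simp [h10]; omega) ?_
      (by simp; omega)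
    refine Achieves.bind (B' := 100 * (2 * N + 1)) (by simp) ?_ (by simp; omega)
    have key := evalCmd_spec h hPM (A := A) (slot := ps) (len := i + 1) (y := e)
      (env := Function.update (Function.update (Function.update (Function.update env 20 ps)
        26 ps) 27 (i + 1)) 28 e) (by simpa using h5)
      (by simpa using h8) (by simp) (by simp) (by simp) hpsY (by omega) (by omega)
      hB.offsets (fun j hj => hln _ (by
        rw [← hlA, pathAt]; exact List.mem_map.2 ⟨j, List.mem_range.2 hj, rfl⟩))
    rw [hlA] at key
    have htime : 100 * ((i + 1) * (μ + 1) + 1) ≤ 100 * (2 * N + 1) := by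
      have h1 : (i + 1) * (μ + 1) ≤ k * (μ + 1) := Nat.mul_le_mul_right _ (by omega)
      have h2 : k * (μ + 1) = p + k := by rw [h.p_eq]; ring
      omega
    refine Achieves.mono (B' := 100 * ((i + 1) * (μ + 1) + 1)) ?_ htime (fun A'' h _ => h)
    simpa [h10, h12] using key
  rintro _ ⟨r, rfl, hr, hrv⟩
  -- The one-point case of `avoidVal_ne_zero_iff`, together with `r < P`.
  have hrzero : r = 0 ↔ e ∈ forbidden x off l := by
    have h1 := avoidVal_ne_zero_iff (F := ZMod P) (natCast_injOn P) (l := forbidden x off l)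
      (Q := [e]) (fun a ha => by have := lt_of_mem_forbidden hx hln ha; omega)
      (fun a ha => by rw [List.mem_singleton] at ha; omega)
    simp only [avoidVal, List.map_cons, List.map_nil, List.prod_cons, List.prod_nil, mul_one,
      List.mem_singleton, forall_eq, ← hrv] at h1
    have h2 : (r : ZMod P) = 0 ↔ r = 0 := by
      rw [ZMod.natCast_eq_zero_iff]
      exact ⟨fun hdvd => Nat.eq_zero_of_dvd_of_lt hdvd hr, fun h => h ▸ dvd_zero _⟩
    rw [ne_eq, h2] at h1
    tauto
  have hB' := hB.set_result hi r
  have hr5 : (A.set 0 5 r) 0 5 = r := Arrays.set_same _ _ _ _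
  generalize A.set 0 5 r = A₁ at hB' hr5 ⊢
  refine Achieves.ite (B' := 1150 * N ^ 2) (by simp; omega) ?_ ?_ (by simp; omega)
  · intro hne
    have hr0 : r ≠ 0 := by simpa [hr5] using hne
    have hef : e ∉ forbidden x off l := fun hmem => hr0 (hrzero.2 hmem)
    obtain ⟨cv, hcv⟩ : ∃ cv, (i + 1) * n + v = cv := ⟨_, rfl⟩
    have hBk := hB'.bucket v hvn
    rw [hcv] at hBk
    obtain ⟨cn, hcn⟩ : ∃ cn, A₁ 7 cv = cn := ⟨_, rfl⟩
    have hcnN : cn ≤ N := by rw [← hcn]; exact hBk.echelon.le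
    obtain ⟨sl, hsl⟩ : ∃ sl, cv * (N + 1) + cn = sl := ⟨_, rfl⟩
    have hslY : sl < Y ^ 3 := by
      rw [← hsl, ← hcv]; exact h.slot_lt hi hvn hcnN
    have hcvle : cv ≤ cv * (N + 1) := Nat.le_mul_of_pos_right _ (by omega)
    have hlow : i * n + u < (i + 1) * n := by rw [Nat.add_mul]; omega
    have hnesl : ∀ u' < n, ∀ b' ≤ N, (i * n + u') * (N + 1) + b' ≠ sl := by
      intro u' hu' b' hb'
      have : i * n + u' < (i + 1) * n := by rw [Nat.add_mul]; omega
      rw [← hsl]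
      exact mul_add_ne (by omega) (by omega) (by omega)
    refine Achieves.bind (B' := 1140 * N ^ 2) ?_ ?_ (by simp; omega)
    · simp [h10, h0, h17]; omega
    refine Achieves.bind (B' := 1120 * N ^ 2) ?_ ?_ (by simp; omega)
    · simp [h10, h0, h17, hcv]; omega
    refine Achieves.bind (B' := 1100 * N ^ 2) ?_ ?_ (by simp; omega)
    · simp [h10, h0, h17, hcv, h9, hcn]; omega
    have hlA₁ : pathAt A₁ k ps (i + 1) = l := by
      rw [← hl, ← hps]; exact (hB'.path_eq u hun b hb).pathAt_eq (by omega)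
    refine (insertCmd_spec h hMP hPM (A := A₁) (i := i) (v := v) (src := ps) (cv := cv) (cn := cn)
      (sl := sl) (l := l) (by simpa using h5) (by simpa using h6) (by simpa using h8)
      (by simpa using h9) (by simpa using h10) (by simpa using h17) (by simp)
      (by simp [h10, h0, h17, hcv]) (by simp [h10, h0, h17, hcv, hcn])
      (by simp [h10, h0, h17, hcv, hcn, h9, hsl]) hcn hsl hslY (by omega) hpsY
      (by rw [← hps]; exact hnesl u hun b hbN.le) hi hlA₁ hln hvn hB'.offsets hB'.tree
      hBk).mono le_rfl ?_
    rintro A' ⟨g1, gT, gsame, g7, gcase, gB, gspan⟩ -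
    exact hB'.insert hx hi he hd hu hv hun hb hvn (by rw [hps, hl]) hef hcv hcn hsl hL.count_le
      hnesl g1 gT gsame g7 gcase gB gspan
  · intro heq
    have hr0 : r = 0 := by simpa [hr5] using heq
    refine Achieves.skip (by omega) ?_
    refine ⟨hB'.offsets, hB'.tree, hB'.empty, hB'.count_eq, hB'.path_eq, hB'.bucket, hB'.sound, ?_⟩
    rintro e' d' b' hD k1 k2 k3 k4
    rcases hD with hD | ⟨rfl, rfl, rfl⟩
    · exact hB'.covered e' d' b' hD k1 k2 k3 k4
    · rw [hu, hps, hl] at k4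
      exact absurd (hrzero.1 hr0) k4

end RepresentativeWalks

/-! ### The complete algorithm -/

namespace RepresentativeWalks

open WordRAM

variable {x off : ℕ → ℕ} {n m s t k μ p M N Y base P : ℕ}

/-- Compute the levels `1, …, k - 1`. -/
def levelsCmd : Cmd :=
  .loop 10 (.var 5 - 1) <| .loop 12 (.var 1) <| .loop 14 2 <|
    .bind 16 (.input (5 + 2 * .var 12 + .var 14)) <|
    .bind 17 (.input (5 + 2 * .var 12 + (1 - .var 14))) <|
    .loop 18 (.arr 7 (.var 10 * .var 0 + .var 16)) stepCmd

/-- The extensions are enumerated by edge, direction and number of the walk, and the predicate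
`Done` grows in this lexicographic order. The time multiplies fewer than `N` levels, `m` edges, two
directions, at most `N` walks and `O(N ^ 2)` for each extension. -/
theorem levelsCmd_spec (h : Context x off n m s t k μ p M N Y base) [Fact P.Prime] (hMP : M < P)
    (hPM : P ≤ 2 * M) {env : ℕ → ℕ} {A : Arrays} (h0 : env 0 = n) (h1 : env 1 = m)
    (h5 : env 5 = k) (h6 : env 6 = p) (h8 : env 8 = P) (h9 : env 9 = N)
    (hL : LevelsDone x off n m s t k p N A 0) :
    Achieves base (Y ^ 5) x env A levelsCmd (5000 * (N ^ 4 * (m + 1))) fun A' =>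
      LevelsDone x off n m s t k p N A' (k - 1) := by
  have hx := h.input
  have hN := h.N_lt
  have hkN := h.lt_N
  have hV := h.sq_lt
  have hMe := h.M_eq
  have hM := h.M_lt
  have hcube := h.cube_le
  have hbe := h.base_eq
  have hbV := h.base_lt
  have hk := hx.k_pos
  have hN1 : N ^ 2 ≤ N ^ 3 := Nat.pow_le_pow_right (by omega) (by norm_num)
  have hN2 : N ≤ N ^ 2 := Nat.le_self_pow (by norm_num) N
  have hN4 : N * N ^ 3 = N ^ 4 := by ring
  have hN3 : N * N ^ 2 = N ^ 3 := by ring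
  refine Achieves.loop (b := k - 1) (t := 4200 * (N ^ 3 * (m + 1)))
    (fun i A' => LevelsDone x off n m s t k p N A' i) (by simp [h5]; omega) (by simp [h5])
    (by omega) hL ?_ ?_ (fun _ h => h)
  · intro i hi A₀ hL₀ _
    refine Achieves.loop (b := m) (t := 4100 * N ^ 3)
      (fun e A' => Building x off n m k p N P A₀ A' i fun e' _ _ => e' < e)
      (by simp) (by simp [Cmd.loopEnv, h1]) (by omega)
      (hL₀.building.weaken fun e d b h1 _ _ _ => by omega) ?_ ?_
      (fun A' hA' => Building.levelsDone h hMP (by omega) hL₀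
        (hA'.weaken fun e d b _ h1 _ _ => h1))
    · intro e he A₁ hB₁ _
      have hm1 : 5 + 2 * e + 1 < base := by rw [hbe]; omega
      refine Achieves.loop (b := 2) (t := 1900 * N ^ 3)
        (fun d A' => Building x off n m k p N P A₀ A' i
          fun e' d' _ => e' < e ∨ e' = e ∧ d' < d)
        (by simp; omega) (by simp) (by omega)
        (hB₁.weaken fun e d b h1 _ _ _ => by omega) ?_ (by simp; omega)
        (fun A' hA' => hA'.weaken fun e d b _ h1 _ _ => by omega)
      intro d hd A₂ hB₂ _
      obtain ⟨u, hu⟩ : ∃ u, x (5 + 2 * e + d) = u := ⟨_, rfl⟩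
      obtain ⟨v, hv⟩ : ∃ v, x (5 + 2 * e + (1 - d)) = v := ⟨_, rfl⟩
      have hun : u < n := by rw [← hu]; exact hx.end_lt e he d hd
      have hslot := h.slot_lt (i := i) (v := u) (b := 0) (by omega) hun (by omega)
      have hle : i * n + u ≤ (i * n + u) * (N + 1) := Nat.le_mul_of_pos_right _ (by omega)
      have hlow : i * n + u < (i + 1) * n := by rw [Nat.add_mul]; omega
      have hcount := hL₀.count_le u hun
      refine Achieves.bind (B' := 1880 * N ^ 3) ?_ ?_ (by simp; omega)
      · simp [Cmd.loopEnv]; omega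
      refine Achieves.bind (B' := 1860 * N ^ 3) ?_ ?_ (by simp; omega)
      · simp [Cmd.loopEnv]; omega
      refine Achieves.loop (b := A₀ 7 (i * n + u)) (t := 1700 * N ^ 2)
        (fun b A' => Building x off n m k p N P A₀ A' i
          fun e' d' b' => (e' < e ∨ e' = e ∧ d' < d) ∨ e' = e ∧ d' = d ∧ b' < b)
        ?_ ?_ (by omega) (hB₂.weaken fun e d b h1 _ _ _ => by omega) ?_ ?_
        (fun A' hA' => hA'.weaken fun e' d' b' h1 _ h2 h3 => ?_)
      · simp [Cmd.loopEnv, h0, hu]; omega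
      -- The bound is read from the current arrays, but insertions into level `i + 1` do not change
      -- the counters of level `i`.
      · simp [Cmd.loopEnv, h0, hu, hB₂.count_eq _ hlow]
      · intro b hb A₃ hB₃ _
        refine (stepCmd_spec h hMP hPM (e := e) (d := d) (b := b) (u := u) (v := v)
          (by simpa [Cmd.loopEnv] using h0) (by simpa [Cmd.loopEnv] using h5)
          (by simpa [Cmd.loopEnv] using h6) (by simpa [Cmd.loopEnv] using h8)
          (by simpa [Cmd.loopEnv] using h9) (by simp [Cmd.loopEnv]) (by simp [Cmd.loopEnv])
          (by simp [Cmd.loopEnv, hu]) (by simp [Cmd.loopEnv, hv]) (by simp [Cmd.loopEnv])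
          (by omega) he hd hu hv hb hL₀ hB₃).mono le_rfl ?_
        exact fun A' hA' _ => hA'.weaken fun e' d' b' h1 _ _ _ => by omega
      · have : A₀ 7 (i * n + u) * (1700 * N ^ 2 + 8) ≤ N * (1708 * N ^ 2) :=
          Nat.mul_le_mul hcount (by omega)
        have e1 : N * (1708 * N ^ 2) = 1708 * N ^ 3 := by ring
        simp
        omega
      · rcases h1 with h1 | ⟨rfl, h1⟩
        · exact Or.inl (Or.inl h1)
        · by_cases hdd : d' < d
          · exact Or.inl (Or.inr ⟨rfl, hdd⟩)
          · obtain rfl : d' = d := by omega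
            refine Or.inr ⟨rfl, rfl, ?_⟩
            rwa [hu] at h3
    · have e1 : m * (4100 * N ^ 3 + 8) ≤ m * (4150 * N ^ 3) := Nat.mul_le_mul_left _ (by omega)
      have e2 : m * (4150 * N ^ 3) + 4150 * N ^ 3 = 4150 * (N ^ 3 * (m + 1)) := by ring
      simp
      omega
  · have e1 : (k - 1) * (4200 * (N ^ 3 * (m + 1)) + 8) ≤ N * (4208 * (N ^ 3 * (m + 1))) := by
      refine Nat.mul_le_mul (by omega) ?_
      have : 1 ≤ N ^ 3 * (m + 1) := Nat.mul_pos (by omega) (by omega)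
      omega
    have e2 : N * (4208 * (N ^ 3 * (m + 1))) = 4208 * (N ^ 4 * (m + 1)) := by ring
    have : 1 ≤ N ^ 4 * (m + 1) := Nat.mul_pos (Nat.pow_pos (by omega)) (by omega)
    simp
    omega

/-- Store the walk without edges. -/
def initCmd : Cmd :=
  .seq (.set 7 (.var 3) 1) (.set 8 (.var 3 * (.var 9 + 1) * .var 5) (.var 3))

theorem initCmd_spec (h : Context x off n m s t k μ p M N Y base) {env : ℕ → ℕ} {A : Arrays}
    (h3 : env 3 = s) (h5 : env 5 = k) (h9 : env 9 = N) (hoff : ∀ v < n, A 1 v = off v)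
    (hT : StoresTree A (pointListsUpTo p k)) (h7 : ∀ j, A 7 j = 0) :
    Achieves base (Y ^ 5) x env A initCmd 50 fun A' => LevelsDone x off n m s t k p N A' 0 := by
  have hx := h.input
  have hN := h.N_lt
  have hkN := h.lt_N
  have hV := h.sq_lt
  have hnY := h.n_le
  have hsn := hx.s_lt
  have hslot := h.slot_lt (i := 0) (v := s) (b := 0) hx.k_pos hsn (by omega)
  simp only [zero_mul, zero_add, add_zero] at hslot
  have hcube := h.cube_le
  have hcell := h.cell_lt hslot (show k ≤ Y by omega) (show 0 < Y by omega)
  refine Achieves.seq (B₁ := 20) (B₂ := 30) (Q₁ := fun A' => A' = A.set 7 s 1) ?_ ?_ (by omega)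
  · exact Achieves.set (by simp) (by simp [h3]; omega) (by simp; omega) (by simp) (by simp [h3])
  rintro _ rfl
  refine Achieves.set ?_ ?_ (by simp) (by simp) ?_
  · simp [h3, h5, h9]; omega
  · simp [h3, h5, h9]; omega
  · simp only [Term.val_mul, Term.val_add, Term.val_var, Term.val_ofNat, h3, h5, h9]
    set A' := (A.set 7 s 1).set 8 (s * (N + 1) * k) s with hA'
    have h7' : ∀ j, A' 7 j = if j = s then 1 else 0 := by
      intro j
      simp [hA', Arrays.set_apply, h7]
    have hpath : pathAt A' k (s * (N + 1)) 1 = [s] := by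
      simp [pathAt, hA', Arrays.set_apply]
    have hst : ∀ v l, Stored n k N A' 0 v l ↔ v = s ∧ l = [s] := by
      intro v l
      simp only [Stored, zero_mul, zero_add, h7']
      constructor
      · rintro ⟨_, b, hb, rfl⟩
        split at hb
        · next hvs =>
          obtain rfl : b = 0 := by omega
          subst hvs
          exact ⟨rfl, hpath⟩
        · omega
      · rintro ⟨rfl, rfl⟩
        exact ⟨hsn, 0, by simp, hpath.symm⟩
    have hst' : Stored n k N A' 0 = fun v l => v = s ∧ l = [s] := by
      funext v l; exact propext (hst v l)
    refine ⟨fun v hv => ?_, hT.congr ?_ ?_ ?_, fun j hj => ?_, fun v hv => ?_, ?_, ?_, ?_⟩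
    · simpa [hA', Arrays.set_apply] using hoff v hv
    · simp [hA', Arrays.set_apply]
    · simp [hA', Arrays.set_array_ne]
    · simp [hA', Arrays.set_array_ne]
    · rw [h7', if_neg (by omega)]
    · rw [h7']; split <;> omega
    · rw [hst']; exact soundAt_zero
    · rw [hst']; exact completeAt_zero
    · intro i' hi'
      obtain rfl : i' = 0 := by omega
      rw [h7']
      constructor
      · intro hne
        have hts : 0 * n + t = s := by
          by_contra hcon; exact hne (if_neg hcon)
        exact ⟨fun _ => s, fun _ => 0, ⟨rfl, by simp, by simp, by simp⟩, by simp at hts; exact hts.symm⟩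
      · rintro ⟨w, e, hw, hwt⟩
        rw [hw.start] at hwt
        simp [hwt]

/-- Check whether some walk to `t` is stored. -/
def answerCmd : Cmd :=
  .seq (.set 0 7 0) <|
  .loop 10 (.var 5) <| .ite (.arr 7 (.var 10 * .var 0 + .var 4)) (.set 0 7 1) .skip

theorem answerCmd_spec (h : Context x off n m s t k μ p M N Y base) {env : ℕ → ℕ} {A : Arrays}
    (h0 : env 0 = n) (h4 : env 4 = t) (h5 : env 5 = k)
    (hL : LevelsDone x off n m s t k p N A (k - 1)) :
    Achieves base (Y ^ 5) x env A answerCmd (100 * N) fun A' =>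
      ((∃ r < k, ∃ w e, ConfWalk x off m s r w e ∧ w r = t) → A' 0 7 = 1) ∧
      ((¬ ∃ r < k, ∃ w e, ConfWalk x off m s r w e ∧ w r = t) → A' 0 7 = 0) := by
  have hx := h.input
  have hN := h.N_lt
  have hkN := h.lt_N
  have hV := h.sq_lt
  have hcube := h.cube_le
  refine Achieves.seq (B₁ := 20) (B₂ := 60 * N + 10) (Q₁ := fun A' => A' = A.set 0 7 0) ?_ ?_
    (by omega)
  · exact Achieves.set (by simp; omega) (by simp; omega) (by simp; omega) (by simp) (by simp)
  rintro _ rfl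
  refine Achieves.loop (b := k) (t := 50)
    (fun i A' => A' 7 = A 7 ∧ ((∃ r < i, A 7 (r * n + t) ≠ 0) → A' 0 7 = 1) ∧
      ((¬ ∃ r < i, A 7 (r * n + t) ≠ 0) → A' 0 7 = 0))
    (by simp) (by simp [h5]) (by omega) ?_ ?_ (by simp; omega) ?_
  · exact ⟨Arrays.set_array_ne _ (by decide), by simp, by simp⟩
  · rintro i hi A' ⟨hI1, hI2, hI3⟩ -
    have hslot := h.slot_lt (i := i) (v := t) (b := 0) hi hx.t_lt (by omega)
    have hle : i * n + t ≤ (i * n + t) * (N + 1) := Nat.le_mul_of_pos_right _ (by omega)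
    refine Achieves.ite (B' := 20) ?_ ?_ ?_ (by simp)
    · simp [Cmd.loopEnv, h0, h4]; omega
    · intro hne
      simp [Cmd.loopEnv, h0, h4, hI1] at hne
      refine Achieves.set (by simp; omega) (by simp; omega) (by simp; omega) (by simp)
        ⟨by rw [Arrays.set_array_ne _ (by decide), hI1], by simp, fun hn => ?_⟩
      exact absurd ⟨i, by omega, hne⟩ hn
    · intro heq
      simp [Cmd.loopEnv, h0, h4, hI1] at heq
      have hiff : (∃ r < i + 1, A 7 (r * n + t) ≠ 0) ↔ ∃ r < i, A 7 (r * n + t) ≠ 0 := by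
        constructor
        · rintro ⟨r, hr, hne⟩
          rcases Nat.lt_succ_iff_lt_or_eq.1 hr with hr | rfl
          · exact ⟨r, hr, hne⟩
          · exact absurd heq hne
        · rintro ⟨r, hr, hne⟩
          exact ⟨r, by omega, hne⟩
      refine Achieves.skip (by omega) ?_
      rw [hiff]
      exact ⟨hI1, hI2, hI3⟩
  · rintro A' ⟨_, hI2, hI3⟩
    have hiff : (∃ r < k, A 7 (r * n + t) ≠ 0) ↔
        ∃ r < k, ∃ w e, ConfWalk x off m s r w e ∧ w r = t := by
      constructor
      · rintro ⟨r, hr, hne⟩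
        exact ⟨r, hr, (hL.answer r (by omega)).1 hne⟩
      · rintro ⟨r, hr, hw⟩
        exact ⟨r, hr, (hL.answer r (by omega)).2 hw⟩
    rw [hiff] at hI2 hI3
    exact ⟨hI2, hI3⟩

/-- The whole algorithm; the variables `0`, `1`, `2` hold `n`, `m` and the start of the arrays. -/
def mainCmd : Cmd :=
  .bind 3 (.input 2) <| .bind 4 (.input 3) <| .bind 5 (.input 4) <| .seq scanCmd <|
  .bind 6 (.var 5 * .arr 0 1) <| .bind 7 (.var 1 + .var 6 + 1) <| .seq sieveCmd <|
  .bind 8 (.arr 0 2) <| .seq treeCmd <| .bind 9 (.arr 0 4) <| .seq initCmd <|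
  .seq levelsCmd answerCmd

theorem mainCmd_wf : mainCmd.wf [0, 1, 2] = true := by decide

theorem mainCmd_spec (h : Context x off n m s t k μ p M N Y base) {env : ℕ → ℕ}
    (h0 : env 0 = n) (h1 : env 1 = m) :
    Achieves base (Y ^ 5) x env (fun _ _ => 0) mainCmd
      (100 * (n + M) + 100 * ∑ i ∈ Finset.range (2 * M), (2 * M / (i + 2) + 1) +
        6000 * (N ^ 4 * (m + 1)))
      fun A' => ((∃ r < k, ∃ w e, ConfWalk x off m s r w e ∧ w r = t) → A' 0 7 = 1) ∧
        ((¬ ∃ r < k, ∃ w e, ConfWalk x off m s r w e ∧ w r = t) → A' 0 7 = 0) := by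
  have hx := h.input
  have hN := h.N_lt
  have hkN := h.lt_N
  have hV := h.sq_lt
  have hMe := h.M_eq
  have hM := h.M_lt
  have hbe := h.base_eq
  have hk := hx.k_pos
  obtain ⟨S, hS⟩ : ∃ S, ∑ i ∈ Finset.range (2 * M), (2 * M / (i + 2) + 1) = S := ⟨_, rfl⟩
  have hN4 : 4 * N ^ 3 ≤ 4 * N ^ 4 ∧ 2 * N ≤ N ^ 3 ∧ N ^ 4 ≤ N ^ 4 * (m + 1) := by
    refine ⟨Nat.mul_le_mul_left _ (Nat.pow_le_pow_right (by omega) (by norm_num)), ?_,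
      Nat.le_mul_of_pos_right _ (by omega)⟩
    have : N ^ 3 = N * N * N := by ring
    rw [this, Nat.mul_assoc, Nat.mul_comm 2]
    refine Nat.mul_le_mul_left _ ?_
    calc 2 ≤ N := by omega
      _ ≤ N * N := Nat.le_mul_self N
  obtain ⟨T, hT⟩ : ∃ T, N ^ 4 * (m + 1) = T := ⟨_, rfl⟩
  rw [hS]
  rw [hT] at hN4 ⊢
  have hT4 : 4 ≤ T := by omega
  refine Achieves.bind (B' := 100 * (n + M) + 100 * S + 5900 * T) ?_ ?_ (by simp; omega)
  · simp; omega
  refine Achieves.bind (B' := 100 * (n + M) + 100 * S + 5890 * T) ?_ ?_ (by simp; omega)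
  · simp; omega
  refine Achieves.bind (B' := 100 * (n + M) + 100 * S + 5880 * T) ?_ ?_ (by simp; omega)
  · simp; omega
  refine Achieves.seq (B₁ := 100 * (n + 1)) (B₂ := 100 * M + 100 * S + 5780 * T)
    ((scanCmd_spec h (by simpa using h0) (by simpa using h1) rfl).mono le_rfl
      fun A' hA' hfr => (⟨hA', hfr⟩ : _ ∧ _)) ?_ (by omega)
  rintro A₁ ⟨⟨hoff₁, hmu₁⟩, hf₁⟩
  refine Achieves.bind (B' := 100 * M + 100 * S + 5770 * T) ?_ ?_ (by simp; omega)
  · simp [hx.x_four, hmu₁, ← h.p_eq]; omega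
  refine Achieves.bind (B' := 100 * M + 100 * S + 5760 * T) ?_ ?_ (by simp; omega)
  · simp [hx.x_four, hmu₁, ← h.p_eq, h1]; omega
  refine Achieves.seq (B₁ := 100 * (M + 1) + 100 * S) (B₂ := 5660 * T)
    ((sieveCmd_spec h (by simp [hx.x_four, hmu₁, ← h.p_eq, h1, hMe])
      (fun c => by rw [hf₁ 2 (by decide)])).mono (by rw [hS])
      fun A' hA' hfr => (⟨hA', hfr⟩ : _ ∧ _)) ?_ (by omega)
  rintro A₂ ⟨⟨hprime, hMP, hPM⟩, hf₂⟩
  obtain ⟨P, hP⟩ : ∃ P, A₂ 0 2 = P := ⟨_, rfl⟩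
  rw [hP] at hprime hMP hPM
  have : Fact P.Prime := ⟨hprime⟩
  refine Achieves.bind (B' := 5650 * T) ?_ ?_ (by simp; omega)
  · simp; omega
  refine Achieves.seq (B₁ := 400 * N ^ 3) (B₂ := 5250 * T)
    ((treeCmd_spec h (by simp [hx.x_four]) (by simp [hx.x_four, hmu₁, ← h.p_eq])
      (by rw [hf₂ 4 (by decide), hf₁ 4 (by decide)])).mono le_rfl
      fun A' hA' hfr => (⟨hA', hfr⟩ : _ ∧ _)) ?_ (by omega)
  rintro A₃ ⟨hT₃, hf₃⟩
  have hc₃ : A₃ 0 4 = N := hT₃.count.trans h.N_eq.symm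
  refine Achieves.bind (B' := 5240 * T) ?_ ?_ (by simp; omega)
  · simp; omega
  refine Achieves.seq (B₁ := 50) (B₂ := 5200 * T)
    (initCmd_spec h (by simp [hx.x_two]) (by simp [hx.x_four]) (by simp [hc₃])
      (fun v hv => by rw [hf₃ 1 (by decide), hf₂ 1 (by decide), hoff₁ v hv]) hT₃
      (fun j => by rw [hf₃ 7 (by decide), hf₂ 7 (by decide), hf₁ 7 (by decide)])) ?_ (by omega)
  intro A₄ hL₄
  refine Achieves.seq (B₁ := 5000 * T) (B₂ := 100 * N)
    ((levelsCmd_spec h hMP hPM (by simp [h0]) (by simp [h1]) (by simp [hx.x_four])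
      (by simp [hx.x_four, hmu₁, ← h.p_eq]) (by simp [hP]) (by simp [hc₃]) hL₄).mono
      (by rw [hT]) fun A' hA' _ => hA') ?_ (by omega)
  intro A₅ hL₅
  exact answerCmd_spec h (by simp [h0]) (by simp [hx.x_three]) (by simp [hx.x_four]) hL₅

end RepresentativeWalks

/-! ### The machine program, its running time and the two bounds -/

namespace RepresentativeWalks

open WordRAM

/-- The program: load `n` and `m`, compute the first address behind the input, run the
algorithm and deliver its answer. -/
def program : Prog :=
  .seq (.assign 0 (.load (.const 0))) <|
  .seq (.assign 1 (.load (.const 1))) <|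
  .seq (.assign 2 (.op .add (.op .add (.const 5) (.op .mul (.const 2) (.reg 1)))
    (.op .add (.reg 0) (.op .mul (.reg 0) (.reg 1))))) <|
  .seq mainCmd.toProg (.assign 0 (Term.arr 0 7).toExpr)

theorem exec_program {l : List ℕ} {off : ℕ → ℕ} {n m s t k μ p M N Y base w : ℕ}
    (h : Context (fun a => l.getD a 0) off n m s t k μ p M N Y base) (hl : l.length ≤ base)
    (hle : ∀ a, l.getD a 0 < 2 ^ w) (hw : base + 16 * Y ^ 5 + 16 ≤ 2 ^ w) {Q : Prop}
    (hQ : Q ↔ ∃ r < k, ∃ v e, ConfWalk (fun a => l.getD a 0) off m s r v e ∧ v r = t) :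
    ∃ T τ, Exec w program (initState w l) T τ ∧
      T ≤ 100 * (n + M) + 100 * ∑ i ∈ Finset.range (2 * M), (2 * M / (i + 2) + 1) +
        6000 * (N ^ 4 * (m + 1)) + 40 ∧ (Q → τ.reg 0 = 1) ∧ (¬ Q → τ.reg 0 = 0) := by
  obtain ⟨env, henv⟩ : ∃ env : ℕ → ℕ, env = fun i => if i = 0 then n else if i = 1 then m else
    if i = 2 then base else 0 := ⟨_, rfl⟩
  have h0 : env 0 = n := by simp [henv]
  have h1 : env 1 = m := by simp [henv]
  have h2 : env 2 = base := by simp [henv]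
  obtain ⟨hb, ht, hyes, hno⟩ := mainCmd_spec h h0 h1
  -- The memory behind the input is zero, so all arrays start as constantly `0` without any
  -- initialization. Cells between the end of the input and `base` agree with the default value of
  -- the list.
  have hmem : (initState w l).mem = layout base (fun a => l.getD a 0) (fun _ _ => 0) := by
    funext a
    simp only [initState, layout]
    rw [Nat.mod_eq_of_lt (hle a)]
    split_ifs with ha
    · rfl
    · exact List.getD_eq_default _ _ (by omega)
  have hn : l.getD 0 0 = n := h.input.x_zero
  have hm : l.getD 1 0 = m := h.input.x_one
  have hbe := h.base_eq
  have hY : 16 < Y ^ 5 := lt_of_lt_of_le (by norm_num) (Nat.pow_le_pow_left h.le_Y 5)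
  obtain ⟨τ, hτ, hreg, hτmem⟩ := Cmd.exec_toProg (S := [0, 1, 2]) (env := env)
    (A := fun _ _ => 0) (σ := ⟨Function.update (Function.update (Function.update
      (initState w l).reg 0 n) 1 m) 2 base, (initState w l).mem⟩) hw mainCmd (by simp) h2
      (by simp [h0, h1, h2]) hmem mainCmd_wf hb
  have hans := Term.eval_toExpr hw (by simp) h2 hreg hτmem (Term.arr 0 7) (by simp [Term.wf])
    (by simp; omega)
  have hn0 : Expr.eval w (initState w l) (.load (.const 0)) = n := by
    simp only [Expr.eval, initState, Nat.zero_mod]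
    rw [Nat.mod_eq_of_lt (hle 0), hn]
  have hm1 : Expr.eval w ⟨Function.update (initState w l).reg 0 n, (initState w l).mem⟩
      (.load (.const 1)) = m := by
    simp only [Expr.eval, initState]
    rw [Nat.mod_eq_of_lt (show 1 < 2 ^ w by omega), Nat.mod_eq_of_lt (hle 1), hm]
  have hb2 : Expr.eval w ⟨Function.update (Function.update (initState w l).reg 0 n) 1 m,
      (initState w l).mem⟩ (.op .add (.op .add (.const 5) (.op .mul (.const 2) (.reg 1)))
        (.op .add (.reg 0) (.op .mul (.reg 0) (.reg 1)))) = base := by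
    simp only [Expr.eval, Op.eval, Function.update_self, ne_eq, zero_ne_one, not_false_eq_true,
      Function.update_of_ne]
    rw [Nat.mod_eq_of_lt (show 5 < 2 ^ w by omega), Nat.mod_eq_of_lt (show 2 < 2 ^ w by omega),
      Nat.mod_eq_of_lt (show 2 * m < 2 ^ w by omega),
      Nat.mod_eq_of_lt (show n * m < 2 ^ w by omega),
      Nat.mod_eq_of_lt (show 5 + 2 * m < 2 ^ w by omega),
      Nat.mod_eq_of_lt (show n + n * m < 2 ^ w by omega),
      Nat.mod_eq_of_lt (by omega)]
    omega
  have e0 := Exec.assign (w := w) (initState w l) 0 (.load (.const 0))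
  rw [hn0] at e0
  have e1 := Exec.assign (w := w) ⟨Function.update (initState w l).reg 0 n, (initState w l).mem⟩ 1
    (.load (.const 1))
  rw [hm1] at e1
  have e2 := Exec.assign (w := w) ⟨Function.update (Function.update (initState w l).reg 0 n) 1 m,
      (initState w l).mem⟩ 2 (.op .add (.op .add (.const 5) (.op .mul (.const 2) (.reg 1)))
        (.op .add (.reg 0) (.op .mul (.reg 0) (.reg 1))))
  rw [hb2] at e2
  have e3 := Exec.assign (w := w) τ 0 (Term.arr 0 7).toExpr
  rw [hans] at e3
  refine ⟨_, _, .seq e0 (.seq e1 (.seq e2 (.seq hτ e3))), ?_, fun q => ?_, fun q => ?_⟩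
  · rw [Term.cost_toExpr]
    simp only [Expr.cost, Term.cost]
    have : (7 : Term).cost = 1 := rfl
    omega
  · simpa using hyes (hQ.1 q)
  · simpa using hno (mt hQ.2 q)

/-- Each quotient is at most `a / (i + 1)`, so the sum is bounded by `a` times a harmonic number,
plus `a`. -/
theorem sum_div_le (a : ℕ) (ha : 0 < a) :
    ((∑ i ∈ Finset.range a, (a / (i + 2) + 1) : ℕ) : ℝ) ≤ a * (2 + Real.log a) := by
  have hh : (harmonic a : ℝ) ≤ 1 + Real.log a := harmonic_le_one_add_log a
  have h1 : ((∑ i ∈ Finset.range a, (a / (i + 2) + 1) : ℕ) : ℝ) ≤ a * (harmonic a : ℝ) + a := by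
    rw [harmonic]
    push_cast
    rw [Finset.sum_add_distrib, Finset.mul_sum]
    gcongr with i
    · refine Nat.cast_div_le.trans ?_
      rw [div_eq_mul_inv]
      push_cast
      gcongr
      norm_num
    · simp
  have : (0 : ℝ) < a := by exact_mod_cast ha
  nlinarith

/-- The running time of `program` in terms of `N` and the size of the graph. -/
theorem time_le {n m M N : ℕ} (hn : 2 ≤ n) (hm : 1 ≤ m) (hmn : m ≤ n * n) (hN : 2 ≤ N)
    (hM : 0 < M) (hMN : M ≤ m + N) :
    ((100 * (n + M) + 100 * ∑ i ∈ Finset.range (2 * M), (2 * M / (i + 2) + 1) +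
      6000 * (N ^ 4 * (m + 1)) + 40 : ℕ) : ℝ) ≤
      2 ^ 13 * (N : ℝ) ^ 4 * ((n : ℝ) + m) * Real.logb 2 n := by
  have hn' : (2 : ℝ) ≤ n := by exact_mod_cast hn
  have hm' : (1 : ℝ) ≤ m := by exact_mod_cast hm
  have hmn' : (m : ℝ) ≤ n * n := by exact_mod_cast hmn
  have hN' : (2 : ℝ) ≤ N := by exact_mod_cast hN
  have hM' : (0 : ℝ) < M := by exact_mod_cast hM
  have hMN' : (M : ℝ) ≤ m + N := by exact_mod_cast hMN
  obtain ⟨L, hL⟩ : ∃ L, Real.logb 2 n = L := ⟨_, rfl⟩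
  obtain ⟨s, hs⟩ : ∃ s : ℝ, (n : ℝ) + m = s := ⟨_, rfl⟩
  have hL1 : 1 ≤ L := by
    rw [← hL, Real.le_logb_iff_rpow_le (by norm_num) (by linarith)]; simpa using hn'
  have hs3 : 3 ≤ s := by linarith
  have hMs : (M : ℝ) ≤ N * s := by nlinarith
  -- A simple graph has `m ≤ n ^ 2`, so `n + m ≤ n ^ 3` for `n ≥ 2`; this replaces `log (n + m)` by
  -- `log n`.
  have hlogs : Real.log s ≤ 3 * L := by
    have h1 : s ≤ (n : ℝ) ^ 3 := by nlinarith [mul_nonneg (sub_nonneg.2 hn') (sq_nonneg (n : ℝ))]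
    have h2 : Real.log s ≤ 3 * Real.log n := by
      have := Real.log_le_log (by linarith) h1
      rwa [Real.log_pow] at this
    have h3 : Real.log n ≤ L := by
      rw [← hL, Real.logb, le_div_iff₀ (Real.log_pos one_lt_two)]
      have := Real.log_two_lt_d9
      nlinarith [Real.log_nonneg (show (1 : ℝ) ≤ n by linarith)]
    linarith
  -- The estimate `log (2 * N) ≤ 2 * N` is wasteful, but factors `N` can be absorbed into `N ^ 4`.
  have hlogM : Real.log ((2 * M : ℕ) : ℝ) ≤ 2 * N + 3 * L := by
    calc Real.log ((2 * M : ℕ) : ℝ) ≤ Real.log (2 * N * s) := by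
          refine Real.log_le_log (by push_cast; linarith) ?_
          push_cast
          linarith
      _ = Real.log (2 * N) + Real.log s := Real.log_mul (by positivity) (by positivity)
      _ ≤ _ := by
          have := Real.log_le_sub_one_of_pos (show (0 : ℝ) < 2 * N by linarith)
          linarith
  have hNL : (N : ℝ) ≤ N * L := by nlinarith
  have hLN : L ≤ N * L := by nlinarith
  have hsum := sum_div_le (2 * M) (by omega)
  have hS : ((∑ i ∈ Finset.range (2 * M), (2 * M / (i + 2) + 1) : ℕ) : ℝ) ≤
      14 * (N ^ 2 * s * L) := by
    refine hsum.trans ?_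
    calc ((2 * M : ℕ) : ℝ) * (2 + Real.log ((2 * M : ℕ) : ℝ)) ≤ 2 * (N * s) * (7 * (N * L)) := by
          push_cast at hlogM ⊢
          refine mul_le_mul (by linarith) (by nlinarith) ?_ (by positivity)
          have := Real.log_nonneg (show (1 : ℝ) ≤ 2 * M by
            have : (1 : ℝ) ≤ M := by exact_mod_cast hM
            linarith)
          linarith
      _ = _ := by ring
  have hP : (N : ℝ) ^ 2 * s * L ≤ N ^ 4 * s * L := by
    gcongr ?_ * s * L
    exact pow_le_pow_right₀ (by linarith) (by norm_num)
  have hR : (N : ℝ) * s ≤ N ^ 4 * s * L := by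
    calc (N : ℝ) * s ≤ N ^ 4 * s := by
          gcongr
          exact le_self_pow₀ (by linarith) (by norm_num)
      _ ≤ _ := le_mul_of_one_le_right (by positivity) hL1
  have hU : (N : ℝ) ^ 4 * (m + 1) ≤ N ^ 4 * s * L := by
    calc (N : ℝ) ^ 4 * (m + 1) ≤ N ^ 4 * s := by
          gcongr
          linarith
      _ ≤ _ := le_mul_of_one_le_right (by positivity) hL1
  have hns : (n : ℝ) ≤ N * s := by nlinarith
  have h40 : (6 : ℝ) ≤ N * s := by nlinarith
  rw [Nat.cast_add, Nat.cast_add, Nat.cast_add, Nat.cast_mul 100 (∑ i ∈ _, _)]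
  push_cast at hS ⊢
  rw [hL, hs]
  linarith

theorem two_le_of_one_le_mu {n : ℕ} (I : PathInstance n) (h : 1 ≤ I.mu) : 2 ≤ n := by
  by_contra hn
  have : Subsingleton (Fin n) := Fin.subsingleton_iff_le_one.2 (by omega)
  have h0 : I.mu = 0 := by
    refine Nat.le_zero.1 (Finset.sup_le fun v _ => ?_)
    rw [Nat.le_zero, Finset.card_eq_zero, Finset.eq_empty_iff_forall_notMem]
    intro e he
    have := I.del_subset v e he
    induction e with
    | _ a b =>
      rw [SimpleGraph.mem_edgeSet] at this
      exact this.ne (Subsingleton.elim a b)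
  omega

/-- This reduces both claims to a bound on `pointCount`. The time is at most `2 ^ 13 * N ^ 4 * (n +
m) * log n`, and `2 ^ 20 * (N * (n + m)) ^ 5` bounds the memory in use. With `N ≤ 2 ^ (c * g)` and
`g ≥ 1`, the constant `20 + 5 * c` covers the exponents of both. -/
theorem solvable_of_pointCount_le {g : ℕ → ℕ → ℝ} {c : ℝ} (hc : 0 ≤ c)
    (hg : ∀ k μ, 1 ≤ k → 1 ≤ μ → 1 ≤ g k μ)
    (hN : ∀ k μ, 1 ≤ k → 1 ≤ μ → (pointCount (k * μ) k : ℝ) ≤ 2 ^ (c * g k μ)) :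
    ShortestPathSolvableInTime g := by
  refine ⟨program, 20 + 5 * c, fun n I l hmu hl w hw => ?_⟩
  obtain ⟨off, hin, hmn, hlen, hval, hyes⟩ := exists_isInput hl
  have hk := I.k_pos
  obtain ⟨N, hNe⟩ : ∃ N, pointCount (I.k * I.mu) I.k = N := ⟨_, rfl⟩
  obtain ⟨m, hme⟩ : ∃ m, I.edgeCount = m := ⟨_, rfl⟩
  have hn2 := two_le_of_one_le_mu I hmu
  have hkN := lt_pointCount_right (I.k * I.mu) I.k
  have hpN := lt_pointCount_left (I.k * I.mu) hk
  have hg1 := hg I.k I.mu hk hmu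
  have hNg := hN I.k I.mu hk hmu
  rw [hNe] at hkN hpN hNg
  rw [hme] at hin hmn hlen hval hyes hw ⊢
  have hm1 : 1 ≤ m := by
    obtain ⟨v, hv, hvm⟩ := hin.mu_attained
    have := hin.length_le v hv
    omega
  have hNs : N + (n + m) ≤ N * (n + m) := by nlinarith
  -- The choice `Y = 8 * (N * (n + m))` dominates `n`, `N` and `4 * M + 2`, because `k * μ + 1 < N`
  -- and a sum of two numbers that are at least `2` is at most their product.
  have hctx : Context (fun a => l.getD a 0) off n m I.s I.t I.k I.mu (I.k * I.mu)
      (m + I.k * I.mu + 1) N (8 * (N * (n + m))) (5 + 2 * m + n + n * m) :=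
    { input := hin
      p_eq := rfl
      M_eq := rfl
      N_eq := hNe.symm
      base_eq := rfl
      n_le := by omega
      N_lt := by omega
      M_lt := by omega
      le_Y := by omega }
  have hs : (1 : ℝ) ≤ (n : ℝ) + m := by
    have : (2 : ℝ) ≤ n := by exact_mod_cast hn2
    linarith [Nat.cast_nonneg (α := ℝ) m]
  have hL0 : 0 ≤ Real.logb 2 ((n : ℝ) + m) := Real.logb_nonneg one_lt_two hs
  have hcg : c ≤ c * g I.k I.mu := le_mul_of_one_le_right hc hg1
  -- With this `Y` the arrays take `16 * Y ^ 5 = 2 ^ 19 * (N * (n + m)) ^ 5` cells; the remaining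
  -- factor `2` makes room for the input and a constant.
  have hword : 2 ^ 20 * (N * (n + m)) ^ 5 ≤ 2 ^ w := by
    have h1 : (2 : ℝ) ^ (20 : ℝ) * (2 ^ (c * g I.k I.mu) *
        2 ^ Real.logb 2 ((n : ℝ) + m)) ^ (5 : ℕ) ≤ 2 ^ (w : ℝ) := by
      rw [← Real.rpow_add two_pos, ← Real.rpow_mul_natCast two_pos.le, ← Real.rpow_add two_pos]
      refine Real.rpow_le_rpow_of_exponent_le one_le_two (le_trans ?_ hw)
      push_cast
      nlinarith [mul_nonneg hc hL0]
    rw [Real.rpow_logb two_pos (by norm_num) (by linarith)] at h1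
    have h2 : (2 : ℝ) ^ (20 : ℝ) * ((N : ℝ) * ((n : ℝ) + m)) ^ 5 ≤ 2 ^ (w : ℝ) := by
      refine le_trans ?_ h1
      gcongr
    have e20 : (2 : ℝ) ^ (20 : ℝ) = 2 ^ 20 := by exact_mod_cast Real.rpow_natCast 2 20
    rw [Real.rpow_natCast, e20] at h2
    exact_mod_cast h2
  have hb := hctx.base_lt
  have hY5 : (8 * (N * (n + m))) ^ 5 = 2 ^ 15 * (N * (n + m)) ^ 5 := by
    rw [mul_pow]; norm_num
  have hself : N * (n + m) ≤ (N * (n + m)) ^ 5 := Nat.le_self_pow (by norm_num) _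
  obtain ⟨T, τ, hex, hT, hy, hno⟩ := exec_program hctx (by rw [Nat.mul_add] at hlen; omega)
    (fun a => lt_of_le_of_lt (hval a) (by omega)) (w := w) (by rw [hY5] at hb ⊢; omega) hyes
  refine ⟨T, τ, hex, ?_, hy, hno⟩
  have hL : 0 ≤ Real.logb 2 (n : ℝ) := Real.logb_nonneg one_lt_two (by
    have : 1 ≤ n := by omega
    exact_mod_cast this)
  calc (T : ℝ) ≤ _ := by exact_mod_cast hT
    _ ≤ 2 ^ 13 * (N : ℝ) ^ 4 * ((n : ℝ) + m) * Real.logb 2 n :=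
        time_le hn2 hm1 hmn (by omega) (by omega) (by omega)
    _ ≤ _ := by
        gcongr ?_ * _ * _
        calc (2 : ℝ) ^ 13 * (N : ℝ) ^ 4 ≤ 2 ^ (13 : ℝ) * (2 ^ (c * g I.k I.mu)) ^ (4 : ℕ) := by
              have e13 : (2 : ℝ) ^ (13 : ℝ) = 2 ^ 13 := by exact_mod_cast Real.rpow_natCast 2 13
              rw [e13]
              gcongr
          _ = 2 ^ (13 + c * g I.k I.mu * (4 : ℕ)) := by
              rw [← Real.rpow_mul_natCast two_pos.le, ← Real.rpow_add two_pos]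
          _ ≤ _ := by
              refine Real.rpow_le_rpow_of_exponent_le one_le_two ?_
              push_cast
              nlinarith

/-- A binomial coefficient is at most two to the power of its upper entry, here `k * μ + k + 2 ≤ 4 *
(μ * k)`. -/
theorem pointCount_le_two_rpow_mul {k μ : ℕ} (hk : 1 ≤ k) (hμ : 1 ≤ μ) :
    (pointCount (k * μ) k : ℝ) ≤ 2 ^ (4 * ((μ : ℝ) * k)) := by
  have h1 : pointCount (k * μ) k ≤ 2 ^ (4 * (μ * k)) := by
    refine (pointCount_le_choose _ _).trans ((Nat.choose_le_two_pow _ _).trans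
      (Nat.pow_le_pow_right two_pos ?_))
    nlinarith
  calc (pointCount (k * μ) k : ℝ) ≤ ((2 ^ (4 * (μ * k)) : ℕ) : ℝ) := by exact_mod_cast h1
    _ = _ := by
        rw [Nat.cast_pow, ← Real.rpow_natCast]
        push_cast
        rfl

/-- Here the estimate is `a.choose k ≤ a ^ k` with `a = k * μ + k + 2`. For `b = max μ 2` one has `a
≤ 3 * (k * b) ≤ (k * b) ^ 3`, the last step because `k * b ≥ 2`; the exponent `3` becomes the
constant. -/
theorem pointCount_le_two_rpow_logb {k μ : ℕ} (hk : 1 ≤ k) :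
    (pointCount (k * μ) k : ℝ) ≤
      2 ^ (3 * ((k : ℝ) * Real.logb 2 ((k : ℝ) * ((max μ 2 : ℕ) : ℝ)))) := by
  obtain ⟨b, hb⟩ : ∃ b, max μ 2 = b := ⟨_, rfl⟩
  have hb2 : 2 ≤ b := hb ▸ le_max_right _ _
  have hμb : μ ≤ b := hb ▸ le_max_left _ _
  have h1 : pointCount (k * μ) k ≤ ((k * b) ^ 3) ^ k := by
    refine (pointCount_le_choose _ _).trans ((Nat.choose_le_pow _ _).trans
      (Nat.pow_le_pow_left ?_ _))
    have h2 : k * μ ≤ k * b := Nat.mul_le_mul_left _ hμb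
    have h3 : 2 * k ≤ k * b := by nlinarith
    have h4 : 3 * (k * b) ≤ (k * b) ^ 3 := by
      have : 2 ≤ k * b := by omega
      obtain ⟨z, hz⟩ : ∃ z, k * b = z := ⟨_, rfl⟩
      rw [hz] at this ⊢
      nlinarith [Nat.mul_le_mul this this]
    omega
  have hpos : (0 : ℝ) < (k : ℝ) * b := by positivity
  rw [hb]
  calc (pointCount (k * μ) k : ℝ) ≤ ((((k * b) ^ 3) ^ k : ℕ) : ℝ) := by exact_mod_cast h1
    _ = ((k : ℝ) * b) ^ (3 * (k : ℝ)) := by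
        rw [← pow_mul, Nat.cast_pow, ← Real.rpow_natCast]
        push_cast
        rfl
    _ = _ := by
        conv_lhs => rw [← Real.rpow_logb two_pos (by norm_num) hpos, ← Real.rpow_mul two_pos.le]
        congr 1
        ring

end RepresentativeWalks

theorem mainTheorem3 :
    ShortestPathSolvableInTime
      (fun k μ => (k : ℝ) * Real.logb 2 ((k : ℝ) * ((max μ 2 : ℕ) : ℝ))) ∧
    ShortestPathSolvableInTime (fun k μ => (μ : ℝ) * (k : ℝ)) := by
  refine ⟨RepresentativeWalks.solvable_of_pointCount_le (c := 3) (by norm_num) (fun k μ hk hμ => ?_)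
    fun k μ hk _ => RepresentativeWalks.pointCount_le_two_rpow_logb hk,
    RepresentativeWalks.solvable_of_pointCount_le (c := 4) (by norm_num) (fun k μ hk hμ => ?_)
    fun k μ hk hμ => RepresentativeWalks.pointCount_le_two_rpow_mul hk hμ⟩
  · have h2 : (2 : ℝ) ≤ (max μ 2 : ℕ) := by exact_mod_cast le_max_right μ 2
    have h1 : (1 : ℝ) ≤ k := by exact_mod_cast hk
    -- The maximum with `2` keeps the argument of the logarithm at least `2` even for `k = μ = 1`.
    have h3 : 1 ≤ Real.logb 2 ((k : ℝ) * (max μ 2 : ℕ)) := by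
      rw [Real.le_logb_iff_rpow_le (by norm_num) (by nlinarith), Real.rpow_one]
      nlinarith
    exact one_le_mul_of_one_le_of_one_le h1 h3
  · exact_mod_cast one_le_mul_of_one_le_of_one_le (M₀ := ℕ) hμ hk
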